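/- **Theorem 2 (Degenerate $N$-soliton solution).** Let $N\ge 1$, $r_1>0$, $0<\alpha_1<\dots<\alpha_N<\pi$, $\lambda_k=r_1e^{i\alpha_k}$, $\omega_k\in\mathbb C\setminus\{0\}$ $(1\le k\le N)$ and $D_-\in\{1,-1\}$. Put $\theta(\lambda;t,z)=\lambda t-\frac{D_-}{2\lambda}z$, $\sigma_3=\mathrm{diag}(1,-1)$ and $V=-2D_-r_1^2$. *Residue form of the Riemann–Hilbert problem (RHP).* For $(t,z)\in\mathbb R^2$ seek $\mathbf M(\lambda)=\mathbf M(\lambda;t,z)\in\mathbb C^{2\times2}$, analytic in $\lambda$ off the points $\lambda_k,\bar\lambda_k$, where it has at most simple poles, with $\mathbf M\to\mathbb I$ as $\lambda\to\infty$ and $$\operatorname*{Res}_{\lambda_k}\mathbf M=\lim_{\lambda\to\lambda_k}\mathbf M(\lambda)\begin{pmatrix}0&0\\ \omega_ke^{-2i\theta(\lambda;t,z)}&0\end{pmatrix},\qquad \operatorname*{Res}_{\bar\lambda_k}\mathbf M=\lim_{\lambda\to\bar\lambda_k}\mathbf M(\lambda)\begin{pmatrix}0&-\bar\omega_ke^{2i\theta(\lambda;t,z)}\\0&0\end{pmatrix}.$$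 *Jump form.* Let $\epsilon>0$ be such that the closed disks of radius $\epsilon$ about all $\lambda_k,\bar\lambda_k$ are pairwise disjoint and do not meet $\mathbb R$. Seek $\mathbf M$ analytic off the boundary circles, with continuous boundary values $\mathbf M^{+}$ (from inside) and $\mathbf M^-$ (from outside), $\mathbf M\to\mathbb I$ as $\lambda\to\infty$, and $\mathbf M^+(\lambda)=\mathbf M^-(\lambda)\mathbf V_k(\lambda)^{-1}$ on $|\lambda-\lambda_k|=\epsilon$, $\mathbf M^+(\lambda)=\mathbf M^-(\lambda)\mathbf V_k(\bar\lambda)^{\dagger}$ on $|\lambda-\bar\lambda_k|=\epsilon$, where $\mathbf V_k(\lambda)=\begin{pmatrix}1&0\\ \frac{\omega_ke^{-2i\theta(\lambda;t,z)}}{\lambda-\lambda_k}&1\end{pmatrix}$. For every $(t,z)\in\mathbb R^2$ both problems have a unique solution (up to the values at the poles, respectively on the circles), $\mathbf M(0;t,z)$ is invertible, and the formulae $$\begin{pmatrix}0&q\\-\bar q&0\end{pmatrix}=\lim_{\lambda\to\infty}i\lambda[\mathbf M(\lambda;t,z),\sigma_3],\qquad \begin{pmatrix}D&P\\ \bar P&-D\end{pmatrix}=D_-\mathbf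 M(0;t,z)\sigma_3\mathbf M(0;t,z)^{-1}$$ give, for both forms, the same functions $q,P:\mathbb R^2\to\mathbb C$, $D:\mathbb R^2\to\mathbb R$, which are a classical solution of the Maxwell–Bloch equations $q_z=-P$, $P_t=-2qD$, $D_t=2\operatorname{Re}(\bar qP)$ with $q\to0$, $D\to D_-$, $P\to0$ as $t\to-\infty$ for each $z$. This $N$-soliton solution (an $N$-DSG) has the following properties. 1. All $N$ solitons travel coherently with the velocity $V$: for each $k$, $V$ is the only real $\xi$ with $\operatorname{Im}\theta(\lambda_k;t,\xi t)=0$ for all $t$; and $q(t,Vt)$ does not tend to $0$ as $t\to+\infty$, nor as $t\to-\infty$. 2. The solution is localized along $z=Vt$: there are constants $C$ and $\kappa>0$ such that $|q(t,z)|$, $|D(t,z)-D_-|$ and $|P(t,z)|$ are at most $Ce^{-\kappa|z-Vt|}$ for all $(t,z)\in\mathbb R^2$. Along every other direction $z=\xi t$, $\xi\neq V$, there is $\aleph>0$ such that, as $t\to\pm\infty$, $q=\mathcal O(e^{-\aleph|t|})$, $D=D_-+\mathcal O(e^{-\aleph|t|})$ and $P=\mathcal O(e^{-\aleph|t|})$.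 3. Let $E_l=\omega_le^{-2i\theta(\lambda_l;t,z)}$, $\boldsymbol\Gamma=\Big(\frac{E_l}{\bar\lambda_k-\lambda_l}\Big)_{k,l=1}^N$ and let $\overline{\boldsymbol\Gamma}$ be its entrywise conjugate. Then $\det(\mathbb I+\boldsymbol\Gamma\overline{\boldsymbol\Gamma})\ne0$ and $q=2i-2i\,\frac{\det(\mathbb I-\vec{\mathbf 1}(\bar E_1,\dots,\bar E_N)+\boldsymbol\Gamma\overline{\boldsymbol\Gamma})}{\det(\mathbb I+\boldsymbol\Gamma\overline{\boldsymbol\Gamma})}$, with $\vec{\mathbf 1}=(1,\dots,1)^\top$. For fixed $t$, call $c$ the center of the $N$-DSG if the leading-order terms of the denominator $\det(\mathbb I+\boldsymbol\Gamma\overline{\boldsymbol\Gamma})$ as $z\to-\infty$ and as $z\to+\infty$, which are exponentials $e^{a_1z+b_1}$ and $e^{a_2z+b_2}$ with real coefficients and $a_1\ne a_2$, coincide at $z=c$. The center exists, is unique, and equals $$z_{\mathrm c}(t)=Vt+z_{\mathrm d},\qquad z_{\mathrm d}=-\frac{D_-r_1}{\sum_{k}\sin\alpha_k}\ln\Bigg(\prod_{k=1}^N|\omega_k|\cdot\frac{\prod_{k=2}^N\prod_{l=1}^{k-1}|\lambda_k-\lambda_l|^2}{\prod_{k=1}^N\prod_{l=1}^N|\bar\lambda_k-\lambda_l|}\Bigg).$$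 4. Along $z=Vt$ the solutions of both RHPs are bounded in $t\in\mathbb R$: for the residue form, uniformly in $\lambda$ outside any fixed neighbourhood of the poles; for the jump form, uniformly in $\lambda$ outside the closed disks of radius $\epsilon$ (where it coincides with the solution of the residue form). -/

import Mathlib

open scoped Topology ComplexConjugate
open Filter Asymptotics

namespace MaxwellBloch

noncomputable section

/-- The linear dispersion relation `θ(λ; t, z) = λ t - D₋ z / (2 λ)`. -/
def theta (Dm : ℝ) (w : ℂ) (t z : ℝ) : ℂ := w * t - (Dm : ℂ) / (2 * w) * z

/-- The eigenvalues `r e^{i α_k}` of a single group with common modulus `r`. -/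
def eigenvalue {N : ℕ} (r : ℝ) (α : Fin N → ℝ) (k : Fin N) : ℂ :=
  (r : ℂ) * Complex.exp (Complex.I * (α k : ℂ))

/-- The eigenvalues together with their complex conjugates. -/
def poleSet {N : ℕ} (lam : Fin N → ℂ) : Set ℂ :=
  Set.range lam ∪ Set.range (fun k => conj (lam k))

/-- The Pauli matrix `σ₃`. -/
def sigma3 : Matrix (Fin 2) (Fin 2) ℂ := !![1, 0; 0, -1]

/-! ### The Riemann-Hilbert problem in residue form -/

/-- `M` solves the Riemann-Hilbert problem with simple poles at the eigenvalues `lam k` and their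
conjugates, norming constants `ω k`, at the point `(t, z)`.  The limit `R` of `(w - p) M(w)` is the
residue at the (at most simple) pole `p`.  The values of `M` at the poles are irrelevant. -/
structure IsResidueRHPSolution {N : ℕ} (lam ω : Fin N → ℂ) (Dm t z : ℝ)
    (M : ℂ → Matrix (Fin 2) (Fin 2) ℂ) : Prop where
  analytic : ∀ i j, DifferentiableOn ℂ (fun w => M w i j) (poleSet lam)ᶜ
  tendsto_one : Tendsto M (cocompact ℂ) (𝓝 1)
  residue_upper : ∀ k, ∃ R : Matrix (Fin 2) (Fin 2) ℂ,
    Tendsto (fun w => (w - lam k) • M w) (𝓝[≠] (lam k)) (𝓝 R) ∧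
    Tendsto (fun w => M w *
        !![0, 0; ω k * Complex.exp (-2 * Complex.I * theta Dm w t z), 0])
      (𝓝[≠] (lam k)) (𝓝 R)
  residue_lower : ∀ k, ∃ R : Matrix (Fin 2) (Fin 2) ℂ,
    Tendsto (fun w => (w - conj (lam k)) • M w) (𝓝[≠] (conj (lam k))) (𝓝 R) ∧
    Tendsto (fun w => M w *
        !![0, -conj (ω k) * Complex.exp (2 * Complex.I * theta Dm w t z); 0, 0])
      (𝓝[≠] (conj (lam k))) (𝓝 R)

/-! ### The Riemann-Hilbert problem in jump form -/

/-- The radius `ε` is admissible: the closed disks of radius `ε` about the eigenvalues (in the upper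
half plane) and about their conjugates are pairwise disjoint and do not meet the real line. -/
def AdmissibleRadius {N : ℕ} (lam : Fin N → ℂ) (ε : ℝ) : Prop :=
  0 < ε ∧ (∀ k, ε < (lam k).im) ∧ ∀ k l, k ≠ l → 2 * ε < dist (lam k) (lam l)

/-- The union of all circles of radius `ε` about the eigenvalues and their conjugates. -/
def contour {N : ℕ} (lam : Fin N → ℂ) (ε : ℝ) : Set ℂ :=
  ⋃ p ∈ poleSet lam, Metric.sphere p ε

/-- The union of all closed disks of radius `ε` about the eigenvalues and their conjugates. -/
def closedDisks {N : ℕ} (lam : Fin N → ℂ) (ε : ℝ) : Set ℂ :=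
  ⋃ p ∈ poleSet lam, Metric.closedBall p ε

/-- The jump matrix attached to the eigenvalue `lam k`. -/
def jumpMatrix {N : ℕ} (lam ω : Fin N → ℂ) (Dm t z : ℝ) (k : Fin N) (w : ℂ) :
    Matrix (Fin 2) (Fin 2) ℂ :=
  !![1, 0; ω k * Complex.exp (-2 * Complex.I * theta Dm w t z) / (w - lam k), 1]

/-- `M` solves the Riemann-Hilbert problem with jumps across the circles of radius `ε` about the
eigenvalues and their conjugates.  The circles are oriented counterclockwise, so that the `+` side
is the inside (`Mp`) and the `-` side is the outside (`Mm`). -/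
structure IsJumpRHPSolution {N : ℕ} (lam ω : Fin N → ℂ) (Dm t z ε : ℝ)
    (M : ℂ → Matrix (Fin 2) (Fin 2) ℂ) : Prop where
  analytic : ∀ i j, DifferentiableOn ℂ (fun w => M w i j) (contour lam ε)ᶜ
  tendsto_one : Tendsto M (cocompact ℂ) (𝓝 1)
  jump_upper : ∀ k, ∃ Mp Mm : ℂ → Matrix (Fin 2) (Fin 2) ℂ,
    ContinuousOn Mp (Metric.sphere (lam k) ε) ∧ ContinuousOn Mm (Metric.sphere (lam k) ε) ∧
    ∀ w ∈ Metric.sphere (lam k) ε,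
      Tendsto M (𝓝[Metric.ball (lam k) ε] w) (𝓝 (Mp w)) ∧
      Tendsto M (𝓝[(Metric.closedBall (lam k) ε)ᶜ] w) (𝓝 (Mm w)) ∧
      Mp w = Mm w * (jumpMatrix lam ω Dm t z k w)⁻¹
  jump_lower : ∀ k, ∃ Mp Mm : ℂ → Matrix (Fin 2) (Fin 2) ℂ,
    ContinuousOn Mp (Metric.sphere (conj (lam k)) ε) ∧
    ContinuousOn Mm (Metric.sphere (conj (lam k)) ε) ∧
    ∀ w ∈ Metric.sphere (conj (lam k)) ε,
      Tendsto M (𝓝[Metric.ball (conj (lam k)) ε] w) (𝓝 (Mp w)) ∧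
      Tendsto M (𝓝[(Metric.closedBall (conj (lam k)) ε)ᶜ] w) (𝓝 (Mm w)) ∧
      Mp w = Mm w * (jumpMatrix lam ω Dm t z k (conj w)).conjTranspose

/-! ### Reconstruction and the Maxwell-Bloch equations -/

/-- The reconstruction formula at one point `(t, z)`: the optical pulse `q`, the population inversion
`D` and the polarization `P` are read off from `M` by
`Q = lim_{λ → ∞} i λ [M(λ), σ₃]` and `ρ = D₋ M(0) σ₃ M(0)⁻¹`. -/
def Reconstructs (Dm : ℝ) (M : ℂ → Matrix (Fin 2) (Fin 2) ℂ) (q : ℂ) (D : ℝ) (P : ℂ) : Prop :=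
  Tendsto (fun w : ℂ => (Complex.I * w) • (M w * sigma3 - sigma3 * M w)) (cocompact ℂ)
    (𝓝 !![0, q; -conj q, 0]) ∧
  IsUnit (M 0).det ∧
  (Dm : ℂ) • (M 0 * sigma3 * (M 0)⁻¹) = !![(D : ℂ), P; conj P, -(D : ℂ)]

/-- `(q, D, P)` is a classical solution of the sharp-line Maxwell-Bloch equations
`q_z = -P`, `P_t = -2 q D`, `D_t = 2 Re (q̄ P)` with
`q → 0`, `D → D₋`, `P → 0` as `t → -∞`. -/
structure IsMBESolution (Dm : ℝ) (q : ℝ → ℝ → ℂ) (D : ℝ → ℝ → ℝ) (P : ℝ → ℝ → ℂ) : Prop where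
  contDiff_q : ContDiff ℝ 1 (fun p : ℝ × ℝ => q p.1 p.2)
  contDiff_D : ContDiff ℝ 1 (fun p : ℝ × ℝ => D p.1 p.2)
  contDiff_P : ContDiff ℝ 1 (fun p : ℝ × ℝ => P p.1 p.2)
  q_z : ∀ t z, HasDerivAt (fun z' => q t z') (-P t z) z
  P_t : ∀ t z, HasDerivAt (fun t' => P t' z) (-2 * q t z * (D t z : ℂ)) t
  D_t : ∀ t z, HasDerivAt (fun t' => D t' z) (2 * (conj (q t z) * P t z).re) t
  q_past : ∀ z, Tendsto (fun t => q t z) atBot (𝓝 0)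
  D_past : ∀ z, Tendsto (fun t => D t z) atBot (𝓝 Dm)
  P_past : ∀ z, Tendsto (fun t => P t z) atBot (𝓝 0)

/-! ### The determinantal solution formula and the center -/

/-- `ω_k e^{-2 i θ(λ_k; t, z)}`. -/
def expCoeff {N : ℕ} (lam ω : Fin N → ℂ) (Dm t z : ℝ) (k : Fin N) : ℂ :=
  ω k * Complex.exp (-2 * Complex.I * theta Dm (lam k) t z)

/-- The `N × N` matrix `Γ` with entries `ω_l e^{-2 i θ_l} / (λ̄_k - λ_l)`. -/
def Gamma {N : ℕ} (lam ω : Fin N → ℂ) (Dm t z : ℝ) : Matrix (Fin N) (Fin N) ℂ :=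
  Matrix.of fun k l => expCoeff lam ω Dm t z l / (conj (lam k) - lam l)

/-- The denominator `det (I + Γ Γ̄)` of the soliton solution (`Γ̄` is the entrywise conjugate). -/
def solitonDenominator {N : ℕ} (lam ω : Fin N → ℂ) (Dm t z : ℝ) : ℂ :=
  (1 + Gamma lam ω Dm t z * (Gamma lam ω Dm t z).map conj).det

/-- The numerator `det (I - 𝟏 C̄_∞ + Γ Γ̄)`, where `𝟏` is the column of ones and `C_∞` is the row of
the `ω_l e^{-2 i θ_l}`. -/
def solitonNumerator {N : ℕ} (lam ω : Fin N → ℂ) (Dm t z : ℝ) : ℂ :=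
  (1 - Matrix.of (fun _ l => conj (expCoeff lam ω Dm t z l)) +
    Gamma lam ω Dm t z * (Gamma lam ω Dm t z).map conj).det

/-- `c` is the center of the profile `f` (a denominator as a function of `z`, at fixed `t`):
`f` has purely exponential leading-order terms as `z → -∞` and as `z → +∞`, with different
exponents, and `c` is the point where these two leading-order terms match. -/
def IsMatchingCenter (f : ℝ → ℂ) (c : ℝ) : Prop :=
  ∃ a₁ b₁ a₂ b₂ : ℝ, a₁ ≠ a₂ ∧
    Tendsto (fun z : ℝ => f z / (Real.exp (a₁ * z + b₁) : ℂ)) atBot (𝓝 1) ∧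
    Tendsto (fun z : ℝ => f z / (Real.exp (a₂ * z + b₂) : ℂ)) atTop (𝓝 1) ∧
    Real.exp (a₁ * c + b₁) = Real.exp (a₂ * c + b₂)

/-- The velocity `V = -2 D₋ r²`. -/
def velocity (Dm r : ℝ) : ℝ := -2 * Dm * r ^ 2

/-- The displacement `z_d` of a group with eigenvalues `r e^{i α_k}`. -/
def displacement {N : ℕ} (Dm r : ℝ) (α : Fin N → ℝ) (ω : Fin N → ℂ) : ℝ :=
  -(Dm * r / ∑ k, Real.sin (α k)) *
    Real.log ((∏ k, ‖ω k‖) *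
      ((∏ k, ∏ l ∈ Finset.Iio k, ‖eigenvalue r α k - eigenvalue r α l‖ ^ 2) /
        ∏ k, ∏ l, ‖conj (eigenvalue r α k) - eigenvalue r α l‖))

end

end MaxwellBloch

/-! Write e_k for `expCoeff` at λ_k. A solution is determined by the residues of its first row, `x`
at the λ_k and `u` at their conjugates; the second row follows by conjugation symmetry. The residue
conditions become the linear system `IsSystemSolution`, which reduces to (1 + Γ Γ̄) μ = 𝟏 with u_k =
-ē_k μ_k. Positivity drives the proof. The matrix G = `gram` is the Gram matrix of the functions
e^{iλ_l s} in L²(0, ∞), and 1 + Γ Γ̄ = G (G⁻¹ + diag(e) Gᵀ diag(e)ᴴ), where the bracket is positive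
definite plus positive semidefinite. Hence the system is solvable for every e
(`systemMatrix_det_ne_zero`), its solution is smooth in e, and it is bounded uniformly in e. For the
Maxwell–Bloch equations, explicit flows of x and u, of the kind a Lax pair gives, are shown to solve
the differentiated system. The homogeneous system has only the zero solution, so they are the
derivatives (`IsSystemSolution.derivative_eq`). The algebraic input is det M(0) = 1. Equal moduli
give 1/λ = λ̄ / r², so every |e_k| depends on (t, z) only through z - V t, and all of them tend to 0
on one side of the line and to infinity on the other. `exists_muCoef_bound` and `exists_uCoef_bound`
make u decay on both sides. The same two regimes give the leading terms 1 and (|det G| ∏ |e_k|)² of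
the denominator, and Cauchy's determinant evaluates |det G|, whence the center. Along z = V t the
e_k keep their moduli and stay in a compact torus. If q tended to 0 there, a limiting solution would
have q = 0 on the whole line; a monotone quantity and a second limit also force M₁₂(0) = 0, so each
u_k becomes a pure exponential with its own frequency, and Σ u_k = 0 gives u = 0, which is
impossible (`not_tendsto_pulse_zero`). The two Riemann–Hilbert problems are exchanged by multiplying
by 1 ± A/(w - p) inside the disks. Passing from jump to residue form uses that a continuous function
holomorphic off a circle is holomorphic (`differentiableOn_of_off_circle`). -/

namespace MaxwellBloch

open Matrix MeasureTheory Polynomial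
open scoped ComplexOrder

/-! ### The modulus of a Cauchy determinant. -/

section CauchyDeterminant

variable {N : ℕ}

theorem prod_erase_eq_prod_Iio_sq (f : Fin N → Fin N → ℝ) (hf : ∀ i j, f i j = f j i) :
    ∏ j, ∏ l ∈ Finset.univ.erase j, f j l = ∏ k, ∏ l ∈ Finset.Iio k, f k l ^ 2 := by
  have h1 : ∀ j : Fin N, ∏ l ∈ Finset.univ.erase j, f j l =
      (∏ l ∈ Finset.Iio j, f j l) * ∏ l ∈ Finset.Ioi j, f j l := by
    intro j
    rw [← Finset.prod_union]
    · congr 1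
      ext l
      simp [lt_or_lt_iff_ne]
    · rw [Finset.disjoint_left]
      intro l hl hl'
      simp only [Finset.mem_Iio, Finset.mem_Ioi] at hl hl'
      exact absurd hl' (not_lt.mpr hl.le)
  have h2 : ∏ j, ∏ l ∈ Finset.Ioi j, f j l = ∏ j, ∏ l ∈ Finset.Iio j, f j l := by
    rw [Finset.prod_comm' (t' := Finset.univ) (s' := fun l => Finset.Iio l) (by simp)]
    exact Finset.prod_congr rfl fun j _ => Finset.prod_congr rfl fun l _ => hf _ _
  simp_rw [h1, Finset.prod_mul_distrib, h2, Finset.prod_pow, sq]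

theorem norm_det_vandermonde_sq (y : Fin N → ℂ) :
    ‖(vandermonde y).det‖ ^ 2 = ∏ k, ∏ l ∈ Finset.Iio k, ‖y k - y l‖ ^ 2 := by
  rw [det_vandermonde, norm_prod]
  simp_rw [norm_prod]
  rw [Finset.prod_comm' (t' := Finset.univ) (s' := fun l => Finset.Iio l) (by simp)]
  simp_rw [Finset.prod_pow]

/-- The norm of a Cauchy determinant with conjugate nodes. -/
theorem norm_det_cauchy (x y : Fin N → ℂ) (hy : Function.Injective y)
    (hxy : ∀ i j, x i - y j ≠ 0) :
    ‖(Matrix.of fun i j => (x i - y j)⁻¹).det‖ * ∏ i, ∏ j, ‖x i - y j‖ =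
      ‖(vandermonde x).det‖ * ‖(vandermonde y).det‖ := by
  classical
  -- Each `p j` vanishes at every node y_l except y_j. Evaluating at the y's gives a diagonal
  -- matrix, which determines |det c|; evaluating at the x's gives the Cauchy matrix with rows
  -- rescaled.
  let p : Fin N → ℂ[X] := fun j => ∏ l ∈ Finset.univ.erase j, (X - C (y l))
  let c : Matrix (Fin N) (Fin N) ℂ := Matrix.of fun m j => (p j).coeff m
  have hdeg : ∀ j, (p j).natDegree < N := by
    intro j
    have h : (p j).natDegree ≤ _ := Polynomial.natDegree_prod_le _ _
    refine lt_of_le_of_lt h ?_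
    simp only [natDegree_X_sub_C, Finset.sum_const, smul_eq_mul, mul_one]
    rw [Finset.card_erase_of_mem (Finset.mem_univ _), Finset.card_univ, Fintype.card_fin]
    have := j.pos
    omega
  have heval : ∀ w : Fin N → ℂ, vandermonde w * c = Matrix.of fun i j => (p j).eval (w i) := by
    intro w
    ext i j
    rw [mul_apply, of_apply, Polynomial.eval_eq_sum_range' (hdeg j), ← Fin.sum_univ_eq_sum_range
      (fun m => (p j).coeff m * w i ^ m)]
    exact Finset.sum_congr rfl fun m _ => by simp [c, vandermonde_apply, mul_comm]
  have hp : ∀ j w, (p j).eval w = ∏ l ∈ Finset.univ.erase j, (w - y l) := by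
    intro j w
    simp [p, eval_prod]
  have hV : (vandermonde y).det ≠ 0 := det_vandermonde_ne_zero_iff.mpr hy
  have hc : ‖c.det‖ = ‖(vandermonde y).det‖ := by
    have h1 : (vandermonde y).det * c.det = ∏ j, (p j).eval (y j) := by
      rw [← det_mul, heval, ← det_diagonal]
      congr 1
      ext i j
      rcases eq_or_ne i j with rfl | hij
      · simp
      · rw [diagonal_apply_ne _ hij, of_apply, hp]
        exact Finset.prod_eq_zero (i := i) (by simp [hij]) (sub_self _)
    have h2 := congrArg norm h1
    rw [norm_mul, norm_prod] at h2
    simp_rw [hp, norm_prod] at h2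
    rw [prod_erase_eq_prod_Iio_sq (fun i j => ‖y i - y j‖) (fun i j => norm_sub_rev _ _),
      ← norm_det_vandermonde_sq, sq] at h2
    exact mul_left_cancel₀ (norm_ne_zero_iff.mpr hV) h2
  have hmain : (∏ i, ∏ j, (x i - y j)) * (Matrix.of fun i j => (x i - y j)⁻¹).det =
      (vandermonde x).det * c.det := by
    rw [← det_mul, heval, ← det_mul_column]
    congr 1
    ext i j
    simp only [of_apply, hp]
    rw [← Finset.mul_prod_erase _ _ (Finset.mem_univ j), mul_comm, ← mul_assoc,
      inv_mul_cancel₀ (hxy i j), one_mul]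
  have := congrArg norm hmain
  rw [norm_mul, norm_mul, hc] at this
  simp_rw [norm_prod] at this
  rw [mul_comm, this]

end CauchyDeterminant

/-! ### Positivity of the Hermitian Cauchy matrix, and coercivity. -/

section Gram

variable {N : ℕ} {lam : Fin N → ℂ}

/-- The Hermitian Cauchy matrix `1 / (i (λ̄_k - λ_l))`. -/
noncomputable def gram (lam : Fin N → ℂ) : Matrix (Fin N) (Fin N) ℂ :=
  Matrix.of fun k l => (Complex.I * (conj (lam k) - lam l))⁻¹

theorem conj_sub_ne_zero (him : ∀ k, 0 < (lam k).im) (k l : Fin N) :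
    conj (lam k) - lam l ≠ 0 := by
  intro h
  have := congrArg Complex.im h
  simp only [Complex.sub_im, Complex.conj_im, Complex.zero_im] at this
  linarith [him k, him l]

theorem sub_conj_ne_zero (him : ∀ k, 0 < (lam k).im) (k l : Fin N) :
    lam k - conj (lam l) ≠ 0 := by
  intro h
  exact conj_sub_ne_zero him l k (by rw [← neg_sub, h, neg_zero])

theorem gram_isHermitian (lam : Fin N → ℂ) : (gram lam).IsHermitian := by
  ext k l
  simp only [gram, conjTranspose_apply, of_apply, star_inv₀, star_mul', RCLike.star_def, map_sub,
    Complex.conj_I, Complex.conj_conj]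
  congr 1
  ring

/-- The entry 1 / (i (λ̄_k - λ_l)) is the integral of e^{i(λ_l - λ̄_k)s} over s > 0, so the
quadratic form at v is the squared L²(0, ∞) norm of Σ v_l e^{iλ_l s}. -/
theorem gram_posSemidef (him : ∀ k, 0 < (lam k).im) : (gram lam).PosSemidef := by
  refine PosSemidef.of_dotProduct_mulVec_nonneg (gram_isHermitian lam) fun v => ?_
  have hre : ∀ k l, (Complex.I * (lam l - conj (lam k))).re < 0 := by
    intro k l
    simp only [Complex.mul_re, Complex.I_re, Complex.I_im, Complex.sub_im, Complex.conj_im]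
    linarith [him k, him l]
  have hint : ∀ k l, IntegrableOn (fun s : ℝ => star (v k) * v l *
      Complex.exp (Complex.I * (lam l - conj (lam k)) * s)) (Set.Ioi 0) := fun k l =>
    (integrableOn_exp_mul_complex_Ioi (hre k l) 0).const_mul _
  have hval : ∀ k l, ∫ s : ℝ in Set.Ioi 0, star (v k) * v l *
      Complex.exp (Complex.I * (lam l - conj (lam k)) * s) = star (v k) * (gram lam k l * v l) := by
    intro k l
    rw [integral_const_mul, integral_exp_mul_complex_Ioi (hre k l) 0, gram, of_apply]
    have : Complex.I * (conj (lam k) - lam l) = -(Complex.I * (lam l - conj (lam k))) := by ring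
    rw [this, inv_neg]
    simp only [Complex.ofReal_zero, mul_zero, Complex.exp_zero, neg_div, one_div]
    ring
  have hsum : star v ⬝ᵥ (gram lam *ᵥ v) = ∫ s : ℝ in Set.Ioi 0,
      ((‖∑ l, v l * Complex.exp (Complex.I * lam l * s)‖ ^ 2 : ℝ) : ℂ) := by
    have hI : ∀ s : ℝ, ((‖∑ l, v l * Complex.exp (Complex.I * lam l * s)‖ ^ 2 : ℝ) : ℂ) =
        ∑ k, ∑ l, star (v k) * v l * Complex.exp (Complex.I * (lam l - conj (lam k)) * s) := by
      intro s
      rw [Complex.ofReal_pow, ← Complex.conj_mul', map_sum, Finset.sum_mul_sum]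
      refine Finset.sum_congr rfl fun k _ => Finset.sum_congr rfl fun l _ => ?_
      rw [map_mul, ← Complex.exp_conj, map_mul, map_mul, Complex.conj_I, Complex.conj_ofReal,
        mul_mul_mul_comm, ← Complex.exp_add]
      simp only [RCLike.star_def]
      congr 2
      ring
    simp_rw [hI]
    rw [integral_finsetSum _ fun k _ => integrable_finsetSum _ fun l _ => hint k l]
    simp_rw [dotProduct, mulVec, dotProduct, Finset.mul_sum, Pi.star_apply]
    refine Finset.sum_congr rfl fun k _ => ?_
    rw [integral_finsetSum _ fun l _ => hint k l]
    exact Finset.sum_congr rfl fun l _ => (hval k l).symm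
  rw [hsum, integral_complex_ofReal, Complex.zero_le_real]
  exact integral_nonneg fun s => by positivity

/-- Cauchy's determinant at the nodes λ̄_k and λ_l, whose two Vandermonde factors are conjugate. It
identifies the quotient inside the logarithm of `displacement` with |det G|. -/
theorem norm_det_gram (him : ∀ k, 0 < (lam k).im) (hinj : Function.Injective lam) :
    ‖(gram lam).det‖ * ∏ k, ∏ l, ‖conj (lam k) - lam l‖ =
      ∏ k, ∏ l ∈ Finset.Iio k, ‖lam k - lam l‖ ^ 2 := by
  have h := norm_det_cauchy (fun k => conj (lam k)) lam hinj (conj_sub_ne_zero him)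
  have hg : gram lam = (-Complex.I) • Matrix.of fun i j => (conj (lam i) - lam j)⁻¹ := by
    ext k l
    simp [gram, mul_comm]
  have hv : ‖(vandermonde fun k => conj (lam k)).det‖ = ‖(vandermonde lam).det‖ := by
    rw [det_vandermonde, det_vandermonde, ← RCLike.norm_conj, map_prod]
    simp_rw [map_prod, map_sub, Complex.conj_conj]
  rw [hg, det_smul, norm_mul, norm_pow, norm_neg, Complex.norm_I, one_pow, one_mul, h, hv, ← sq,
    norm_det_vandermonde_sq]

/-- A positive semidefinite matrix with nonzero determinant is definite, and `norm_det_gram` shows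
the determinant to be nonzero for distinct eigenvalues. -/
theorem gram_posDef (him : ∀ k, 0 < (lam k).im) (hinj : Function.Injective lam) :
    (gram lam).PosDef := by
  rw [(gram_posSemidef him).posDef_iff_det_ne_zero]
  intro h
  have h1 := norm_det_gram him hinj
  rw [h, norm_zero, zero_mul] at h1
  refine Finset.prod_ne_zero_iff.mpr (fun k _ => Finset.prod_ne_zero_iff.mpr fun l hl => ?_) h1.symm
  have : l < k := by simpa using hl
  exact pow_ne_zero _ (norm_ne_zero_iff.mpr (sub_ne_zero.mpr (hinj.ne this.ne')))

/-- Coercivity of a positive definite matrix, in a form uniform over positive semidefinite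
perturbations. -/
theorem exists_bound_of_posDef {A : Matrix (Fin N) (Fin N) ℂ} (hA : A.PosDef) :
    ∃ C : ℝ, 0 ≤ C ∧ ∀ H : Matrix (Fin N) (Fin N) ℂ, H.PosSemidef → ∀ v : Fin N → ℂ,
      ‖v‖ ≤ C * ‖(A + H) *ᵥ v‖ := by
  have hcont : Continuous fun v : Fin N → ℂ => (star v ⬝ᵥ (A *ᵥ v)).re := by
    simp only [dotProduct, mulVec]
    fun_prop
  obtain ⟨c, hc, hcv⟩ : ∃ c : ℝ, 0 < c ∧ ∀ v : Fin N → ℂ, c * ‖v‖ ^ 2 ≤ (star v ⬝ᵥ (A *ᵥ v)).re := by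
    -- The constant is the minimum of the form on the unit sphere, carried to all vectors by
    -- homogeneity. The sphere is empty exactly when N = 0.
    rcases (Metric.sphere (0 : Fin N → ℂ) 1).eq_empty_or_nonempty with he | hne
    · refine ⟨1, one_pos, fun v => ?_⟩
      have hv : v = 0 := by
        by_contra hv
        have : (‖v‖⁻¹ : ℂ) • v ∈ Metric.sphere (0 : Fin N → ℂ) 1 := by
          simp [norm_smul, norm_ne_zero_iff.mpr hv]
        rw [he] at this
        exact this
      simp [hv]
    · obtain ⟨v₀, hv₀, hmin⟩ := (isCompact_sphere (0 : Fin N → ℂ) 1).exists_isMinOn hne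
        hcont.continuousOn
      have hne0 : v₀ ≠ 0 := by
        rintro rfl
        simp at hv₀
      refine ⟨_, (Complex.lt_def.mp (hA.dotProduct_mulVec_pos hne0)).1, fun v => ?_⟩
      rcases eq_or_ne v 0 with rfl | hv
      · simp
      have hn : ‖v‖ ≠ 0 := norm_ne_zero_iff.mpr hv
      have hmem : (‖v‖⁻¹ : ℂ) • v ∈ Metric.sphere (0 : Fin N → ℂ) 1 := by
        simp [norm_smul, hn]
      have h := hmin hmem
      have hval : (star ((‖v‖⁻¹ : ℂ) • v) ⬝ᵥ (A *ᵥ ((‖v‖⁻¹ : ℂ) • v))).re =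
          (‖v‖⁻¹) ^ 2 * (star v ⬝ᵥ (A *ᵥ v)).re := by
        rw [mulVec_smul, star_smul, smul_dotProduct, dotProduct_smul, smul_smul, smul_eq_mul]
        have : star (‖v‖⁻¹ : ℂ) * (‖v‖⁻¹ : ℂ) = (((‖v‖⁻¹) ^ 2 : ℝ) : ℂ) := by
          simp [sq]
        rw [this, Complex.re_ofReal_mul]
      simp only [Set.mem_ofPred_eq, hval] at h
      calc _ ≤ (‖v‖⁻¹) ^ 2 * (star v ⬝ᵥ (A *ᵥ v)).re * ‖v‖ ^ 2 := by gcongr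
        _ = _ := by field_simp
  -- The factor N is the price of the sup norm: a pairing of two vectors is at most N times the
  -- product of their norms.
  refine ⟨c⁻¹ * N, by positivity, fun H hH v => ?_⟩
  rcases eq_or_ne v 0 with rfl | hv
  · simp
  have hn : 0 < ‖v‖ := norm_pos_iff.mpr hv
  have h1 : c * ‖v‖ ^ 2 ≤ (star v ⬝ᵥ ((A + H) *ᵥ v)).re := by
    rw [add_mulVec, dotProduct_add, Complex.add_re]
    have := (Complex.le_def.mp (hH.dotProduct_mulVec_nonneg v)).1
    simp only [Complex.zero_re] at this
    linarith [hcv v]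
  have h2 : (star v ⬝ᵥ ((A + H) *ᵥ v)).re ≤ N * (‖v‖ * ‖(A + H) *ᵥ v‖) := by
    refine (Complex.re_le_norm _).trans ?_
    refine (norm_sum_le _ _).trans ?_
    calc _ ≤ ∑ _k : Fin N, ‖v‖ * ‖(A + H) *ᵥ v‖ := by
          refine Finset.sum_le_sum fun k _ => ?_
          rw [norm_mul, Pi.star_apply, norm_star]
          exact mul_le_mul (norm_le_pi_norm v k) (norm_le_pi_norm _ k) (norm_nonneg _) hn.le
      _ = _ := by simp
  have h3 : c * ‖v‖ ≤ N * ‖(A + H) *ᵥ v‖ := by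
    refine le_of_mul_le_mul_right ?_ hn
    calc _ = c * ‖v‖ ^ 2 := by ring
      _ ≤ _ := h1.trans h2
      _ = _ := by ring
  rw [mul_assoc, ← div_eq_inv_mul, le_div_iff₀ hc]
  linarith

end Gram

/-! ### The linear system for the residues: solvability, uniform bounds, smoothness. -/

section LinearSystem

variable {N : ℕ} {lam : Fin N → ℂ}

/-- The Cauchy transform `∑ u_l / (λ_k - λ̄_l)`. -/
noncomputable def lowerSum (lam u : Fin N → ℂ) (k : Fin N) : ℂ :=
  ∑ l, u l / (lam k - conj (lam l))

/-- The Cauchy transform `∑ x_l / (λ̄_k - λ_l)`. -/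
noncomputable def upperSum (lam x : Fin N → ℂ) (k : Fin N) : ℂ :=
  ∑ l, x l / (conj (lam k) - lam l)

theorem conj_lowerSum (lam u : Fin N → ℂ) (k : Fin N) :
    conj (lowerSum lam u k) = upperSum lam (fun l => conj (u l)) k := by
  simp [lowerSum, upperSum, map_sum]

theorem conj_upperSum (lam u : Fin N → ℂ) (k : Fin N) :
    conj (upperSum lam u k) = lowerSum lam (fun l => conj (u l)) k := by
  simp [lowerSum, upperSum, map_sum]

theorem lowerSum_sub (u v : Fin N → ℂ) (k : Fin N) :
    lowerSum lam (fun l => u l - v l) k = lowerSum lam u k - lowerSum lam v k := by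
  simp [lowerSum, sub_div, Finset.sum_sub_distrib]

theorem upperSum_sub (u v : Fin N → ℂ) (k : Fin N) :
    upperSum lam (fun l => u l - v l) k = upperSum lam u k - upperSum lam v k := by
  simp [upperSum, sub_div, Finset.sum_sub_distrib]

/-- The matrix `Γ` as a function of the coefficients `e_l`. -/
noncomputable def coupling (lam e : Fin N → ℂ) : Matrix (Fin N) (Fin N) ℂ :=
  Matrix.of fun k l => e l / (conj (lam k) - lam l)

/-- The matrix `1 + Γ Γ̄` as a function of the coefficients. -/
noncomputable def systemMatrix (lam e : Fin N → ℂ) : Matrix (Fin N) (Fin N) ℂ :=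
  1 + coupling lam e * (coupling lam e).map conj

/-- The Hermitian matrix `diag(e) Ḡ diag(ē)`. -/
noncomputable def conjGram (lam e : Fin N → ℂ) : Matrix (Fin N) (Fin N) ℂ :=
  diagonal e * (gram lam)ᵀ * (diagonal e)ᴴ

theorem coupling_eq (lam e : Fin N → ℂ) : coupling lam e = Complex.I • (gram lam * diagonal e) := by
  ext k l
  simp only [coupling, of_apply, Matrix.smul_apply, mul_diagonal, gram, smul_eq_mul, mul_inv,
    Complex.inv_I]
  linear_combination (e l * (conj (lam k) - lam l)⁻¹) * Complex.I_sq

theorem gram_map_conj (lam : Fin N → ℂ) : (gram lam).map conj = (gram lam)ᵀ := by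
  ext k l
  exact congrFun (congrFun (gram_isHermitian lam) l) k

/-- Γ = i G diag(e). Since G is Hermitian its entrywise conjugate is its transpose, so Γ̄ = -i Gᵀ
diag(e)ᴴ, and the factors i and -i multiply to 1. -/
theorem systemMatrix_eq (lam e : Fin N → ℂ) :
    systemMatrix lam e = 1 + gram lam * conjGram lam e := by
  have h : (coupling lam e).map conj = (-Complex.I) • ((gram lam)ᵀ * (diagonal e)ᴴ) := by
    rw [coupling_eq, ← gram_map_conj, diagonal_conjTranspose]
    ext k l
    simp [mul_diagonal]
  rw [systemMatrix, h, coupling_eq, conjGram, Matrix.smul_mul, Matrix.mul_smul, smul_smul]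
  simp [Matrix.mul_assoc]

theorem conjGram_posSemidef (him : ∀ k, 0 < (lam k).im) (e : Fin N → ℂ) :
    (conjGram lam e).PosSemidef :=
  (gram_posSemidef him).transpose.mul_mul_conjTranspose_same _

/-- Pulling out G replaces the non-Hermitian 1 + Γ Γ̄ by a fixed positive definite matrix plus a
positive semidefinite one, the form to which coercivity applies uniformly in e. -/
theorem systemMatrix_factor (him : ∀ k, 0 < (lam k).im) (hinj : Function.Injective lam)
    (e : Fin N → ℂ) : systemMatrix lam e = gram lam * ((gram lam)⁻¹ + conjGram lam e) := by
  rw [systemMatrix_eq, Matrix.mul_add, mul_nonsing_inv]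
  exact (isUnit_iff_isUnit_det _).mp (gram_posDef him hinj).isUnit

theorem systemMatrix_det_ne_zero (him : ∀ k, 0 < (lam k).im) (hinj : Function.Injective lam)
    (e : Fin N → ℂ) : (systemMatrix lam e).det ≠ 0 := by
  rw [systemMatrix_factor him hinj, det_mul]
  have h1 := (gram_posDef him hinj)
  exact mul_ne_zero h1.det_pos.ne' (h1.inv.add_posSemidef (conjGram_posSemidef him e)).det_pos.ne'

/-- The solution of `(1 + Γ Γ̄) μ = 𝟏`. -/
noncomputable def muCoef (lam e : Fin N → ℂ) (k : Fin N) : ℂ :=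
  (systemMatrix lam e).det⁻¹ * cramer (systemMatrix lam e) 1 k

/-- The residue coefficients of `M₁₂` at `λ̄_k`. -/
noncomputable def uCoef (lam e : Fin N → ℂ) (k : Fin N) : ℂ := -conj (e k) * muCoef lam e k

/-- The residue coefficients of `M₁₁` at `λ_k`. -/
noncomputable def xCoef (lam e : Fin N → ℂ) (k : Fin N) : ℂ :=
  e k * lowerSum lam (uCoef lam e) k

/-- The linear system for the residues of the first row. -/
structure IsSystemSolution (lam e x u : Fin N → ℂ) : Prop where
  x_eq : ∀ k, x k = e k * lowerSum lam u k
  u_eq : ∀ k, u k = -conj (e k) * (1 + upperSum lam x k)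

theorem systemMatrix_mulVec_muCoef (him : ∀ k, 0 < (lam k).im) (hinj : Function.Injective lam)
    (e : Fin N → ℂ) : systemMatrix lam e *ᵥ muCoef lam e = 1 := by
  have : muCoef lam e = (systemMatrix lam e).det⁻¹ • cramer (systemMatrix lam e) 1 := rfl
  rw [this, mulVec_smul, mulVec_cramer, smul_smul,
    inv_mul_cancel₀ (systemMatrix_det_ne_zero him hinj e), one_smul]

theorem conj_coupling_mulVec (e μ : Fin N → ℂ) (k : Fin N) :
    ((coupling lam e).map conj *ᵥ μ) k = -lowerSum lam (fun l => -conj (e l) * μ l) k := by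
  simp only [mulVec, dotProduct, coupling, lowerSum, map_apply, of_apply, map_div₀, map_sub,
    Complex.conj_conj, ← Finset.sum_neg_distrib]
  exact Finset.sum_congr rfl fun l _ => by ring

theorem coupling_mulVec (e ξ : Fin N → ℂ) (k : Fin N) :
    (coupling lam e *ᵥ ξ) k = upperSum lam (fun l => e l * ξ l) k := by
  simp only [mulVec, dotProduct, coupling, upperSum, of_apply]
  exact Finset.sum_congr rfl fun l _ => by ring

/-- With μ = 1 + `upperSum` x, or without the 1 in the homogeneous case, this is what eliminating x
and u from the system produces. -/
theorem systemMatrix_mulVec (e μ : Fin N → ℂ) (k : Fin N) :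
    (systemMatrix lam e *ᵥ μ) k =
      μ k - upperSum lam (fun l => e l * lowerSum lam (fun l => -conj (e l) * μ l) l) k := by
  rw [systemMatrix, add_mulVec, one_mulVec, Pi.add_apply, ← mulVec_mulVec, coupling_mulVec]
  simp only [conj_coupling_mulVec, upperSum, ← Finset.sum_neg_distrib, sub_eq_add_neg]
  congr 1
  exact Finset.sum_congr rfl fun l _ => by ring

theorem muCoef_eq (him : ∀ k, 0 < (lam k).im) (hinj : Function.Injective lam)
    (e : Fin N → ℂ) (k : Fin N) : muCoef lam e k = 1 + upperSum lam (xCoef lam e) k := by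
  have h := congrFun (systemMatrix_mulVec_muCoef him hinj e) k
  rw [systemMatrix_mulVec] at h
  exact sub_eq_iff_eq_add.mp h

theorem isSystemSolution_coef (him : ∀ k, 0 < (lam k).im) (hinj : Function.Injective lam)
    (e : Fin N → ℂ) : IsSystemSolution lam e (xCoef lam e) (uCoef lam e) where
  x_eq _ := rfl
  u_eq k := by rw [← muCoef_eq him hinj, uCoef]

/-- The homogeneous system has only the trivial solution. -/
theorem homogeneous_system (him : ∀ k, 0 < (lam k).im) (hinj : Function.Injective lam)
    {e x u : Fin N → ℂ} (hx : ∀ k, x k = e k * lowerSum lam u k)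
    (hu : ∀ k, u k = -conj (e k) * upperSum lam x k) : x = 0 ∧ u = 0 := by
  have h : systemMatrix lam e *ᵥ upperSum lam x = 0 := by
    ext k
    rw [systemMatrix_mulVec]
    have h1 : (fun l => -conj (e l) * upperSum lam x l) = u := funext fun l => (hu l).symm
    rw [h1]
    have h2 : (fun l => e l * lowerSum lam u l) = x := funext fun l => (hx l).symm
    rw [h2, sub_self, Pi.zero_apply]
  have h0 := eq_zero_of_mulVec_eq_zero (systemMatrix_det_ne_zero him hinj e) h
  have hu0 : u = 0 := funext fun k => by simp [hu k, h0]
  refine ⟨funext fun k => ?_, hu0⟩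
  rw [hx k, hu0]
  simp [lowerSum]

/-- In (G⁻¹ + H) μ = G⁻¹ 𝟏 all dependence on e sits in the positive semidefinite H, so coercivity of
G⁻¹ alone bounds μ. -/
theorem exists_muCoef_bound (him : ∀ k, 0 < (lam k).im) (hinj : Function.Injective lam) :
    ∃ C : ℝ, 0 ≤ C ∧ ∀ e : Fin N → ℂ, ‖muCoef lam e‖ ≤ C := by
  obtain ⟨C, hC, h⟩ := exists_bound_of_posDef (gram_posDef him hinj).inv
  refine ⟨C * ‖(gram lam)⁻¹ *ᵥ 1‖, by positivity, fun e => ?_⟩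
  have h1 := h _ (conjGram_posSemidef him e) (muCoef lam e)
  have hdet := (isUnit_iff_isUnit_det _).mp (gram_posDef him hinj).isUnit
  rwa [← Matrix.one_mul ((gram lam)⁻¹ + conjGram lam e), ← nonsing_inv_mul _ hdet,
    Matrix.mul_assoc, ← systemMatrix_factor him hinj, ← mulVec_mulVec,
    systemMatrix_mulVec_muCoef him hinj] at h1

/-- The counterpart for large e. In terms of u = -diag(e)ᴴ μ the system reads (Gᵀ + diag(e)⁻¹ G⁻¹
(diag(e)⁻¹)ᴴ) u = -diag(e)⁻¹ G⁻¹ 𝟏. Coercivity of Gᵀ applies, and the right-hand side is of the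
order of the largest 1/|e_k|. -/
theorem exists_uCoef_bound (him : ∀ k, 0 < (lam k).im) (hinj : Function.Injective lam) :
    ∃ C : ℝ, 0 ≤ C ∧ ∀ (e : Fin N → ℂ) (B : ℝ), (∀ k, e k ≠ 0) → (∀ k, ‖e k‖⁻¹ ≤ B) →
      ‖uCoef lam e‖ ≤ C * B := by
  obtain ⟨C, hC, h⟩ := exists_bound_of_posDef (gram_posDef him hinj).transpose
  set g := (gram lam)⁻¹ *ᵥ 1 with hg
  refine ⟨C * ‖g‖, by positivity, fun e B he hB => ?_⟩
  have hdet := (isUnit_iff_isUnit_det _).mp (gram_posDef him hinj).isUnit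
  have hH : (diagonal e⁻¹ * (gram lam)⁻¹ * (diagonal e⁻¹)ᴴ).PosSemidef :=
    (gram_posSemidef him).inv.mul_mul_conjTranspose_same _
  have hee : diagonal e⁻¹ * diagonal e = 1 := by
    rw [diagonal_mul_diagonal, ← diagonal_one]
    congr 1
    ext k
    simp [he k]
  have hee' : (diagonal e⁻¹)ᴴ * (diagonal e)ᴴ = 1 := by
    rw [← conjTranspose_mul, diagonal_mul_diagonal, ← conjTranspose_one, ← diagonal_one]
    congr 2
    ext k
    simp [he k]
  have hu : uCoef lam e = -((diagonal e)ᴴ *ᵥ muCoef lam e) := by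
    ext k
    simp [uCoef, diagonal_conjTranspose, mulVec_diagonal]
  have hμ : ((gram lam)⁻¹ + conjGram lam e) *ᵥ muCoef lam e = g := by
    rw [← Matrix.one_mul ((gram lam)⁻¹ + conjGram lam e), ← nonsing_inv_mul _ hdet,
      Matrix.mul_assoc, ← systemMatrix_factor him hinj, ← mulVec_mulVec,
      systemMatrix_mulVec_muCoef him hinj]
  have hmain : ((gram lam)ᵀ + diagonal e⁻¹ * (gram lam)⁻¹ * (diagonal e⁻¹)ᴴ) *ᵥ uCoef lam e =
      -(diagonal e⁻¹ *ᵥ g) := by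
    rw [hu, mulVec_neg, ← hμ, mulVec_mulVec, mulVec_mulVec, Matrix.add_mul, Matrix.mul_add,
      Matrix.mul_assoc _ (diagonal e⁻¹)ᴴ, hee', Matrix.mul_one, conjGram, ← Matrix.mul_assoc,
      ← Matrix.mul_assoc, hee, Matrix.one_mul, add_comm]
  have h1 := h _ hH (uCoef lam e)
  rw [hmain, norm_neg] at h1
  rcases isEmpty_or_nonempty (Fin N) with hemp | ⟨⟨k₀⟩⟩
  · rw [Subsingleton.elim (uCoef lam e) 0, norm_zero, Subsingleton.elim g 0, norm_zero]
    simp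
  have hB0 : 0 ≤ B := le_trans (by positivity) (hB k₀)
  refine h1.trans ?_
  rw [mul_assoc]
  gcongr
  rw [pi_norm_le_iff_of_nonneg (by positivity)]
  intro k
  rw [mulVec_diagonal, norm_mul, mul_comm, Pi.inv_apply, norm_inv]
  exact mul_le_mul (norm_le_pi_norm g k) (hB k) (by positivity) (norm_nonneg _)

/-- Since G x = -i (μ - 1), the bound on μ passes to x by coercivity of G, here with zero
perturbation. -/
theorem exists_xCoef_bound (him : ∀ k, 0 < (lam k).im) (hinj : Function.Injective lam) :
    ∃ C : ℝ, 0 ≤ C ∧ ∀ e : Fin N → ℂ, ‖xCoef lam e‖ ≤ C := by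
  obtain ⟨C, hC, h⟩ := exists_bound_of_posDef (gram_posDef him hinj)
  obtain ⟨B, hB, hμ⟩ := exists_muCoef_bound him hinj
  refine ⟨C * (B + 1), by positivity, fun e => ?_⟩
  refine (h 0 PosSemidef.zero (xCoef lam e)).trans ?_
  gcongr
  rw [add_zero, pi_norm_le_iff_of_nonneg (by positivity)]
  intro k
  have h1 : (gram lam *ᵥ xCoef lam e) k = -Complex.I * (muCoef lam e k - 1) := by
    rw [muCoef_eq him hinj, add_sub_cancel_left]
    simp only [mulVec, dotProduct, gram, of_apply, upperSum, Finset.mul_sum, mul_inv,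
      Complex.inv_I]
    exact Finset.sum_congr rfl fun l _ => by ring
  rw [h1, norm_mul, norm_neg, Complex.norm_I, one_mul]
  refine (norm_sub_le _ _).trans ?_
  rw [norm_one]
  gcongr
  exact (norm_le_pi_norm _ k).trans (hμ e)

theorem contDiff_det {E : Type*} [NormedAddCommGroup E] [NormedSpace ℝ E] {n : WithTop ℕ∞}
    {A : E → Matrix (Fin N) (Fin N) ℂ} (hA : ∀ i j, ContDiff ℝ n fun v => A v i j) :
    ContDiff ℝ n fun v => (A v).det := by
  simp only [det_apply]
  exact ContDiff.sum fun σ _ => (contDiff_prod fun i _ => hA _ _).const_smul _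

theorem contDiff_systemMatrix {n : WithTop ℕ∞} (lam : Fin N → ℂ) (i j : Fin N) :
    ContDiff ℝ n fun e => systemMatrix lam e i j := by
  simp only [systemMatrix, Matrix.add_apply, mul_apply, map_apply, coupling, of_apply,
    div_eq_mul_inv]
  refine contDiff_const.add (ContDiff.sum fun m _ => ?_)
  exact ((contDiff_apply ℝ ℂ m).mul contDiff_const).mul
    (Complex.conjCLE.contDiff.comp ((contDiff_apply ℝ ℂ j).mul contDiff_const))

/-- `muCoef` is a Cramer quotient whose denominator never vanishes. Smoothness is over ℝ because the
conjugates of the e_k enter. -/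
theorem contDiff_muCoef {n : WithTop ℕ∞} (him : ∀ k, 0 < (lam k).im)
    (hinj : Function.Injective lam) (k : Fin N) : ContDiff ℝ n fun e => muCoef lam e k := by
  simp only [muCoef, cramer_apply]
  refine ContDiff.mul (ContDiff.inv (contDiff_det (contDiff_systemMatrix lam))
    (systemMatrix_det_ne_zero him hinj)) (contDiff_det fun i j => ?_)
  rcases eq_or_ne j k with rfl | hjk
  · simpa using contDiff_const
  · simpa [updateCol_ne hjk] using contDiff_systemMatrix lam i j

theorem contDiff_uCoef {n : WithTop ℕ∞} (him : ∀ k, 0 < (lam k).im)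
    (hinj : Function.Injective lam) (k : Fin N) : ContDiff ℝ n fun e => uCoef lam e k :=
  (Complex.conjCLE.contDiff.comp (contDiff_apply ℝ ℂ k)).neg.mul (contDiff_muCoef him hinj k)

theorem contDiff_xCoef {n : WithTop ℕ∞} (him : ∀ k, 0 < (lam k).im)
    (hinj : Function.Injective lam) (k : Fin N) : ContDiff ℝ n fun e => xCoef lam e k := by
  simp only [xCoef, lowerSum, div_eq_mul_inv]
  exact (contDiff_apply ℝ ℂ k).mul
    (ContDiff.sum fun l _ => (contDiff_uCoef him hinj l).mul contDiff_const)

end LinearSystem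

/-! ### Derivatives of the residues in t and z. -/

section Evolution

variable {N : ℕ} {lam : Fin N → ℂ}

theorem ne_zero_of_im_pos (him : ∀ k, 0 < (lam k).im) (k : Fin N) : lam k ≠ 0 := by
  intro h
  have := him k
  simp [h] at this

theorem conj_ne_zero_of_im_pos (him : ∀ k, 0 < (lam k).im) (k : Fin N) : conj (lam k) ≠ 0 :=
  (_root_.map_ne_zero _).mpr (ne_zero_of_im_pos him k)

/-- The value `M₁₁(0)` in terms of the residues. -/
noncomputable def diagValue (lam x : Fin N → ℂ) : ℂ := 1 - ∑ l, x l / lam l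

/-- The value `M₁₂(0)` in terms of the residues. -/
noncomputable def offDiagValue (lam u : Fin N → ℂ) : ℂ := -∑ l, u l / conj (lam l)

/-- Writing λ̄_l = λ_k - (λ_k - λ̄_l) shows that multiplication by λ commutes with the Cauchy
transform up to the rank-one term Σ u_l. In the same way, division by λ produces the entries of M(0)
as correction terms. -/
theorem lowerSum_mul (him : ∀ k, 0 < (lam k).im) (u : Fin N → ℂ) (k : Fin N) :
    lowerSum lam (fun l => conj (lam l) * u l) k = lam k * lowerSum lam u k - ∑ l, u l := by
  simp only [lowerSum, Finset.mul_sum, ← Finset.sum_sub_distrib]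
  refine Finset.sum_congr rfl fun l _ => ?_
  have := sub_conj_ne_zero him k l
  field_simp
  ring

theorem lowerSum_div (him : ∀ k, 0 < (lam k).im) (u : Fin N → ℂ) (k : Fin N) :
    lowerSum lam (fun l => u l / conj (lam l)) k =
      (lowerSum lam u k - offDiagValue lam u) / lam k := by
  simp only [lowerSum, offDiagValue, sub_neg_eq_add, ← Finset.sum_add_distrib, Finset.sum_div]
  refine Finset.sum_congr rfl fun l _ => ?_
  have := sub_conj_ne_zero him k l
  have := conj_ne_zero_of_im_pos him l
  have := ne_zero_of_im_pos him k
  field_simp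
  ring

theorem upperSum_div (him : ∀ k, 0 < (lam k).im) (x : Fin N → ℂ) (k : Fin N) :
    upperSum lam (fun l => x l / lam l) k =
      (upperSum lam x k + 1 - diagValue lam x) / conj (lam k) := by
  have h : upperSum lam x k + 1 - diagValue lam x = upperSum lam x k + ∑ l, x l / lam l := by
    rw [diagValue]; ring
  rw [h]
  simp only [upperSum, ← Finset.sum_add_distrib, Finset.sum_div]
  refine Finset.sum_congr rfl fun l _ => ?_
  have := conj_sub_ne_zero him k l
  have := conj_ne_zero_of_im_pos him k
  have := ne_zero_of_im_pos him l
  field_simp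
  ring

namespace IsSystemSolution

variable {e x u : Fin N → ℂ}

theorem conj_x_eq (h : IsSystemSolution lam e x u) (k : Fin N) :
    conj (x k) = conj (e k) * upperSum lam (fun l => conj (u l)) k := by
  rw [h.x_eq, map_mul, conj_lowerSum]

theorem conj_u_eq (h : IsSystemSolution lam e x u) (k : Fin N) :
    conj (u k) = -e k * (1 + lowerSum lam (fun l => conj (x l)) k) := by
  rw [h.u_eq, map_mul, map_add, conj_upperSum, map_neg, Complex.conj_conj, map_one]

/-- `det M(0) = 1`. -/
theorem det_eq_one (h : IsSystemSolution lam e x u) (him : ∀ k, 0 < (lam k).im) :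
    diagValue lam x * conj (diagValue lam x) +
      offDiagValue lam u * conj (offDiagValue lam u) = 1 := by
  -- Partial fractions split 1 / (λ_k λ̄_l) over the difference λ_k - λ̄_l, turning a product of two
  -- sums into Cauchy transforms.
  have h1 : ∀ f g : Fin N → ℂ, (∑ k, f k / lam k) * ∑ l, g l / conj (lam l) =
      -(∑ l, g l / conj (lam l) * upperSum lam f l) - ∑ k, f k / lam k * lowerSum lam g k := by
    intro f g
    rw [Finset.sum_mul_sum]
    simp only [upperSum, lowerSum, Finset.mul_sum]
    conv_rhs => rw [Finset.sum_comm]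
    rw [← Finset.sum_neg_distrib, ← Finset.sum_sub_distrib]
    refine Finset.sum_congr rfl fun k _ => ?_
    rw [← Finset.sum_neg_distrib, ← Finset.sum_sub_distrib]
    refine Finset.sum_congr rfl fun l _ => ?_
    have a1 := sub_conj_ne_zero him k l
    have a2 := conj_sub_ne_zero him l k
    have a3 := conj_ne_zero_of_im_pos him l
    have a4 := ne_zero_of_im_pos him k
    have a5 : conj (lam l) - lam k = -(lam k - conj (lam l)) := by ring
    rw [a5]
    field_simp
  have hx := h1 x fun l => conj (x l)
  have hu := h1 (fun l => conj (u l)) u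
  -- The residue of det M at λ_k vanishes; `e2` is the same at λ̄_k.
  have e1 : ∀ k, x k / lam k * (1 + lowerSum lam (fun l => conj (x l)) k) +
      conj (u k) / lam k * lowerSum lam u k = 0 := by
    intro k
    rw [h.conj_u_eq, h.x_eq]
    ring
  have e2 : ∀ k, conj (x k) / conj (lam k) * (1 + upperSum lam x k) +
      u k / conj (lam k) * upperSum lam (fun l => conj (u l)) k = 0 := by
    intro k
    rw [h.conj_x_eq, h.u_eq]
    ring
  have s1 := Finset.sum_eq_zero fun k (_ : k ∈ Finset.univ) => e1 k
  have s2 := Finset.sum_eq_zero fun k (_ : k ∈ Finset.univ) => e2 k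
  simp only [mul_add, mul_one, Finset.sum_add_distrib] at s1 s2
  simp only [diagValue, offDiagValue, map_sub, map_one, map_neg, map_sum, map_div₀,
    Complex.conj_conj]
  linear_combination hx + hu - s1 - s2

end IsSystemSolution

/-- The right-hand side of the evolution equation for the residues `x_k` in the direction
`(τ, ζ)`. -/
noncomputable def xFlow (Dm : ℝ) (lam x u : Fin N → ℂ) (τ ζ : ℝ) (k : Fin N) : ℂ :=
  τ * (2 * Complex.I * (∑ l, u l) * conj (u k)) +
    ζ * (Complex.I * Dm / lam k * offDiagValue lam u * (conj (offDiagValue lam u) * x k -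
      diagValue lam x * conj (u k)))

/-- The right-hand side of the evolution equation for the residues `u_k` in the direction
`(τ, ζ)`. -/
noncomputable def uFlow (Dm : ℝ) (lam x u : Fin N → ℂ) (τ ζ : ℝ) (k : Fin N) : ℂ :=
  τ * (2 * Complex.I * conj (lam k) * u k - 2 * Complex.I * (∑ l, u l) * conj (x k)) +
    ζ * (Complex.I * Dm / conj (lam k) * diagValue lam x * (offDiagValue lam u * conj (x k) -
      conj (diagValue lam x) * u k))

/-- The logarithmic derivative of `e_k` in the direction `(τ, ζ)`. -/
noncomputable def rate (Dm : ℝ) (lam : Fin N → ℂ) (τ ζ : ℝ) (k : Fin N) : ℂ :=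
  τ * (-2 * Complex.I * lam k) + ζ * (Complex.I * Dm / lam k)

theorem conj_rate (Dm : ℝ) (lam : Fin N → ℂ) (τ ζ : ℝ) (k : Fin N) :
    conj (rate Dm lam τ ζ k) =
      τ * (2 * Complex.I * conj (lam k)) - ζ * (Complex.I * Dm / conj (lam k)) := by
  simp only [rate, map_add, map_mul, map_neg, map_div₀, Complex.conj_I, Complex.conj_ofReal,
    map_ofNat]
  ring

variable {e x u : Fin N → ℂ}

theorem lowerSum_combo {c d₁ d₂ d₃ : ℂ} (f g h i : Fin N → ℂ) (k : Fin N) :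
    lowerSum lam (fun l => c * f l + d₁ * g l + d₂ * h l + d₃ * i l) k =
      c * lowerSum lam f k + d₁ * lowerSum lam g k + d₂ * lowerSum lam h k +
        d₃ * lowerSum lam i k := by
  simp only [lowerSum, Finset.mul_sum, ← Finset.sum_add_distrib]
  exact Finset.sum_congr rfl fun l _ => by ring

theorem upperSum_combo {d₁ d₂ d₃ : ℂ} (g h i : Fin N → ℂ) (k : Fin N) :
    upperSum lam (fun l => d₁ * g l + d₂ * h l + d₃ * i l) k =
      d₁ * upperSum lam g k + d₂ * upperSum lam h k + d₃ * upperSum lam i k := by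
  simp only [upperSum, Finset.mul_sum, ← Finset.sum_add_distrib]
  exact Finset.sum_congr rfl fun l _ => by ring

/-- The explicit flow satisfies the differentiated first equation of the system. The τ-part is an
identity of Cauchy transforms; the ζ-part closes only because det M(0) = 1. -/
theorem IsSystemSolution.xFlow_eq (h : IsSystemSolution lam e x u) (him : ∀ k, 0 < (lam k).im)
    (Dm τ ζ : ℝ) (k : Fin N) :
    xFlow Dm lam x u τ ζ k =
      rate Dm lam τ ζ k * x k + e k * lowerSum lam (uFlow Dm lam x u τ ζ) k := by
  have hflow : uFlow Dm lam x u τ ζ = fun l =>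
      (τ * (2 * Complex.I)) * (conj (lam l) * u l) +
      (-(τ * (2 * Complex.I * ∑ l, u l))) * conj (x l) +
      (ζ * (Complex.I * Dm * diagValue lam x * offDiagValue lam u)) * (conj (x l) / conj (lam l)) +
      (-(ζ * (Complex.I * Dm * diagValue lam x * conj (diagValue lam x)))) *
        (u l / conj (lam l)) := by
    ext l
    rw [uFlow]
    ring
  rw [hflow, lowerSum_combo, lowerSum_mul him, lowerSum_div him, lowerSum_div him, xFlow, rate,
    h.conj_u_eq, h.x_eq]
  have hd := h.det_eq_one him
  have hv : offDiagValue lam (fun l => conj (x l)) = conj (diagValue lam x) - 1 := by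
    simp [offDiagValue, diagValue, map_sum]
  rw [hv]
  have := ne_zero_of_im_pos him k
  field_simp
  generalize diagValue lam x = a at *
  generalize offDiagValue lam u = b at *
  linear_combination (e k * ζ * Dm * lowerSum lam u k) * hd

theorem IsSystemSolution.uFlow_eq (h : IsSystemSolution lam e x u) (him : ∀ k, 0 < (lam k).im)
    (Dm τ ζ : ℝ) (k : Fin N) :
    uFlow Dm lam x u τ ζ k = conj (rate Dm lam τ ζ k) * u k +
      -conj (e k) * upperSum lam (xFlow Dm lam x u τ ζ) k := by
  have hflow : xFlow Dm lam x u τ ζ = fun l =>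
      (τ * (2 * Complex.I * ∑ l, u l)) * conj (u l) +
      (ζ * (Complex.I * Dm * offDiagValue lam u * conj (offDiagValue lam u))) * (x l / lam l) +
      (-(ζ * (Complex.I * Dm * diagValue lam x * offDiagValue lam u))) *
        (conj (u l) / lam l) := by
    ext l
    rw [xFlow]
    ring
  rw [hflow, upperSum_combo, upperSum_div him, upperSum_div him, uFlow, conj_rate,
    h.conj_x_eq, h.u_eq]
  have hd := h.det_eq_one him
  have hv : diagValue lam (fun l => conj (u l)) = 1 + conj (offDiagValue lam u) := by
    simp [offDiagValue, diagValue, map_sum, sub_eq_add_neg]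
  rw [hv]
  have := conj_ne_zero_of_im_pos him k
  field_simp
  generalize diagValue lam x = a at *
  generalize offDiagValue lam u = b at *
  linear_combination (conj (e k) * ζ * Dm * (1 + upperSum lam x k)) * hd

/-- The hypotheses are the differentiated system, which the explicit flows also satisfy. The
difference solves the homogeneous system and is therefore zero. -/
theorem IsSystemSolution.derivative_eq (h : IsSystemSolution lam e x u)
    (him : ∀ k, 0 < (lam k).im) (hinj : Function.Injective lam) (Dm τ ζ : ℝ)
    {x' u' : Fin N → ℂ}
    (hx : ∀ k, x' k = rate Dm lam τ ζ k * x k + e k * lowerSum lam u' k)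
    (hu : ∀ k, u' k = conj (rate Dm lam τ ζ k) * u k + -conj (e k) * upperSum lam x' k) :
    x' = xFlow Dm lam x u τ ζ ∧ u' = uFlow Dm lam x u τ ζ := by
  have := homogeneous_system him hinj (e := e)
    (x := fun k => x' k - xFlow Dm lam x u τ ζ k) (u := fun k => u' k - uFlow Dm lam x u τ ζ k)
    (fun k => by
      rw [lowerSum_sub]
      linear_combination hx k - h.xFlow_eq him Dm τ ζ k)
    (fun k => by
      rw [upperSum_sub]
      linear_combination hu k - h.uFlow_eq him Dm τ ζ k)
  exact ⟨funext fun k => sub_eq_zero.mp (congrFun this.1 k),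
    funext fun k => sub_eq_zero.mp (congrFun this.2 k)⟩

/-- Smoothness in e and the chain rule provide the existence of the derivatives; their values are
then read off by differentiating the system. -/
theorem hasDerivAt_coef (him : ∀ k, 0 < (lam k).im) (hinj : Function.Injective lam)
    (Dm τ ζ : ℝ) {e : ℝ → Fin N → ℂ} {s : ℝ}
    (he : ∀ k, HasDerivAt (fun s => e s k) (rate Dm lam τ ζ k * e s k) s) (k : Fin N) :
    HasDerivAt (fun s => xCoef lam (e s) k)
      (xFlow Dm lam (xCoef lam (e s)) (uCoef lam (e s)) τ ζ k) s ∧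
    HasDerivAt (fun s => uCoef lam (e s) k)
      (uFlow Dm lam (xCoef lam (e s)) (uCoef lam (e s)) τ ζ k) s := by
  have hed : DifferentiableAt ℝ e s := differentiableAt_pi.mpr fun k => (he k).differentiableAt
  have hx : ∀ k, HasDerivAt (fun s => xCoef lam (e s) k) (deriv (fun s => xCoef lam (e s) k) s) s :=
    fun k => (((contDiff_xCoef (n := 1) him hinj k).differentiable one_ne_zero).differentiableAt.comp
      s hed).hasDerivAt
  have hu : ∀ k, HasDerivAt (fun s => uCoef lam (e s) k) (deriv (fun s => uCoef lam (e s) k) s) s :=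
    fun k => (((contDiff_uCoef (n := 1) him hinj k).differentiable one_ne_zero).differentiableAt.comp
      s hed).hasDerivAt
  have hsys := isSystemSolution_coef him hinj (e s)
  have := hsys.derivative_eq him hinj Dm τ ζ
    (x' := fun k => deriv (fun s => xCoef lam (e s) k) s)
    (u' := fun k => deriv (fun s => uCoef lam (e s) k) s)
    (fun k => by
      have h1 : HasDerivAt (fun s => lowerSum lam (uCoef lam (e s)) k)
          (lowerSum lam (fun k => deriv (fun s => uCoef lam (e s) k) s) k) s := by
        simp only [lowerSum]
        exact HasDerivAt.fun_sum fun l _ => (hu l).div_const _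
      refine (hx k).unique (((he k).mul h1).congr_deriv ?_)
      rw [hsys.x_eq]
      ring)
    (fun k => by
      have h1 : HasDerivAt (fun s => upperSum lam (xCoef lam (e s)) k)
          (upperSum lam (fun k => deriv (fun s => xCoef lam (e s) k) s) k) s := by
        simp only [upperSum]
        exact HasDerivAt.fun_sum fun l _ => (hx l).div_const _
      have h2 : HasDerivAt (fun s => -conj (e s k)) (-conj (rate Dm lam τ ζ k * e s k)) s :=
        (Complex.conjCLE.hasFDerivAt.comp_hasDerivAt s (he k)).neg
      have h3 : (fun s => uCoef lam (e s) k) =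
          fun s => -conj (e s k) * (1 + upperSum lam (xCoef lam (e s)) k) :=
        funext fun s => (isSystemSolution_coef him hinj (e s)).u_eq k
      have h4 := hu k
      rw [h3] at h4
      refine HasDerivAt.unique ?_ ((h2.mul (h1.const_add 1)).congr_deriv ?_)
      · rw [h3]; exact h4
      · rw [hsys.u_eq, map_mul]
        ring)
  rw [← this.1, ← this.2]
  exact ⟨hx k, hu k⟩

end Evolution

/-! ### Pulse, inversion and polarization, and the Maxwell–Bloch equations. -/

section Fields

variable {N : ℕ} {lam : Fin N → ℂ}

/-- The optical pulse as a function of the coefficients. -/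
noncomputable def pulse (lam e : Fin N → ℂ) : ℂ := -2 * Complex.I * ∑ l, uCoef lam e l

/-- `M₁₁(0)` as a function of the coefficients. -/
noncomputable def diagEntry (lam e : Fin N → ℂ) : ℂ := diagValue lam (xCoef lam e)

/-- `M₁₂(0)` as a function of the coefficients. -/
noncomputable def offDiagEntry (lam e : Fin N → ℂ) : ℂ := offDiagValue lam (uCoef lam e)

/-- The population inversion as a function of the coefficients. -/
noncomputable def inversion (Dm : ℝ) (lam e : Fin N → ℂ) : ℝ :=
  Dm * (Complex.normSq (diagEntry lam e) - Complex.normSq (offDiagEntry lam e))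

/-- The polarization as a function of the coefficients. -/
noncomputable def polarization (Dm : ℝ) (lam e : Fin N → ℂ) : ℂ :=
  -2 * Dm * diagEntry lam e * offDiagEntry lam e

theorem normSq_add_normSq (him : ∀ k, 0 < (lam k).im) (hinj : Function.Injective lam)
    (e : Fin N → ℂ) :
    Complex.normSq (diagEntry lam e) + Complex.normSq (offDiagEntry lam e) = 1 := by
  have h := (isSystemSolution_coef him hinj e).det_eq_one him
  rw [Complex.mul_conj, Complex.mul_conj] at h
  exact_mod_cast h

theorem contDiff_pulse {n : WithTop ℕ∞} (him : ∀ k, 0 < (lam k).im)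
    (hinj : Function.Injective lam) : ContDiff ℝ n (pulse lam) :=
  contDiff_const.mul (ContDiff.sum fun l _ => contDiff_uCoef him hinj l)

theorem contDiff_diagEntry {n : WithTop ℕ∞} (him : ∀ k, 0 < (lam k).im)
    (hinj : Function.Injective lam) : ContDiff ℝ n (diagEntry lam) := by
  unfold diagEntry diagValue
  simp only [div_eq_mul_inv]
  exact contDiff_const.sub (ContDiff.sum fun l _ => (contDiff_xCoef him hinj l).mul contDiff_const)

theorem contDiff_offDiagEntry {n : WithTop ℕ∞} (him : ∀ k, 0 < (lam k).im)
    (hinj : Function.Injective lam) : ContDiff ℝ n (offDiagEntry lam) := by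
  unfold offDiagEntry offDiagValue
  simp only [div_eq_mul_inv]
  exact (ContDiff.sum fun l _ => (contDiff_uCoef him hinj l).mul contDiff_const).neg

theorem contDiff_normSq {n : WithTop ℕ∞} : ContDiff ℝ n (fun z : ℂ => Complex.normSq z) := by
  simp only [Complex.normSq_apply]
  exact (Complex.reCLM.contDiff.mul Complex.reCLM.contDiff).add
    (Complex.imCLM.contDiff.mul Complex.imCLM.contDiff)

theorem contDiff_inversion {n : WithTop ℕ∞} (Dm : ℝ) (him : ∀ k, 0 < (lam k).im)
    (hinj : Function.Injective lam) : ContDiff ℝ n (inversion Dm lam) :=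
  contDiff_const.mul ((contDiff_normSq.comp (contDiff_diagEntry him hinj)).sub
    (contDiff_normSq.comp (contDiff_offDiagEntry him hinj)))

theorem contDiff_polarization {n : WithTop ℕ∞} (Dm : ℝ) (him : ∀ k, 0 < (lam k).im)
    (hinj : Function.Injective lam) : ContDiff ℝ n (polarization Dm lam) :=
  (contDiff_const.mul (contDiff_diagEntry him hinj)).mul (contDiff_offDiagEntry him hinj)

theorem sum_conj_xCoef_div (e : Fin N → ℂ) :
    ∑ l, conj (xCoef lam e l) / conj (lam l) = 1 - conj (diagEntry lam e) := by
  simp [diagEntry, diagValue, map_sum]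

theorem sum_conj_uCoef_div (e : Fin N → ℂ) :
    ∑ l, conj (uCoef lam e l) / lam l = -conj (offDiagEntry lam e) := by
  simp [offDiagEntry, offDiagValue, map_sum]

theorem sum_uCoef_div (e : Fin N → ℂ) :
    ∑ l, uCoef lam e l / conj (lam l) = -offDiagEntry lam e := by
  simp [offDiagEntry, offDiagValue]

/-- The direction (0, 1) is the z-derivative. With a = M₁₁(0) and b = M₁₂(0), the cubic terms cancel
when the flow of u is summed, leaving i D₋ a b. -/
theorem hasDerivAt_pulse (him : ∀ k, 0 < (lam k).im) (hinj : Function.Injective lam) (Dm : ℝ)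
    {e : ℝ → Fin N → ℂ} {s : ℝ}
    (he : ∀ k, HasDerivAt (fun s => e s k) (rate Dm lam 0 1 k * e s k) s) :
    HasDerivAt (fun s => pulse lam (e s)) (-polarization Dm lam (e s)) s := by
  refine ((HasDerivAt.fun_sum fun l (_ : l ∈ Finset.univ) =>
    (hasDerivAt_coef him hinj Dm 0 1 he l).2).const_mul (-2 * Complex.I)).congr_deriv ?_
  have h : ∀ l, uFlow Dm lam (xCoef lam (e s)) (uCoef lam (e s)) 0 1 l =
      (Complex.I * Dm * diagEntry lam (e s) * offDiagEntry lam (e s)) *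
        (conj (xCoef lam (e s) l) / conj (lam l)) -
      (Complex.I * Dm * diagEntry lam (e s) * conj (diagEntry lam (e s))) *
        (uCoef lam (e s) l / conj (lam l)) := by
    intro l
    simp only [uFlow, Complex.ofReal_zero, Complex.ofReal_one, diagEntry, offDiagEntry]
    ring
  simp only [h, Finset.sum_sub_distrib, ← Finset.mul_sum, sum_conj_xCoef_div, sum_uCoef_div,
    polarization]
  linear_combination (-2 * Dm * diagEntry lam (e s) * offDiagEntry lam (e s)) * Complex.I_sq

/-- This is the first row of M(0)_t = Q M(0), the t-equation of the Lax pair at λ = 0. The equations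
for P_t and D_t follow from it by the product rule. -/
theorem hasDerivAt_entries (him : ∀ k, 0 < (lam k).im) (hinj : Function.Injective lam) (Dm : ℝ)
    {e : ℝ → Fin N → ℂ} {s : ℝ}
    (he : ∀ k, HasDerivAt (fun s => e s k) (rate Dm lam 1 0 k * e s k) s) :
    HasDerivAt (fun s => diagEntry lam (e s))
      (-pulse lam (e s) * conj (offDiagEntry lam (e s))) s ∧
    HasDerivAt (fun s => offDiagEntry lam (e s))
      (pulse lam (e s) * conj (diagEntry lam (e s))) s := by
  constructor
  · refine ((HasDerivAt.fun_sum fun l (_ : l ∈ Finset.univ) =>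
      (hasDerivAt_coef him hinj Dm 1 0 he l).1.div_const (lam l)).const_sub 1).congr_deriv ?_
    have h : ∀ l, xFlow Dm lam (xCoef lam (e s)) (uCoef lam (e s)) 1 0 l / lam l =
        -pulse lam (e s) * (conj (uCoef lam (e s) l) / lam l) := by
      intro l
      simp only [xFlow, Complex.ofReal_zero, Complex.ofReal_one, pulse]
      ring
    simp only [h, ← Finset.mul_sum, sum_conj_uCoef_div]
    ring
  · refine ((HasDerivAt.fun_sum fun l (_ : l ∈ Finset.univ) =>
      (hasDerivAt_coef him hinj Dm 1 0 he l).2.div_const (conj (lam l))).neg).congr_deriv ?_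
    have h : ∀ l, uFlow Dm lam (xCoef lam (e s)) (uCoef lam (e s)) 1 0 l / conj (lam l) =
        2 * Complex.I * uCoef lam (e s) l +
        pulse lam (e s) * (conj (xCoef lam (e s) l) / conj (lam l)) := by
      intro l
      have := conj_ne_zero_of_im_pos him l
      simp only [uFlow, Complex.ofReal_zero, Complex.ofReal_one, pulse]
      field_simp
      ring
    simp only [h, Finset.sum_add_distrib, ← Finset.mul_sum, sum_conj_xCoef_div]
    rw [pulse]
    ring

theorem hasDerivAt_polarization (him : ∀ k, 0 < (lam k).im) (hinj : Function.Injective lam)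
    (Dm : ℝ) {e : ℝ → Fin N → ℂ} {s : ℝ}
    (he : ∀ k, HasDerivAt (fun s => e s k) (rate Dm lam 1 0 k * e s k) s) :
    HasDerivAt (fun s => polarization Dm lam (e s))
      (-2 * pulse lam (e s) * (inversion Dm lam (e s) : ℂ)) s := by
  obtain ⟨ha, hb⟩ := hasDerivAt_entries him hinj Dm he
  refine ((ha.const_mul (-2 * (Dm : ℂ))).mul hb).congr_deriv ?_
  rw [inversion]
  push_cast
  rw [← Complex.mul_conj, ← Complex.mul_conj]
  ring

theorem hasDerivAt_normSq {f : ℝ → ℂ} {f' : ℂ} {s : ℝ} (hf : HasDerivAt f f' s) :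
    HasDerivAt (fun s => Complex.normSq (f s)) (2 * (conj (f s) * f').re) s := by
  have h1 := Complex.reCLM.hasFDerivAt.comp_hasDerivAt s hf
  have h2 := Complex.imCLM.hasFDerivAt.comp_hasDerivAt s hf
  refine ((h1.mul h1).add (h2.mul h2)).congr_deriv ?_
  simp only [Complex.mul_re, Complex.conj_re, Complex.conj_im, Complex.reCLM_apply,
    Complex.imCLM_apply, Function.comp_apply]
  ring

theorem hasDerivAt_inversion (him : ∀ k, 0 < (lam k).im) (hinj : Function.Injective lam)
    (Dm : ℝ) {e : ℝ → Fin N → ℂ} {s : ℝ}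
    (he : ∀ k, HasDerivAt (fun s => e s k) (rate Dm lam 1 0 k * e s k) s) :
    HasDerivAt (fun s => inversion Dm lam (e s))
      (2 * (conj (pulse lam (e s)) * polarization Dm lam (e s)).re) s := by
  obtain ⟨ha, hb⟩ := hasDerivAt_entries him hinj Dm he
  refine (((hasDerivAt_normSq ha).sub (hasDerivAt_normSq hb)).const_mul Dm).congr_deriv ?_
  rw [polarization]
  simp only [Complex.mul_re, Complex.mul_im, Complex.conj_re, Complex.conj_im, Complex.neg_re,
    Complex.neg_im, Complex.ofReal_re, Complex.ofReal_im, Complex.re_ofNat, Complex.im_ofNat]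
  ring

/-- An arbitrary differentiable curve is allowed, so that the coordinate directions and the line z =
V t are treated together. -/
theorem hasDerivAt_expCoeff (ω : Fin N → ℂ) (Dm : ℝ) {t z : ℝ → ℝ} {τ ζ s : ℝ}
    (ht : HasDerivAt t τ s) (hz : HasDerivAt z ζ s) (k : Fin N) :
    HasDerivAt (fun s => expCoeff lam ω Dm (t s) (z s) k)
      (rate Dm lam τ ζ k * expCoeff lam ω Dm (t s) (z s) k) s := by
  simp only [expCoeff, theta]
  refine (((((ht.ofReal_comp.const_mul (lam k)).sub
    (hz.ofReal_comp.const_mul ((Dm : ℂ) / (2 * lam k)))).const_mul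
    (-2 * Complex.I)).cexp).const_mul (ω k)).congr_deriv ?_
  rw [rate]
  simp only [Pi.sub_apply, div_eq_mul_inv, mul_inv]
  ring

theorem contDiff_expCoeff (ω : Fin N → ℂ) (Dm : ℝ) {n : WithTop ℕ∞} :
    ContDiff ℝ n fun p : ℝ × ℝ => expCoeff lam ω Dm p.1 p.2 := by
  refine contDiff_pi.mpr fun k => ?_
  simp only [expCoeff, theta]
  have h1 : ContDiff ℝ n fun p : ℝ × ℝ => (p.1 : ℂ) := Complex.ofRealCLM.contDiff.comp contDiff_fst
  have h2 : ContDiff ℝ n fun p : ℝ × ℝ => (p.2 : ℂ) := Complex.ofRealCLM.contDiff.comp contDiff_snd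
  exact contDiff_const.mul (contDiff_const.mul ((contDiff_const.mul h1).sub
    (contDiff_const.mul h2))).cexp

end Fields

/-! ### Exponential localization about the line z = V t. -/

section Localization

variable {N : ℕ} {lam : Fin N → ℂ}

theorem norm_expCoeff (lam ω : Fin N → ℂ) (Dm t z : ℝ) (k : Fin N) :
    ‖expCoeff lam ω Dm t z k‖ = ‖ω k‖ * Real.exp (2 * (theta Dm (lam k) t z).im) := by
  rw [expCoeff, norm_mul, Complex.norm_exp]
  congr 2
  simp

theorem expCoeff_ne_zero {ω : Fin N → ℂ} (hω : ∀ k, ω k ≠ 0) (Dm t z : ℝ) (k : Fin N) :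
    expCoeff lam ω Dm t z k ≠ 0 :=
  mul_ne_zero (hω k) (Complex.exp_ne_zero _)

variable {r : ℝ} {α : Fin N → ℝ}

theorem eigenvalue_re (r : ℝ) (α : Fin N → ℝ) (k : Fin N) :
    (eigenvalue r α k).re = r * Real.cos (α k) := by
  rw [eigenvalue, mul_comm Complex.I, Complex.re_ofReal_mul, Complex.exp_ofReal_mul_I_re]

theorem eigenvalue_im (r : ℝ) (α : Fin N → ℝ) (k : Fin N) :
    (eigenvalue r α k).im = r * Real.sin (α k) := by
  rw [eigenvalue, mul_comm Complex.I, Complex.im_ofReal_mul, Complex.exp_ofReal_mul_I_im]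

theorem eigenvalue_mul_conj (r : ℝ) (α : Fin N → ℝ) (k : Fin N) :
    eigenvalue r α k * conj (eigenvalue r α k) = (r : ℂ) ^ 2 := by
  rw [Complex.mul_conj, Complex.normSq_apply, eigenvalue_re, eigenvalue_im]
  norm_cast
  linear_combination r ^ 2 * Real.sin_sq_add_cos_sq (α k)

theorem inv_eigenvalue (hr : 0 < r) (k : Fin N) :
    (eigenvalue r α k)⁻¹ = conj (eigenvalue r α k) / (r : ℂ) ^ 2 := by
  have h := eigenvalue_mul_conj r α k
  have hr' : (r : ℂ) ^ 2 ≠ 0 := pow_ne_zero _ (by exact_mod_cast hr.ne')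
  rw [eq_div_iff hr', ← h, inv_mul_cancel_left₀]
  rintro h0
  rw [h0, zero_mul] at h
  exact hr' h.symm

theorem theta_eigenvalue (hr : 0 < r) (Dm t z : ℝ) (k : Fin N) :
    theta Dm (eigenvalue r α k) t z =
      ((r * Real.cos (α k) * (t - Dm * z / (2 * r ^ 2)) : ℝ) : ℂ) +
      ((r * Real.sin (α k) * (t + Dm * z / (2 * r ^ 2)) : ℝ) : ℂ) * Complex.I := by
  have h1 : (Dm : ℂ) / (2 * eigenvalue r α k) * z =
      ((Dm * z / (2 * r ^ 2) : ℝ) : ℂ) * conj (eigenvalue r α k) := by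
    rw [div_eq_mul_inv, mul_inv, inv_eigenvalue hr]
    push_cast
    ring
  rw [theta, h1]
  apply Complex.ext
  · simp only [Complex.sub_re, Complex.re_mul_ofReal, Complex.re_ofReal_mul, Complex.conj_re,
      eigenvalue_re, Complex.add_re, Complex.ofReal_re, Complex.I_re]
    ring
  · simp only [Complex.sub_im, Complex.im_mul_ofReal, Complex.im_ofReal_mul, Complex.conj_im,
      eigenvalue_im, Complex.add_im, Complex.ofReal_im, Complex.I_im]
    ring

/-- On |λ| = r one has 1/λ = λ̄ / r², so the imaginary part sees t and z only through z - V t,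
simultaneously for all eigenvalues. This is the degeneracy behind coherent travel. -/
theorem im_theta_eigenvalue (hr : 0 < r) {Dm : ℝ} (hDm : Dm = 1 ∨ Dm = -1) (t z : ℝ)
    (k : Fin N) : (theta Dm (eigenvalue r α k) t z).im =
      Real.sin (α k) * (Dm * (z - velocity Dm r * t) / (2 * r)) := by
  have hD : Dm * Dm = 1 := by rcases hDm with rfl | rfl <;> norm_num
  rw [theta_eigenvalue hr]
  simp only [Complex.add_im, Complex.ofReal_im, Complex.im_ofReal_mul, Complex.I_im, velocity]
  field_simp
  linear_combination (-2 * Real.sin (α k) * r ^ 2 * t) * hD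

theorem norm_expCoeff_eigenvalue (hr : 0 < r) {Dm : ℝ} (hDm : Dm = 1 ∨ Dm = -1)
    (ω : Fin N → ℂ) (t z : ℝ) (k : Fin N) :
    ‖expCoeff (eigenvalue r α) ω Dm t z k‖ =
      ‖ω k‖ * Real.exp (Real.sin (α k) * (Dm * (z - velocity Dm r * t) / r)) := by
  rw [norm_expCoeff, im_theta_eigenvalue hr hDm]
  congr 2
  field_simp

theorem eigenvalue_im_pos (hr : 0 < r) (hα : ∀ k, 0 < α k ∧ α k < Real.pi) (k : Fin N) :
    0 < (eigenvalue r α k).im := by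
  rw [eigenvalue_im]
  exact mul_pos hr (Real.sin_pos_of_pos_of_lt_pi (hα k).1 (hα k).2)

theorem eigenvalue_re_injective (hr : 0 < r) (hα : StrictMono α)
    (hα_mem : ∀ k, 0 < α k ∧ α k < Real.pi) :
    Function.Injective fun k => (eigenvalue r α k).re := by
  intro k l h
  simp only [eigenvalue_re] at h
  exact hα.injective (Real.injOn_cos ⟨(hα_mem k).1.le, (hα_mem k).2.le⟩
    ⟨(hα_mem l).1.le, (hα_mem l).2.le⟩ (mul_left_cancel₀ hr.ne' h))

theorem eigenvalue_injective (hr : 0 < r) (hα : StrictMono α)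
    (hα_mem : ∀ k, 0 < α k ∧ α k < Real.pi) : Function.Injective (eigenvalue r α) :=
  fun _ _ h => eigenvalue_re_injective hr hα hα_mem (congrArg Complex.re h)

/-- The residues `u_k` are exponentially localized. -/
theorem exists_uCoef_expCoeff_bound (hr : 0 < r) (hα : StrictMono α)
    (hα_mem : ∀ k, 0 < α k ∧ α k < Real.pi) {ω : Fin N → ℂ} (hω : ∀ k, ω k ≠ 0)
    {Dm : ℝ} (hDm : Dm = 1 ∨ Dm = -1) :
    ∃ C κ : ℝ, 0 ≤ C ∧ 0 < κ ∧ ∀ t z : ℝ,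
      ‖uCoef (eigenvalue r α) (expCoeff (eigenvalue r α) ω Dm t z)‖ ≤
        C * Real.exp (-κ * |z - velocity Dm r * t|) := by
  have him := eigenvalue_im_pos hr hα_mem
  have hinj := eigenvalue_injective hr hα hα_mem
  obtain ⟨C₁, hC₁, h₁⟩ := exists_muCoef_bound him hinj
  obtain ⟨C₂, hC₂, h₂⟩ := exists_uCoef_bound him hinj
  -- The decay rate is governed by the smallest sin α_k; with N = 0 any positive number serves.
  obtain ⟨κ, hκ, hκs⟩ : ∃ κ : ℝ, 0 < κ ∧ ∀ k, κ ≤ Real.sin (α k) := by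
    rcases isEmpty_or_nonempty (Fin N) with hemp | hne
    · exact ⟨1, one_pos, fun k => hemp.elim k⟩
    · obtain ⟨k₀, hk₀⟩ := Finite.exists_min fun k => Real.sin (α k)
      exact ⟨_, Real.sin_pos_of_pos_of_lt_pi (hα_mem k₀).1 (hα_mem k₀).2, hk₀⟩
  set W := ‖ω‖ + ‖ω⁻¹‖ with hW
  have hW0 : 0 ≤ W := by positivity
  refine ⟨(C₁ + C₂) * W, κ / r, by positivity, by positivity, fun t z => ?_⟩
  set y := Dm * (z - velocity Dm r * t) / r with hy
  have hyabs : -(κ / r) * |z - velocity Dm r * t| = -κ * |y| := by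
    have : |Dm| = 1 := by rcases hDm with rfl | rfl <;> norm_num
    rw [hy, abs_div, abs_mul, this, abs_of_pos hr]
    ring
  rw [hyabs]
  have hnorm := norm_expCoeff_eigenvalue (α := α) hr hDm ω t z
  rw [← hy] at hnorm
  set e := expCoeff (eigenvalue r α) ω Dm t z with he
  -- The sign of y separates the two regimes: for y ≤ 0 the e_k decay and u = -ē μ with μ bounded,
  -- while for y ≥ 0 their inverses decay and `exists_uCoef_bound` applies. The constant W dominates
  -- both the |ω_k| and their inverses.
  rcases le_total y 0 with h0 | h0
  · rw [pi_norm_le_iff_of_nonneg (by positivity)]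
    intro k
    rw [uCoef, norm_mul, norm_neg, RCLike.norm_conj, hnorm, abs_of_nonpos h0, neg_mul_neg]
    calc _ ≤ W * Real.exp (κ * y) * C₁ := by
          gcongr ?_ * Real.exp ?_ * ?_
          · exact (norm_le_pi_norm ω k).trans (le_add_of_nonneg_right (norm_nonneg _))
          · exact mul_le_mul_of_nonpos_right (hκs k) h0
          · exact (norm_le_pi_norm _ k).trans (h₁ e)
      _ ≤ _ := by
          have : 0 ≤ C₂ * W * Real.exp (κ * y) := by positivity
          linarith
  · refine (h₂ e (W * Real.exp (-κ * y)) (expCoeff_ne_zero hω Dm t z) fun k => ?_).trans ?_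
    · rw [hnorm, mul_inv, ← Real.exp_neg]
      gcongr ?_ * Real.exp ?_
      · rw [← norm_inv]
        exact (norm_le_pi_norm ω⁻¹ k).trans (le_add_of_nonneg_left (norm_nonneg _))
      · have := mul_le_mul_of_nonneg_right (hκs k) h0
        linarith
    · rw [abs_of_nonneg h0]
      have : 0 ≤ C₁ * W * Real.exp (-κ * y) := by positivity
      linarith

theorem norm_pulse_le (lam e : Fin N → ℂ) : ‖pulse lam e‖ ≤ 2 * N * ‖uCoef lam e‖ := by
  rw [pulse, norm_mul, norm_mul, norm_neg, Complex.norm_I, mul_one, Complex.norm_ofNat, mul_assoc]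
  gcongr
  refine (norm_sum_le _ _).trans ?_
  calc _ ≤ ∑ _k : Fin N, ‖uCoef lam e‖ := Finset.sum_le_sum fun k _ => norm_le_pi_norm _ k
    _ = _ := by simp

theorem norm_offDiagEntry_le (lam e : Fin N → ℂ) :
    ‖offDiagEntry lam e‖ ≤ (∑ l, ‖lam l‖⁻¹) * ‖uCoef lam e‖ := by
  rw [offDiagEntry, offDiagValue, norm_neg, Finset.sum_mul]
  refine (norm_sum_le _ _).trans (Finset.sum_le_sum fun k _ => ?_)
  rw [norm_div, RCLike.norm_conj, div_eq_inv_mul]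
  gcongr
  exact norm_le_pi_norm _ k

/-- From |a|² + |b|² = 1 one gets D - D₋ = -2 D₋ |b|², while P = -2 D₋ a b. Since |a|, |b| ≤ 1, both
are controlled linearly by |b|. -/
theorem abs_inversion_sub_le (him : ∀ k, 0 < (lam k).im) (hinj : Function.Injective lam)
    {Dm : ℝ} (hDm : Dm = 1 ∨ Dm = -1) (e : Fin N → ℂ) :
    |inversion Dm lam e - Dm| ≤ 2 * ‖offDiagEntry lam e‖ ∧
      ‖polarization Dm lam e‖ ≤ 2 * ‖offDiagEntry lam e‖ := by
  have h := normSq_add_normSq him hinj e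
  have hD : |Dm| = 1 := by rcases hDm with rfl | rfl <;> norm_num
  rw [Complex.normSq_eq_norm_sq, Complex.normSq_eq_norm_sq] at h
  have ha : ‖diagEntry lam e‖ ≤ 1 := by
    nlinarith [sq_nonneg ‖offDiagEntry lam e‖, norm_nonneg (diagEntry lam e)]
  have hb : ‖offDiagEntry lam e‖ ≤ 1 := by
    nlinarith [sq_nonneg ‖diagEntry lam e‖, norm_nonneg (offDiagEntry lam e)]
  constructor
  · have : inversion Dm lam e - Dm = Dm * (-2 * ‖offDiagEntry lam e‖ ^ 2) := by
      rw [inversion, Complex.normSq_eq_norm_sq, Complex.normSq_eq_norm_sq]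
      linear_combination Dm * h
    rw [this, abs_mul, hD, one_mul, neg_mul, abs_neg, abs_of_nonneg (by positivity)]
    nlinarith [norm_nonneg (offDiagEntry lam e)]
  · rw [polarization, norm_mul, norm_mul, norm_mul, norm_neg, Complex.norm_real, Real.norm_eq_abs,
      hD, Complex.norm_ofNat]
    nlinarith [norm_nonneg (offDiagEntry lam e)]

theorem exists_localization (hr : 0 < r) (hα : StrictMono α)
    (hα_mem : ∀ k, 0 < α k ∧ α k < Real.pi) {ω : Fin N → ℂ} (hω : ∀ k, ω k ≠ 0)
    {Dm : ℝ} (hDm : Dm = 1 ∨ Dm = -1) :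
    ∃ C κ : ℝ, 0 < κ ∧ ∀ t z : ℝ,
      ‖pulse (eigenvalue r α) (expCoeff (eigenvalue r α) ω Dm t z)‖ ≤
        C * Real.exp (-κ * |z - velocity Dm r * t|) ∧
      |inversion Dm (eigenvalue r α) (expCoeff (eigenvalue r α) ω Dm t z) - Dm| ≤
        C * Real.exp (-κ * |z - velocity Dm r * t|) ∧
      ‖polarization Dm (eigenvalue r α) (expCoeff (eigenvalue r α) ω Dm t z)‖ ≤
        C * Real.exp (-κ * |z - velocity Dm r * t|) := by
  obtain ⟨C, κ, hC, hκ, h⟩ := exists_uCoef_expCoeff_bound hr hα hα_mem hω hDm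
  set B := ∑ l, ‖eigenvalue r α l‖⁻¹ with hB
  have hB0 : 0 ≤ B := Finset.sum_nonneg fun l _ => by positivity
  refine ⟨(2 * N + 2 * B) * C, κ, hκ, fun t z => ?_⟩
  have hu := h t z
  set e := expCoeff (eigenvalue r α) ω Dm t z with he
  set X := Real.exp (-κ * |z - velocity Dm r * t|) with hX
  have hX0 : 0 ≤ C * X := by positivity
  have h1 : ‖pulse (eigenvalue r α) e‖ ≤ 2 * N * (C * X) :=
    (norm_pulse_le _ _).trans (by gcongr)
  have h2 : ‖offDiagEntry (eigenvalue r α) e‖ ≤ B * (C * X) :=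
    (norm_offDiagEntry_le _ _).trans (by gcongr)
  have h3 := abs_inversion_sub_le (eigenvalue_im_pos hr hα_mem)
    (eigenvalue_injective hr hα hα_mem) hDm e
  have hN : (0 : ℝ) ≤ 2 * N * (C * X) := by positivity
  have hB1 : (0 : ℝ) ≤ B * (C * X) := by positivity
  refine ⟨?_, ?_, ?_⟩
  · linarith
  · linarith [h3.1]
  · linarith [h3.2]

theorem tendsto_exp_localization {κ V : ℝ} (hκ : 0 < κ) (hV : V ≠ 0) (C z : ℝ) :
    Tendsto (fun t : ℝ => C * Real.exp (-κ * |z - V * t|)) atBot (𝓝 0) := by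
  have h1 : Tendsto (fun t : ℝ => |z - V * t|) atBot atTop := by
    rcases hV.lt_or_gt with h | h
    · refine tendsto_abs_atBot_atTop.comp ?_
      simp only [sub_eq_add_neg]
      refine tendsto_atBot_add_const_left _ _ ?_
      simp_rw [← neg_mul]
      exact tendsto_id.const_mul_atBot (by linarith)
    · refine tendsto_abs_atTop_atTop.comp ?_
      simp only [sub_eq_add_neg]
      refine tendsto_atTop_add_const_left _ _ ?_
      simp_rw [← neg_mul]
      exact tendsto_id.const_mul_atBot_of_neg (by linarith)
  have h2 : Tendsto (fun t : ℝ => Real.exp (-κ * |z - V * t|)) atBot (𝓝 0) :=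
    Real.tendsto_exp_atBot.comp (h1.const_mul_atTop_of_neg (by linarith))
  simpa using h2.const_mul C

theorem isMBESolution (hr : 0 < r) (hα : StrictMono α)
    (hα_mem : ∀ k, 0 < α k ∧ α k < Real.pi) {ω : Fin N → ℂ} (hω : ∀ k, ω k ≠ 0)
    {Dm : ℝ} (hDm : Dm = 1 ∨ Dm = -1) :
    IsMBESolution Dm
      (fun t z => pulse (eigenvalue r α) (expCoeff (eigenvalue r α) ω Dm t z))
      (fun t z => inversion Dm (eigenvalue r α) (expCoeff (eigenvalue r α) ω Dm t z))
      (fun t z => polarization Dm (eigenvalue r α) (expCoeff (eigenvalue r α) ω Dm t z)) := by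
  have him := eigenvalue_im_pos hr hα_mem
  have hinj := eigenvalue_injective hr hα hα_mem
  have hV : velocity Dm r ≠ 0 := by
    have : Dm ≠ 0 := by rcases hDm with rfl | rfl <;> norm_num
    rw [velocity]
    positivity
  obtain ⟨C, κ, hκ, h⟩ := exists_localization hr hα hα_mem hω hDm
  exact {
    contDiff_q := (contDiff_pulse him hinj).comp (contDiff_expCoeff ω Dm)
    contDiff_D := (contDiff_inversion Dm him hinj).comp (contDiff_expCoeff ω Dm)
    contDiff_P := (contDiff_polarization Dm him hinj).comp (contDiff_expCoeff ω Dm)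
    q_z := fun t z => hasDerivAt_pulse him hinj Dm
      (hasDerivAt_expCoeff ω Dm (hasDerivAt_const z t) (hasDerivAt_id z))
    P_t := fun t z => hasDerivAt_polarization him hinj Dm
      (hasDerivAt_expCoeff ω Dm (hasDerivAt_id t) (hasDerivAt_const t z))
    D_t := fun t z => hasDerivAt_inversion him hinj Dm
      (hasDerivAt_expCoeff ω Dm (hasDerivAt_id t) (hasDerivAt_const t z))
    q_past := fun z => squeeze_zero_norm (fun t => (h t z).1)
      (tendsto_exp_localization hκ hV C z)
    D_past := fun z => tendsto_sub_nhds_zero_iff.mp (squeeze_zero_norm (fun t => (h t z).2.1)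
      (tendsto_exp_localization hκ hV C z))
    P_past := fun z => squeeze_zero_norm (fun t => (h t z).2.2)
      (tendsto_exp_localization hκ hV C z) }

end Localization

/-! ### The common velocity and decay along other directions. -/

section Directions

variable {N : ℕ} {r : ℝ} {α : Fin N → ℝ}

theorem im_theta_eq_zero_iff (hr : 0 < r) (hα_mem : ∀ k, 0 < α k ∧ α k < Real.pi)
    {Dm : ℝ} (hDm : Dm = 1 ∨ Dm = -1) (k : Fin N) (ξ : ℝ) :
    (∀ t : ℝ, (theta Dm (eigenvalue r α k) t (ξ * t)).im = 0) ↔ ξ = velocity Dm r := by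
  have hs := (Real.sin_pos_of_pos_of_lt_pi (hα_mem k).1 (hα_mem k).2).ne'
  have hD : Dm ≠ 0 := by rcases hDm with rfl | rfl <;> norm_num
  simp only [im_theta_eigenvalue hr hDm]
  constructor
  · intro h
    have h1 := h 1
    simp only [mul_one, mul_eq_zero, hs, false_or, div_eq_zero_iff, hD, hr.ne', OfNat.ofNat_ne_zero,
      or_false] at h1
    exact sub_eq_zero.mp h1
  · rintro rfl t
    simp

theorem decay_of_localization {E : Type*} [NormedAddCommGroup E] {f : ℝ → ℝ → E} {C κ V : ℝ}
    (h : ∀ t z, ‖f t z‖ ≤ C * Real.exp (-κ * |z - V * t|)) (ξ : ℝ) (l : Filter ℝ) :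
    (fun t : ℝ => f t (ξ * t)) =O[l] (fun t : ℝ => Real.exp (-(κ * |ξ - V|) * |t|)) := by
  refine IsBigO.of_bound C (Eventually.of_forall fun t => (h t (ξ * t)).trans_eq ?_)
  rw [Real.norm_eq_abs, Real.abs_exp, ← sub_mul, abs_mul]
  ring_nf

end Directions

/-! ### The determinantal formula and the asymptotics of the denominator. -/

section Determinants

variable {N : ℕ} {lam : Fin N → ℂ}

theorem solitonDenominator_eq (lam ω : Fin N → ℂ) (Dm t z : ℝ) :
    solitonDenominator lam ω Dm t z = (systemMatrix lam (expCoeff lam ω Dm t z)).det := rfl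

/-- The numerator matrix is a rank-one update of 1 + Γ Γ̄ by the column 𝟏 and the row -ē. The matrix
determinant lemma makes the quotient equal to 1 - Σ ē_l μ_l = 1 + Σ u_l. -/
theorem pulse_eq_det (him : ∀ k, 0 < (lam k).im) (hinj : Function.Injective lam)
    (ω : Fin N → ℂ) (Dm t z : ℝ) :
    pulse lam (expCoeff lam ω Dm t z) = 2 * Complex.I - 2 * Complex.I *
      (solitonNumerator lam ω Dm t z / solitonDenominator lam ω Dm t z) := by
  rw [solitonDenominator_eq]
  set e := expCoeff lam ω Dm t z with he
  have hdet := systemMatrix_det_ne_zero him hinj e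
  have h1 : solitonNumerator lam ω Dm t z = (systemMatrix lam e +
      (replicateCol Unit (1 : Fin N → ℂ) : Matrix (Fin N) Unit ℂ) *
        (replicateRow Unit (fun l => -conj (e l)) : Matrix Unit (Fin N) ℂ)).det := by
    rw [solitonNumerator, systemMatrix, sub_add_eq_add_sub, sub_eq_add_neg]
    congr 2
    ext k l
    simp [mul_apply, he]
  have hinv : (systemMatrix lam e)⁻¹ *ᵥ 1 = muCoef lam e := by
    rw [← systemMatrix_mulVec_muCoef him hinj e, mulVec_mulVec,
      nonsing_inv_mul _ (isUnit_iff_ne_zero.mpr hdet), one_mulVec]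
  rw [h1, det_add_replicateCol_mul_replicateRow (isUnit_iff_ne_zero.mpr hdet),
    mul_div_cancel_left₀ _ hdet, det_unique, Matrix.add_apply, one_apply_eq, Matrix.mul_assoc,
    ← replicateCol_mulVec, hinv, replicateRow_mul_replicateCol_apply, pulse, dotProduct]
  simp only [uCoef]
  ring

theorem tendsto_det_systemMatrix_of_tendsto_zero {ι : Type*} {l : Filter ι}
    {e : ι → Fin N → ℂ} (he : Tendsto e l (𝓝 0)) :
    Tendsto (fun i => (systemMatrix lam (e i)).det) l (𝓝 1) := by
  have hc : Continuous fun e => (systemMatrix lam e).det :=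
    (contDiff_det (n := 0) (contDiff_systemMatrix lam)).continuous
  have h0 : (systemMatrix lam (0 : Fin N → ℂ)).det = 1 := by
    have : coupling lam (0 : Fin N → ℂ) = 0 := by
      ext; simp [coupling]
    simp [systemMatrix, this]
  simpa only [Function.comp_def, h0] using (hc.tendsto 0).comp he

/-- For large e the summand G diag(e) Gᵀ diag(e)ᴴ dominates. Factoring it out on the left leaves 1
plus a term quadratic in e⁻¹ and its conjugate, whose determinant tends to 1. -/
theorem tendsto_det_systemMatrix_of_tendsto_inv_zero (him : ∀ k, 0 < (lam k).im)
    (hinj : Function.Injective lam) {ι : Type*} {l : Filter ι}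
    {e : ι → Fin N → ℂ} (hne : ∀ i k, e i k ≠ 0) (he : Tendsto (fun i => (e i)⁻¹) l (𝓝 0)) :
    Tendsto (fun i => (systemMatrix lam (e i)).det /
      (((‖(gram lam).det‖ * ∏ k, ‖e i k‖) ^ 2 : ℝ) : ℂ)) l (𝓝 1) := by
  set G := gram lam with hG
  have hdet : IsUnit G.det := (isUnit_iff_isUnit_det _).mp (gram_posDef him hinj).isUnit
  have hdetT : IsUnit Gᵀ.det := by rwa [det_transpose]
  let R : (Fin N → ℂ) → Matrix (Fin N) (Fin N) ℂ := fun c =>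
    1 + (diagonal c)ᴴ * Gᵀ⁻¹ * diagonal c * G⁻¹
  have hfac : ∀ i, systemMatrix lam (e i) = G * diagonal (e i) * Gᵀ * (diagonal (e i))ᴴ *
      R (e i)⁻¹ := by
    intro i
    have h1 : diagonal (e i) * diagonal (e i)⁻¹ = 1 := by
      rw [diagonal_mul_diagonal, ← diagonal_one]
      congr 1
      ext k
      simp [hne i k]
    have h2 : (diagonal (e i))ᴴ * (diagonal (e i)⁻¹)ᴴ = 1 := by
      rw [← conjTranspose_mul, diagonal_mul_diagonal, ← conjTranspose_one, ← diagonal_one]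
      congr 2
      ext k
      simp [hne i k]
    have h3 : G * diagonal (e i) * Gᵀ * (diagonal (e i))ᴴ *
        ((diagonal (e i)⁻¹)ᴴ * Gᵀ⁻¹ * diagonal (e i)⁻¹ * G⁻¹) = 1 := by
      calc _ = G * diagonal (e i) * Gᵀ * ((diagonal (e i))ᴴ * (diagonal (e i)⁻¹)ᴴ) * Gᵀ⁻¹ *
            diagonal (e i)⁻¹ * G⁻¹ := by simp only [Matrix.mul_assoc]
        _ = G * diagonal (e i) * (Gᵀ * Gᵀ⁻¹) * diagonal (e i)⁻¹ * G⁻¹ := by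
            rw [h2, Matrix.mul_one]; simp only [Matrix.mul_assoc]
        _ = G * (diagonal (e i) * diagonal (e i)⁻¹) * G⁻¹ := by
            rw [mul_nonsing_inv _ hdetT, Matrix.mul_one]; simp only [Matrix.mul_assoc]
        _ = 1 := by rw [h1, Matrix.mul_one, mul_nonsing_inv _ hdet]
    rw [systemMatrix_eq, conjGram, Matrix.mul_add, h3, Matrix.mul_one, add_comm]
    simp only [Matrix.mul_assoc, hG]
  have hval : ∀ i, (G * diagonal (e i) * Gᵀ * (diagonal (e i))ᴴ).det =
      (((‖G.det‖ * ∏ k, ‖e i k‖) ^ 2 : ℝ) : ℂ) := by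
    intro i
    have hGreal : conj G.det = G.det := by
      rw [← RCLike.star_def, ← det_conjTranspose, (gram_isHermitian lam).eq]
    have h1 : (G * diagonal (e i) * Gᵀ * (diagonal (e i))ᴴ).det =
        (G.det * conj G.det) * ∏ k, (e i k * conj (e i k)) := by
      rw [det_mul, det_mul, det_mul, det_transpose, det_conjTranspose, det_diagonal, hGreal,
        Finset.prod_mul_distrib, ← map_prod]
      simp only [RCLike.star_def]
      ring
    rw [h1, Complex.mul_conj']
    simp_rw [Complex.mul_conj']
    push_cast
    rw [Finset.prod_pow]
    ring
  have hcont : Continuous fun c => (R c).det := by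
    refine Continuous.matrix_det (continuous_const.add ?_)
    have : Continuous fun c : Fin N → ℂ => diagonal c := continuous_id.matrix_diagonal
    exact (((this.matrix_conjTranspose).matrix_mul continuous_const).matrix_mul this).matrix_mul
      continuous_const
  have hR0 : (R 0).det = 1 := by simp [R]
  have hlim : Tendsto (fun i => (R (e i)⁻¹).det) l (𝓝 1) := by
    simpa only [Function.comp_def, hR0] using (hcont.tendsto 0).comp he
  refine hlim.congr fun i => ?_
  have hne0 : (((‖G.det‖ * ∏ k, ‖e i k‖) ^ 2 : ℝ) : ℂ) ≠ 0 := by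
    have : ‖G.det‖ ≠ 0 := norm_ne_zero_iff.mpr hdet.ne_zero
    have h2 : ∏ k, ‖e i k‖ ≠ 0 :=
      Finset.prod_ne_zero_iff.mpr fun k _ => norm_ne_zero_iff.mpr (hne i k)
    exact_mod_cast pow_ne_zero 2 (mul_ne_zero this h2)
  rw [hfac i, det_mul _ (R _), hval i, mul_div_cancel_left₀ _ hne0]

end Determinants

/-! ### The center of the soliton group. -/

section Center

/-- The exponent of a purely exponential leading term is unique. -/
theorem exponent_unique {f : ℝ → ℂ} {l : Filter ℝ} [l.NeBot]
    (hl : Tendsto (fun z : ℝ => z + 1) l l) {a b a' b' : ℝ}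
    (h : Tendsto (fun z : ℝ => f z / (Real.exp (a * z + b) : ℂ)) l (𝓝 1))
    (h' : Tendsto (fun z : ℝ => f z / (Real.exp (a' * z + b') : ℂ)) l (𝓝 1)) :
    a = a' ∧ b = b' := by
  have h1 := (h.div h' one_ne_zero).norm
  rw [div_one, norm_one] at h1
  have h2 : Tendsto (fun z : ℝ => Real.exp ((a' - a) * z + (b' - b))) l (𝓝 1) := by
    refine h1.congr' ?_
    filter_upwards [h.eventually_ne one_ne_zero] with z hz
    have hf : f z ≠ 0 := fun h0 => hz (by simp [h0])
    simp only [Pi.div_apply, div_div_div_cancel_left' _ _ hf]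
    rw [← Complex.ofReal_div, ← Real.exp_sub, Complex.norm_real, Real.norm_eq_abs, Real.abs_exp]
    congr 1
    ring
  have h3 : Tendsto (fun z : ℝ => (a' - a) * z + (b' - b)) l (𝓝 0) := by
    have := (Real.continuousAt_log one_ne_zero).tendsto.comp h2
    simpa only [Function.comp_def, Real.log_exp, Real.log_one] using this
  -- An affine function tending to 0 is compared with its translate by 1, which isolates the slope.
  have h4 : a' - a = 0 := by
    have h5 := (h3.comp hl).sub h3
    rw [sub_zero] at h5
    refine tendsto_nhds_unique (tendsto_const_nhds.congr fun z => ?_) h5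
    simp only [Function.comp_apply]
    ring
  have h6 : b' - b = 0 := by
    simp only [h4, zero_mul, zero_add] at h3
    exact tendsto_nhds_unique tendsto_const_nhds h3
  exact ⟨by linarith, by linarith⟩

/-- Leading exponents are unique, so one known pair of leading terms decides the existential in
`IsMatchingCenter`. -/
theorem isMatchingCenter_iff {f : ℝ → ℂ} {a₁ b₁ a₂ b₂ : ℝ} (ha : a₁ ≠ a₂)
    (h₁ : Tendsto (fun z : ℝ => f z / (Real.exp (a₁ * z + b₁) : ℂ)) atBot (𝓝 1))
    (h₂ : Tendsto (fun z : ℝ => f z / (Real.exp (a₂ * z + b₂) : ℂ)) atTop (𝓝 1)) (c : ℝ) :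
    IsMatchingCenter f c ↔ a₁ * c + b₁ = a₂ * c + b₂ := by
  constructor
  · rintro ⟨a₁', b₁', a₂', b₂', -, h₁', h₂', hc⟩
    obtain ⟨rfl, rfl⟩ := exponent_unique (tendsto_atBot_add_const_right _ _ tendsto_id) h₁ h₁'
    obtain ⟨rfl, rfl⟩ := exponent_unique (tendsto_atTop_add_const_right _ _ tendsto_id) h₂ h₂'
    exact Real.exp_injective hc
  · intro hc
    exact ⟨a₁, b₁, a₂, b₂, ha, h₁, h₂, by rw [hc]⟩

variable {N : ℕ} {r : ℝ} {α : Fin N → ℝ}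

theorem tendsto_expCoeff_zero (hr : 0 < r) (hα_mem : ∀ k, 0 < α k ∧ α k < Real.pi)
    {Dm : ℝ} (hDm : Dm = 1 ∨ Dm = -1) (ω : Fin N → ℂ) (t : ℝ) {l : Filter ℝ}
    (hl : Tendsto (fun z => Dm * z) l atBot) :
    Tendsto (fun z => expCoeff (eigenvalue r α) ω Dm t z) l (𝓝 0) := by
  rw [tendsto_pi_nhds]
  intro k
  rw [Pi.zero_apply, tendsto_zero_iff_norm_tendsto_zero]
  simp only [norm_expCoeff_eigenvalue hr hDm]
  rw [← mul_zero ‖ω k‖]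
  refine (Real.tendsto_exp_atBot.comp ?_).const_mul _
  have hs := Real.sin_pos_of_pos_of_lt_pi (hα_mem k).1 (hα_mem k).2
  refine Tendsto.const_mul_atBot hs (Tendsto.atBot_div_const hr ?_)
  simp only [sub_eq_add_neg, mul_add]
  exact tendsto_atBot_add_const_right _ _ hl

theorem tendsto_inv_expCoeff_zero (hr : 0 < r) (hα_mem : ∀ k, 0 < α k ∧ α k < Real.pi)
    {Dm : ℝ} (hDm : Dm = 1 ∨ Dm = -1) (ω : Fin N → ℂ) (t : ℝ) {l : Filter ℝ}
    (hl : Tendsto (fun z => Dm * z) l atTop) :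
    Tendsto (fun z => (expCoeff (eigenvalue r α) ω Dm t z)⁻¹) l (𝓝 0) := by
  rw [tendsto_pi_nhds]
  intro k
  rw [Pi.zero_apply, tendsto_zero_iff_norm_tendsto_zero]
  simp only [Pi.inv_apply, norm_inv, norm_expCoeff_eigenvalue hr hDm, mul_inv, ← Real.exp_neg]
  rw [← mul_zero ‖ω k‖⁻¹]
  refine (Real.tendsto_exp_neg_atTop_nhds_zero.comp ?_).const_mul _
  have hs := Real.sin_pos_of_pos_of_lt_pi (hα_mem k).1 (hα_mem k).2
  refine Tendsto.const_mul_atTop hs (Tendsto.atTop_div_const hr ?_)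
  simp only [sub_eq_add_neg, mul_add]
  exact tendsto_atTop_add_const_right _ _ hl

/-- At one end the denominator tends to 1; at the other it is asymptotic to (|det G| ∏ |ω_k|)² exp(2
D₋ (z - V t) Σ sin α_k / r). The center is where this exponential equals 1. The sign of D₋ only
decides which end is which. -/
theorem isMatchingCenter_solitonDenominator_iff (hN : 1 ≤ N) (hr : 0 < r) (hα : StrictMono α)
    (hα_mem : ∀ k, 0 < α k ∧ α k < Real.pi) {ω : Fin N → ℂ} (hω : ∀ k, ω k ≠ 0)
    {Dm : ℝ} (hDm : Dm = 1 ∨ Dm = -1) (t c : ℝ) :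
    IsMatchingCenter (fun z => solitonDenominator (eigenvalue r α) ω Dm t z) c ↔
      c = velocity Dm r * t + displacement Dm r α ω := by
  have him := eigenvalue_im_pos hr hα_mem
  have hinj := eigenvalue_injective hr hα hα_mem
  set S := ∑ k, Real.sin (α k) with hS
  have hS0 : 0 < S := by
    have : Nonempty (Fin N) := ⟨⟨0, hN⟩⟩
    exact Finset.sum_pos (fun k _ => Real.sin_pos_of_pos_of_lt_pi (hα_mem k).1 (hα_mem k).2)
      Finset.univ_nonempty
  set d := ‖(gram (eigenvalue r α)).det‖ with hd
  have hd0 : 0 < d := norm_pos_iff.mpr (gram_posDef him hinj).det_pos.ne'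
  set w := ∏ k, ‖ω k‖ with hw
  have hw0 : 0 < w := Finset.prod_pos fun k _ => norm_pos_iff.mpr (hω k)
  set L := Real.log (w * d) with hL
  have hdisp : displacement Dm r α ω = -(Dm * r / S) * L := by
    have hprod : ∏ k, ∏ l, ‖conj (eigenvalue r α k) - eigenvalue r α l‖ ≠ 0 :=
      Finset.prod_ne_zero_iff.mpr fun k _ => Finset.prod_ne_zero_iff.mpr fun l _ =>
        norm_ne_zero_iff.mpr (conj_sub_ne_zero him k l)
    rw [displacement, ← norm_det_gram him hinj, mul_div_cancel_right₀ _ hprod]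
  set a := 2 * S * Dm / r with ha
  set b := 2 * L - 2 * S * Dm * (velocity Dm r * t) / r with hb
  have hD : Dm ≠ 0 := by rcases hDm with rfl | rfl <;> norm_num
  have hDD : Dm * Dm = 1 := by rcases hDm with rfl | rfl <;> norm_num
  have ha0 : a ≠ 0 := by positivity
  have hexp : ∀ z, (d * ∏ k, ‖expCoeff (eigenvalue r α) ω Dm t z k‖) ^ 2 =
      Real.exp (a * z + b) := by
    intro z
    have h1 : a * z + b = 2 * L + 2 * ∑ k, Real.sin (α k) * (Dm * (z - velocity Dm r * t) / r) := by
      rw [← Finset.sum_mul, ha, hb]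
      ring
    simp only [norm_expCoeff_eigenvalue hr hDm, Finset.prod_mul_distrib]
    rw [h1, Real.exp_add, ← Real.exp_sum, two_mul L, two_mul (Finset.sum _ _), Real.exp_add,
      Real.exp_add, hL, Real.exp_log (by positivity)]
    ring
  have hsmall : ∀ l : Filter ℝ, Tendsto (fun z => Dm * z) l atBot →
      Tendsto (fun z => solitonDenominator (eigenvalue r α) ω Dm t z /
        (Real.exp (0 * z + 0) : ℂ)) l (𝓝 1) := by
    intro l hl
    simpa [solitonDenominator_eq] using tendsto_det_systemMatrix_of_tendsto_zero
      (lam := eigenvalue r α) (tendsto_expCoeff_zero hr hα_mem hDm ω t hl)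
  have hlarge : ∀ l : Filter ℝ, Tendsto (fun z => Dm * z) l atTop →
      Tendsto (fun z => solitonDenominator (eigenvalue r α) ω Dm t z /
        (Real.exp (a * z + b) : ℂ)) l (𝓝 1) := by
    intro l hl
    have := tendsto_det_systemMatrix_of_tendsto_inv_zero him hinj
      (fun z k => expCoeff_ne_zero hω Dm t z k) (tendsto_inv_expCoeff_zero hr hα_mem hDm ω t hl)
    simp only [← hd, hexp] at this
    exact this
  have hc : (a * c + b = 0) ↔ c = velocity Dm r * t + displacement Dm r α ω := by
    have h1 : a * c + b = a * (c - (velocity Dm r * t + displacement Dm r α ω)) := by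
      rw [hdisp, ha, hb]
      field_simp
      linear_combination (-r * L) * hDD
    rw [h1, mul_eq_zero, or_iff_right ha0, sub_eq_zero]
  rw [← hc]
  rcases hDm with h | h
  · have h1 : (fun z => Dm * z) = id := by ext z; simp [h]
    rw [isMatchingCenter_iff ha0.symm (hsmall _ (by rw [h1]; exact tendsto_id))
      (hlarge _ (by rw [h1]; exact tendsto_id))]
    rw [zero_mul, add_zero, eq_comm]
  · have h1 : (fun z => Dm * z) = Neg.neg := by ext z; simp [h]
    rw [isMatchingCenter_iff ha0 (hlarge _ (by rw [h1]; exact tendsto_neg_atBot_atTop))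
      (hsmall _ (by rw [h1]; exact tendsto_neg_atTop_atBot))]
    rw [zero_mul, add_zero]

end Center

/-! ### Limiting norming constants along a line. -/

section Recurrence

variable {N : ℕ} {lam : Fin N → ℂ}

/-- Translating (t, z) amounts to changing the norming constants, so limits of translated solutions
can be taken among the coefficients. -/
theorem expCoeff_expCoeff (lam ω : Fin N → ℂ) (Dm s y t z : ℝ) :
    expCoeff lam (expCoeff lam ω Dm s y) Dm t z = expCoeff lam ω Dm (s + t) (y + z) := by
  ext k
  simp only [expCoeff, theta]
  rw [mul_assoc, ← Complex.exp_add]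
  congr 2
  push_cast
  ring

theorem continuous_expCoeff_coeff (lam : Fin N → ℂ) (Dm t z : ℝ) :
    Continuous fun ω => expCoeff lam ω Dm t z := by
  refine continuous_pi fun k => ?_
  simp only [expCoeff]
  exact (continuous_apply k).mul continuous_const

/-- Along a line on which the coefficients have constant modulus, there is a limiting set of norming
constants for which every convergent continuous observable is constant. -/
theorem exists_limit_coefficients (lam ω : Fin N → ℂ) (Dm V : ℝ)
    (hnorm : ∀ s k, ‖expCoeff lam ω Dm s (V * s) k‖ = ‖ω k‖) {l : Filter ℝ} [l.NeBot]
    (hl : ∀ t : ℝ, Tendsto (fun s => s + t) l l) :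
    ∃ ω' : Fin N → ℂ, (∀ k, ‖ω' k‖ = ‖ω k‖) ∧
      ∀ (G : (Fin N → ℂ) → ℂ) (c : ℂ), Continuous G →
        Tendsto (fun s => G (expCoeff lam ω Dm s (V * s))) l (𝓝 c) →
        ∀ t, G (expCoeff lam ω' Dm t (V * t)) = c := by
  have hK : IsCompact (Set.pi Set.univ fun k => Metric.sphere (0 : ℂ) ‖ω k‖) :=
    isCompact_univ_pi fun k => isCompact_sphere _ _
  have hmem : ∀ s, expCoeff lam ω Dm s (V * s) ∈
      Set.pi Set.univ fun k => Metric.sphere (0 : ℂ) ‖ω k‖ := fun s k _ => by simp [hnorm s k]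
  -- The coefficients remain in a product of circles; compactness supplies a cluster point, which
  -- serves as new norming constants.
  obtain ⟨ω', hω', hcl⟩ := hK.exists_mapClusterPt_of_frequently (l := l)
    (f := fun s => expCoeff lam ω Dm s (V * s)) (Eventually.of_forall hmem).frequently
  refine ⟨ω', fun k => by simpa using hω' k trivial, fun G c hG hc t => ?_⟩
  have h1 := MapClusterPt.continuousAt_comp
    (f := fun ω => G (expCoeff lam ω Dm t (V * t)))
    (hG.comp (continuous_expCoeff_coeff lam Dm t (V * t))).continuousAt hcl
  -- Shifting s by t does not change the limit c, and by the group law the shifted observable is a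
  -- continuous function of the coefficients at s.
  have h2 : Tendsto ((fun ω => G (expCoeff lam ω Dm t (V * t))) ∘
      fun s => expCoeff lam ω Dm s (V * s)) l (𝓝 c) := by
    refine (hc.comp (hl t)).congr fun s => ?_
    simp only [Function.comp_apply, expCoeff_expCoeff, mul_add]
  have h3 : ClusterPt (G (expCoeff lam ω' Dm t (V * t))) (𝓝 c) := h1.clusterPt.mono h2
  exact eq_of_nhds_neBot h3

end Recurrence

/-! ### Persistence of the pulse along z = V t. -/

section NoDecay

variable {N : ℕ} {r : ℝ} {α : Fin N → ℝ}

theorem norm_expCoeff_velocity (hr : 0 < r) {Dm : ℝ} (hDm : Dm = 1 ∨ Dm = -1) (ω : Fin N → ℂ)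
    (s : ℝ) (k : Fin N) :
    ‖expCoeff (eigenvalue r α) ω Dm s (velocity Dm r * s) k‖ = ‖ω k‖ := by
  rw [norm_expCoeff_eigenvalue hr hDm]
  simp

theorem sum_xCoef_div (lam e : Fin N → ℂ) :
    ∑ l, xCoef lam e l / lam l = 1 - diagEntry lam e := by
  simp [diagEntry, diagValue]

/-- The pulse cannot vanish identically along `z = V t`, even in the limit. -/
theorem not_tendsto_pulse_zero (hN : 1 ≤ N) (hr : 0 < r) (hα : StrictMono α)
    (hα_mem : ∀ k, 0 < α k ∧ α k < Real.pi) {ω : Fin N → ℂ} (hω : ∀ k, ω k ≠ 0)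
    {Dm : ℝ} (hDm : Dm = 1 ∨ Dm = -1) {l : Filter ℝ} [l.NeBot]
    (hl : ∀ t : ℝ, Tendsto (fun s => s + t) l l) :
    ¬ Tendsto (fun t : ℝ => pulse (eigenvalue r α)
      (expCoeff (eigenvalue r α) ω Dm t (velocity Dm r * t))) l (𝓝 0) := by
  intro hlim
  have him := eigenvalue_im_pos hr hα_mem
  have hinj := eigenvalue_injective hr hα hα_mem
  have hDD : (Dm : ℂ) * Dm = 1 := by rcases hDm with rfl | rfl <;> norm_num
  have hVD : (velocity Dm r : ℂ) * Dm = -2 * (r : ℂ) ^ 2 := by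
    rw [velocity]
    push_cast
    linear_combination (-2 * (r : ℂ) ^ 2) * hDD
  set lam := eigenvalue r α with hlam
  set V := velocity Dm r with hV
  have hflow : ∀ (ν : Fin N → ℂ) (s : ℝ) (k : Fin N),
      HasDerivAt (fun s => expCoeff lam ν Dm s (V * s) k)
        (rate Dm lam 1 V k * expCoeff lam ν Dm s (V * s) k) s := fun ν s k =>
    hasDerivAt_expCoeff ν Dm (hasDerivAt_id s) (by simpa using (hasDerivAt_id s).const_mul V) k
  have hcx : ∀ k, Continuous fun e => xCoef lam e k := fun k =>
    (contDiff_xCoef (n := 0) him hinj k).continuous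
  have hcF : Continuous fun e => (((∑ k, xCoef lam e k).im : ℝ) : ℂ) :=
    Complex.continuous_ofReal.comp (Complex.continuous_im.comp
      (continuous_finsetSum _ fun k _ => hcx k))
  have hcq : Continuous (pulse lam) := (contDiff_pulse (n := 0) him hinj).continuous
  -- First limit: for the norming constants ω₁ the pulse vanishes at every point of the line.
  obtain ⟨ω₁, hω₁, h₁⟩ := exists_limit_coefficients lam ω Dm V
    (norm_expCoeff_velocity hr hDm ω) hl
  have hq₁ := h₁ _ _ hcq hlim
  have hsum_zero : ∀ e, pulse lam e = 0 → ∑ k, uCoef lam e k = 0 := by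
    intro e he
    simpa [pulse] using he
  -- Im Σ x_k acts as a Lyapunov function: wherever q = 0, its derivative along the line is -2 r²
  -- |M₁₂(0)|², because V D₋ = -2 r².
  have hF : ∀ (ν : Fin N → ℂ) (s : ℝ), pulse lam (expCoeff lam ν Dm s (V * s)) = 0 →
      HasDerivAt (fun s => (∑ k, xCoef lam (expCoeff lam ν Dm s (V * s)) k).im)
        (-2 * r ^ 2 * Complex.normSq (offDiagEntry lam (expCoeff lam ν Dm s (V * s)))) s := by
    intro ν s hs
    have h := Complex.imCLM.hasFDerivAt.comp_hasDerivAt s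
      (HasDerivAt.fun_sum fun k (_ : k ∈ Finset.univ) =>
        (hasDerivAt_coef him hinj Dm 1 V (hflow ν s) k).1)
    refine h.congr_deriv ?_
    set e := expCoeff lam ν Dm s (V * s)
    have h1 : ∀ k, xFlow Dm lam (xCoef lam e) (uCoef lam e) 1 V k =
        (V * (Complex.I * Dm * offDiagEntry lam e * conj (offDiagEntry lam e))) *
          (xCoef lam e k / lam k) -
        (V * (Complex.I * Dm * offDiagEntry lam e * diagEntry lam e)) *
          (conj (uCoef lam e k) / lam k) := by
      intro k
      rw [xFlow, hsum_zero e hs]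
      simp only [offDiagEntry, diagEntry]
      ring
    simp only [h1, Finset.sum_sub_distrib, ← Finset.mul_sum, sum_xCoef_div, sum_conj_uCoef_div]
    have h2 : V * (Complex.I * Dm * offDiagEntry lam e * conj (offDiagEntry lam e)) *
        (1 - diagEntry lam e) - V * (Complex.I * Dm * offDiagEntry lam e * diagEntry lam e) *
          -conj (offDiagEntry lam e) =
        ((-2 * r ^ 2 * Complex.normSq (offDiagEntry lam e) : ℝ) : ℂ) * Complex.I := by
      push_cast
      rw [← Complex.mul_conj]
      linear_combination
        (Complex.I * offDiagEntry lam e * conj (offDiagEntry lam e)) * hVD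
    rw [h2, Complex.imCLM_apply, Complex.im_ofReal_mul, Complex.I_im, mul_one]
  obtain ⟨c, hc⟩ : ∃ c, Tendsto (fun s => (∑ k, xCoef lam (expCoeff lam ω₁ Dm s (V * s)) k).im)
      atTop (𝓝 c) := by
    have hanti : Antitone fun s => (∑ k, xCoef lam (expCoeff lam ω₁ Dm s (V * s)) k).im := by
      refine antitone_of_deriv_nonpos (fun s => (hF ω₁ s (hq₁ s)).differentiableAt) fun s => ?_
      rw [(hF ω₁ s (hq₁ s)).deriv]
      have := Complex.normSq_nonneg (offDiagEntry lam (expCoeff lam ω₁ Dm s (V * s)))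
      have : 0 ≤ r ^ 2 * Complex.normSq (offDiagEntry lam (expCoeff lam ω₁ Dm s (V * s))) := by
        positivity
      linarith
    refine ⟨_, tendsto_atTop_ciInf hanti ?_⟩
    obtain ⟨B, -, hB⟩ := exists_xCoef_bound him hinj
    refine ⟨-(N * B), ?_⟩
    rintro _ ⟨s, rfl⟩
    refine neg_le_of_abs_le ((Complex.abs_im_le_norm _).trans ((norm_sum_le _ _).trans ?_))
    calc _ ≤ ∑ _k : Fin N, B := Finset.sum_le_sum fun k _ => (norm_le_pi_norm _ k).trans (hB _)
      _ = _ := by simp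
  -- Second limit: the monotone bounded quantity converges, so for ω₂ it is constant and M₁₂(0)
  -- vanishes on the whole line.
  obtain ⟨ω₂, hω₂, h₂⟩ := exists_limit_coefficients lam ω₁ Dm V
    (norm_expCoeff_velocity hr hDm ω₁) (l := atTop)
    (fun t => tendsto_atTop_add_const_right _ _ tendsto_id)
  have hq₂ := h₂ _ 0 hcq (by simp only [hq₁]; exact tendsto_const_nhds)
  have hF₂ := h₂ _ _ hcF (Complex.continuous_ofReal.continuousAt.tendsto.comp hc)
  have hb₂ : ∀ s, offDiagEntry lam (expCoeff lam ω₂ Dm s (V * s)) = 0 := by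
    intro s
    have h := hF ω₂ s (hq₂ s)
    have hconst : (fun s => (∑ k, xCoef lam (expCoeff lam ω₂ Dm s (V * s)) k).im) = fun _ => c :=
      funext fun s => Complex.ofReal_injective (hF₂ s)
    rw [hconst] at h
    have := h.unique (hasDerivAt_const s c)
    simpa [hr.ne'] using this
  -- With Σ u_l = 0, M₁₂(0) = 0 and |M₁₁(0)| = 1 the flow of u decouples: 2i λ̄_k + 2i r² / λ̄_k =
  -- 4i Re λ_k.
  have hu₂ : ∀ s k, HasDerivAt (fun s => uCoef lam (expCoeff lam ω₂ Dm s (V * s)) k)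
      (((4 * (lam k).re : ℝ) : ℂ) * Complex.I * uCoef lam (expCoeff lam ω₂ Dm s (V * s)) k) s := by
    intro s k
    refine (hasDerivAt_coef him hinj Dm 1 V (hflow ω₂ s) k).2.congr_deriv ?_
    have h0 := hb₂ s
    have h1 := hsum_zero _ (hq₂ s)
    have hdet := (isSystemSolution_coef him hinj (expCoeff lam ω₂ Dm s (V * s))).det_eq_one him
    set e := expCoeff lam ω₂ Dm s (V * s)
    rw [offDiagEntry] at h0
    rw [h0, zero_mul, add_zero] at hdet
    rw [uFlow, h1, h0]
    have h2 : (r : ℂ) ^ 2 / conj (lam k) = lam k := by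
      rw [div_eq_iff (conj_ne_zero_of_im_pos him k), eigenvalue_mul_conj]
    have h3 : ((4 * (lam k).re : ℝ) : ℂ) = 2 * (lam k + conj (lam k)) := by
      rw [Complex.add_conj]
      push_cast
      ring
    rw [h3]
    simp only [Complex.ofReal_one, zero_mul, mul_zero, sub_zero, zero_sub, one_mul]
    linear_combination (-(V * Complex.I * Dm / conj (lam k) * uCoef lam e k)) * hdet
      - (Complex.I / conj (lam k) * uCoef lam e k) * hVD
      + (2 * Complex.I * uCoef lam e k) * h2
  -- Repeated differentiation of Σ u_k = 0 gives all power sums. The Re λ_k are distinct on the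
  -- upper semicircle, so a Vandermonde argument yields u = 0.
  have hpow : ∀ (n : ℕ) (s : ℝ), ∑ k, uCoef lam (expCoeff lam ω₂ Dm s (V * s)) k *
      (((4 * (lam k).re : ℝ) : ℂ) * Complex.I) ^ n = 0 := by
    intro n
    induction n with
    | zero => intro s; simpa using hsum_zero _ (hq₂ s)
    | succ n ih =>
      intro s
      have h1 := HasDerivAt.fun_sum fun k (_ : k ∈ Finset.univ) =>
        (hu₂ s k).mul_const ((((4 * (lam k).re : ℝ) : ℂ) * Complex.I) ^ n)
      have h2 := h1.unique (by simp only [ih]; exact hasDerivAt_const s 0)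
      rw [← h2]
      exact Finset.sum_congr rfl fun k _ => by ring
  have hvinj : Function.Injective fun k => ((4 * (lam k).re : ℝ) : ℂ) * Complex.I := by
    intro k l h
    have h1 := Complex.ofReal_injective (mul_right_cancel₀ Complex.I_ne_zero h)
    exact eigenvalue_re_injective hr hα hα_mem (by simpa using h1)
  have hu0 := eq_zero_of_forall_pow_sum_mul_pow_eq_zero hvinj fun i => hpow i 0
  have hne : expCoeff lam ω₂ Dm 0 (V * 0) ⟨0, hN⟩ ≠ 0 := by
    refine expCoeff_ne_zero (fun k => ?_) _ _ _ _
    rw [← norm_ne_zero_iff, hω₂, hω₁]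
    exact norm_ne_zero_iff.mpr (hω k)
  change uCoef lam (expCoeff lam ω₂ Dm 0 (V * 0)) = 0 at hu0
  generalize expCoeff lam ω₂ Dm 0 (V * 0) = e at hu0 hne
  have hsys := isSystemSolution_coef him hinj e
  have hx0 : xCoef lam e = 0 := by
    ext k
    rw [hsys.x_eq, hu0]
    simp [lowerSum]
  -- With x = 0 the system gives u_k = -ē_k, which is nonzero, against u = 0.
  have hu := hsys.u_eq ⟨0, hN⟩
  rw [hx0, hu0] at hu
  simp [upperSum, hne] at hu

end NoDecay

/-! ### Removing a circle across which a function is continuous. -/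

section CircleGluing

open Metric

/-- The integrand is holomorphic on the annulus, so the contour shrinks to radius ε, where Cauchy's
formula for the small disk applies. -/
theorem cauchy_integral_inner {f : ℂ → ℂ} {c w : ℂ} {ε R : ℝ} (hε : 0 < ε) (hεR : ε < R)
    (hc : ContinuousOn f (closedBall c R)) (h₁ : DifferentiableOn ℂ f (ball c ε))
    (h₂ : DifferentiableOn ℂ f (ball c R \ closedBall c ε)) (hw : w ∈ ball c ε) :
    (∮ z in C(c, R), (z - w)⁻¹ * f z) = (2 * Real.pi * Complex.I : ℂ) * f w := by
  have hne : ∀ z, z ∉ ball c ε → z - w ≠ 0 := fun z hz h => hz (sub_eq_zero.mp h ▸ hw)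
  have hcont : ContinuousOn (fun z => (z - w)⁻¹ * f z) (closedBall c R \ ball c ε) :=
    (ContinuousOn.inv₀ (by fun_prop) fun z hz => hne z hz.2).mul (hc.mono Set.sdiff_subset)
  rw [Complex.circleIntegral_eq_of_differentiable_on_annulus_off_countable
    (f := fun z => (z - w)⁻¹ * f z) hε hεR.le Set.countable_empty hcont (fun z hz => ?_)]
  · exact Complex.circleIntegral_sub_inv_smul_of_differentiable_on_off_countable
      Set.countable_empty hw (hc.mono (closedBall_subset_closedBall hεR.le))
      fun z hz => h₁.differentiableAt (isOpen_ball.mem_nhds hz.1)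
  · have hz' : z ∉ ball c ε := fun h => hz.1.2 (ball_subset_closedBall h)
    exact DifferentiableAt.mul (DifferentiableAt.inv (by fun_prop) (hne z hz'))
      (h₂.differentiableAt ((isOpen_ball.sdiff isClosed_closedBall).mem_nhds hz.1))

/-- The Cauchy integrand has a pole in the annulus, but `dslope f w` does not, so its integrals over
the two circles agree. On the inner circle both of its parts integrate to 0. -/
theorem cauchy_integral_outer {f : ℂ → ℂ} {c w : ℂ} {ε R : ℝ} (hε : 0 < ε) (hεR : ε < R)
    (hc : ContinuousOn f (closedBall c R)) (h₁ : DifferentiableOn ℂ f (ball c ε))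
    (h₂ : DifferentiableOn ℂ f (ball c R \ closedBall c ε)) (hw : w ∈ ball c R)
    (hw' : w ∉ closedBall c ε) :
    (∮ z in C(c, R), (z - w)⁻¹ * f z) = (2 * Real.pi * Complex.I : ℂ) * f w := by
  have hU : ball c R \ closedBall c ε ∈ 𝓝 w :=
    (isOpen_ball.sdiff isClosed_closedBall).mem_nhds ⟨hw, hw'⟩
  have hU' : closedBall c R \ ball c ε ∈ 𝓝 w := mem_of_superset hU fun z hz =>
    ⟨ball_subset_closedBall hz.1, fun h => hz.2 (ball_subset_closedBall h)⟩
  have hfw : DifferentiableAt ℂ f w := h₂.differentiableAt hU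
  have hdiff := Complex.circleIntegral_eq_of_differentiable_on_annulus_off_countable
    (f := dslope f w) hε hεR.le (Set.countable_singleton w)
    ((continuousOn_dslope hU').mpr ⟨hc.mono Set.sdiff_subset, hfw⟩)
    (fun z hz => (differentiableAt_dslope_of_ne (by simpa using hz.2)).mpr
      (h₂.differentiableAt ((isOpen_ball.sdiff isClosed_closedBall).mem_nhds hz.1)))
  have hsplit : ∀ ρ : ℝ, 0 < ρ → ρ ≤ R → w ∉ sphere c ρ →
      (∮ z in C(c, ρ), dslope f w z) =
        (∮ z in C(c, ρ), (z - w)⁻¹ * f z) - (∮ z in C(c, ρ), (z - w)⁻¹) * f w := by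
    intro ρ hρ hρR hwρ
    have hne : ∀ z ∈ sphere c ρ, z - w ≠ 0 := fun z hz h => hwρ (sub_eq_zero.mp h ▸ hz)
    have hinv : ContinuousOn (fun z => (z - w)⁻¹) (sphere c ρ) :=
      ContinuousOn.inv₀ (by fun_prop) hne
    have hfρ : ContinuousOn f (sphere c ρ) :=
      hc.mono (sphere_subset_closedBall.trans (closedBall_subset_closedBall hρR))
    have hi₁ : CircleIntegrable (fun z => (z - w)⁻¹ * f z) c ρ :=
      (hinv.mul hfρ).circleIntegrable hρ.le
    have hi₂ : CircleIntegrable (fun z => (z - w)⁻¹ * f w) c ρ :=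
      (hinv.mul continuousOn_const).circleIntegrable hρ.le
    have hcongr : (∮ z in C(c, ρ), dslope f w z) =
        ∮ z in C(c, ρ), ((z - w)⁻¹ * f z - (z - w)⁻¹ * f w) := by
      refine circleIntegral.integral_congr hρ.le fun z hz => ?_
      simp only [dslope_of_ne f (sub_ne_zero.mp (hne z hz)), slope_def_field]
      ring
    rw [hcongr, circleIntegral.integral_sub hi₁ hi₂]
    congr 1
    exact circleIntegral.integral_smul_const (fun z => (z - w)⁻¹) (f w) c ρ
  have hnez : ∀ z ∈ closedBall c ε, z - w ≠ 0 := fun z hz h => hw' (sub_eq_zero.mp h ▸ hz)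
  have hz₁ : (∮ z in C(c, ε), (z - w)⁻¹) = 0 :=
    Complex.circleIntegral_eq_zero_of_differentiable_on_off_countable hε.le Set.countable_empty
      (ContinuousOn.inv₀ (by fun_prop) hnez)
      fun z hz => DifferentiableAt.inv (by fun_prop) (hnez z (ball_subset_closedBall hz.1))
  have hz₂ : (∮ z in C(c, ε), (z - w)⁻¹ * f z) = 0 :=
    Complex.circleIntegral_eq_zero_of_differentiable_on_off_countable hε.le Set.countable_empty
      ((ContinuousOn.inv₀ (by fun_prop) hnez).mul
        (hc.mono (closedBall_subset_closedBall hεR.le)))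
      fun z hz => by
        have hi : DifferentiableAt ℂ (fun z => (z - w)⁻¹) z :=
          DifferentiableAt.inv (by fun_prop) (hnez z (ball_subset_closedBall hz.1))
        exact hi.mul (h₁.differentiableAt (isOpen_ball.mem_nhds hz.1))
  rw [hsplit R (hε.trans hεR) le_rfl fun h => (mem_ball.mp hw).ne h,
    hsplit ε hε hεR.le fun h => hw' (sphere_subset_closedBall h), hz₁, hz₂,
    circleIntegral.integral_sub_inv_of_mem_ball hw] at hdiff
  linear_combination hdiff

/-- A function that is continuous on a disk and holomorphic off a concentric circle is
holomorphic. -/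
theorem differentiableOn_of_off_circle {f : ℂ → ℂ} {c : ℂ} {ε R : ℝ} (hε : 0 < ε) (hεR : ε < R)
    (hc : ContinuousOn f (closedBall c R)) (h₁ : DifferentiableOn ℂ f (ball c ε))
    (h₂ : DifferentiableOn ℂ f (ball c R \ closedBall c ε)) :
    DifferentiableOn ℂ f (ball c R) := by
  have hR : 0 < R := hε.trans hεR
  let g : ℂ → ℂ := fun w =>
    (2 * Real.pi * Complex.I : ℂ)⁻¹ • ∮ z in C(c, R), (z - w)⁻¹ • f z
  have hg : DifferentiableOn ℂ g (ball c R) := by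
    have h := (hasFPowerSeriesOn_cauchy_integral (R := ⟨R, hR.le⟩)
      ((hc.mono sphere_subset_closedBall).circleIntegrable hR.le) hR).differentiableOn
    exact h.mono (Metric.eball_coe (x := c) (ε := ⟨R, hR.le⟩)).ge
  have hval : ∀ w, (∮ z in C(c, R), (z - w)⁻¹ * f z) = (2 * Real.pi * Complex.I : ℂ) * f w →
      f w = g w := by
    intro w h
    simp only [g, smul_eq_mul, h]
    rw [inv_mul_cancel_left₀ Complex.two_pi_I_ne_zero]
  -- Points of the circle itself are reached by continuity from the open disk.
  have hin : Set.EqOn f g (closedBall c ε) := by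
    refine Set.EqOn.of_subset_closure (s := ball c ε)
      (fun w hw => hval w (cauchy_integral_inner hε hεR hc h₁ h₂ hw))
      (hc.mono (closedBall_subset_closedBall hεR.le))
      (hg.continuousOn.mono (closedBall_subset_ball hεR)) ball_subset_closedBall ?_
    rw [closure_ball c hε.ne']
  refine hg.congr fun w hw => ?_
  by_cases hw' : w ∈ closedBall c ε
  · exact hin hw'
  · exact hval w (cauchy_integral_outer hε hεR hc h₁ h₂ hw hw')

end CircleGluing

/-! ### Equivalence of residue and jump problems for nilpotent data. -/

section AbstractProblem

open Metric

/-- `2 × 2` complex matrices. -/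
abbrev Mat2 := Matrix (Fin 2) (Fin 2) ℂ

variable {ι : Type*}

/-- A residue problem with poles `p n` and nilpotent residue data `A n`. -/
structure ResidueProblem (p : ι → ℂ) (A : ι → ℂ → Mat2) (M : ℂ → Mat2) : Prop where
  analytic : ∀ i j, DifferentiableOn ℂ (fun w => M w i j) (Set.range p)ᶜ
  tendsto_one : Tendsto M (cocompact ℂ) (𝓝 1)
  residue : ∀ n, ∃ R : Mat2, Tendsto (fun w => (w - p n) • M w) (𝓝[≠] (p n)) (𝓝 R) ∧
    Tendsto (fun w => M w * A n w) (𝓝[≠] (p n)) (𝓝 R)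

/-- The matrix `1 - A(w) / (w - p)`. -/
noncomputable def jumpFactor (p : ι → ℂ) (A : ι → ℂ → Mat2) (n : ι) (w : ℂ) : Mat2 :=
  1 - (w - p n)⁻¹ • A n w

/-- The matrix `1 + A(w) / (w - p)`. -/
noncomputable def jumpFactorInv (p : ι → ℂ) (A : ι → ℂ → Mat2) (n : ι) (w : ℂ) : Mat2 :=
  1 + (w - p n)⁻¹ • A n w

/-- A jump problem on the circles of radius `ε` about the points `p n`. -/
structure JumpProblem (p : ι → ℂ) (A : ι → ℂ → Mat2) (ε : ℝ) (M : ℂ → Mat2) : Prop where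
  analytic : ∀ i j, DifferentiableOn ℂ (fun w => M w i j) (⋃ n, sphere (p n) ε)ᶜ
  tendsto_one : Tendsto M (cocompact ℂ) (𝓝 1)
  jump : ∀ n, ∃ Mp Mm : ℂ → Mat2, ContinuousOn Mp (sphere (p n) ε) ∧
    ContinuousOn Mm (sphere (p n) ε) ∧ ∀ w ∈ sphere (p n) ε,
      Tendsto M (𝓝[ball (p n) ε] w) (𝓝 (Mp w)) ∧
      Tendsto M (𝓝[(closedBall (p n) ε)ᶜ] w) (𝓝 (Mm w)) ∧
      Mp w = Mm w * jumpFactor p A n w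

theorem jumpFactorInv_mul_jumpFactor {p : ι → ℂ} {A : ι → ℂ → Mat2}
    (hA : ∀ n w, A n w * A n w = 0) (n : ι) (w : ℂ) :
    jumpFactorInv p A n w * jumpFactor p A n w = 1 := by
  simp [jumpFactor, jumpFactorInv, Matrix.add_mul, Matrix.mul_sub, hA]

theorem differentiableAt_mul_apply {F G : ℂ → Mat2} {w : ℂ}
    (hF : ∀ i j, DifferentiableAt ℂ (fun w => F w i j) w)
    (hG : ∀ i j, DifferentiableAt ℂ (fun w => G w i j) w) (i j : Fin 2) :
    DifferentiableAt ℂ (fun w => (F w * G w) i j) w := by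
  simp only [mul_apply]
  exact DifferentiableAt.fun_sum fun k _ => (hF i k).mul (hG k j)

theorem continuousAt_of_entries {F : ℂ → Mat2} {w : ℂ}
    (hF : ∀ i j, DifferentiableAt ℂ (fun w => F w i j) w) : ContinuousAt F w :=
  continuousAt_pi.mpr fun i => continuousAt_pi.mpr fun j => (hF i j).continuousAt

theorem tendsto_mat_entry {F : ℂ → Mat2} {l : Filter ℂ} {R : Mat2} (h : Tendsto F l (𝓝 R))
    (i j : Fin 2) : Tendsto (fun w => F w i j) l (𝓝 (R i j)) :=
  tendsto_pi_nhds.mp (tendsto_pi_nhds.mp h i) j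

/-- The data of the abstract problems: finitely many well-separated poles and residue data that are
nilpotent and holomorphic near the disks. -/
structure ProblemData (p : ι → ℂ) (A : ι → ℂ → Mat2) (ε : ℝ) (U : Set ℂ) : Prop where
  pos : 0 < ε
  sep : ∀ n m, n ≠ m → 2 * ε < dist (p n) (p m)
  isOpen : IsOpen U
  subset : ∀ n, closedBall (p n) ε ⊆ U
  analytic : ∀ n i j, DifferentiableOn ℂ (fun w => A n w i j) U
  nilpotent : ∀ n w, A n w * A n w = 0

/-- Equal to `F n` on the closed disk about `p n` and to `M` outside all disks. -/
noncomputable def patch {α : Type*} (p : ι → ℂ) (ε : ℝ) (F : ι → ℂ → α) (M : ℂ → α) (w : ℂ) : α :=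
  open Classical in if h : ∃ n, w ∈ closedBall (p n) ε then F h.choose w else M w

theorem patch_of_notMem {α : Type*} {p : ι → ℂ} {ε : ℝ} {F : ι → ℂ → α} {M : ℂ → α} {w : ℂ}
    (h : ∀ n, w ∉ closedBall (p n) ε) : patch p ε F M w = M w :=
  dif_neg fun ⟨n, hn⟩ => h n hn

namespace ProblemData

variable {p : ι → ℂ} {A : ι → ℂ → Mat2} {ε : ℝ} {U : Set ℂ}

theorem eq_of_mem (hd : ProblemData p A ε U) {n m : ι} {w : ℂ} (hn : w ∈ closedBall (p n) ε)
    (hm : w ∈ closedBall (p m) ε) : n = m := by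
  by_contra h
  have h1 := hd.sep n m h
  have h2 := dist_triangle_left (p n) (p m) w
  rw [mem_closedBall] at hn hm
  linarith

theorem patch_of_mem {α : Type*} (hd : ProblemData p A ε U) {F : ι → ℂ → α} {M : ℂ → α} {w : ℂ}
    {n : ι} (h : w ∈ closedBall (p n) ε) : patch p ε F M w = F n w := by
  have h' : ∃ n, w ∈ closedBall (p n) ε := ⟨n, h⟩
  rw [patch, dif_pos h', hd.eq_of_mem h'.choose_spec h]

theorem patch_eventuallyEq_of_mem_ball {α : Type*} (hd : ProblemData p A ε U)
    {F : ι → ℂ → α} {M : ℂ → α} {w : ℂ} {n : ι} (h : w ∈ ball (p n) ε) :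
    patch p ε F M =ᶠ[𝓝 w] F n := by
  filter_upwards [isOpen_ball.mem_nhds h] with z hz
  exact hd.patch_of_mem (ball_subset_closedBall hz)

theorem notMem_spheres_of_mem_ball (hd : ProblemData p A ε U) {n : ι} {w : ℂ}
    (h : w ∈ ball (p n) ε) : w ∈ (⋃ n, sphere (p n) ε)ᶜ := by
  simp only [Set.mem_compl_iff, Set.mem_iUnion, not_exists]
  intro m hm
  obtain rfl := hd.eq_of_mem (ball_subset_closedBall h) (sphere_subset_closedBall hm)
  exact (mem_ball.mp h).ne hm

theorem notMem_spheres_of_notMem {w : ℂ} (h : ∀ n, w ∉ closedBall (p n) ε) :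
    w ∈ (⋃ n, sphere (p n) ε)ᶜ := by
  simp only [Set.mem_compl_iff, Set.mem_iUnion, not_exists]
  exact fun m hm => h m (sphere_subset_closedBall hm)

theorem notMem_range_of_mem (hd : ProblemData p A ε U) {n : ι} {w : ℂ}
    (h : w ∈ closedBall (p n) ε) (hne : w ≠ p n) : w ∈ (Set.range p)ᶜ := by
  rintro ⟨m, rfl⟩
  exact hne (congrArg p (hd.eq_of_mem (mem_closedBall_self hd.pos.le) h))

theorem notMem_range_of_notMem (hd : ProblemData p A ε U) {w : ℂ}
    (h : ∀ n, w ∉ closedBall (p n) ε) : w ∈ (Set.range p)ᶜ := by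
  rintro ⟨m, rfl⟩
  exact h m (mem_closedBall_self hd.pos.le)

theorem differentiableAt_data (hd : ProblemData p A ε U) {n m : ι} {w : ℂ}
    (h : w ∈ closedBall (p n) ε) (i j : Fin 2) : DifferentiableAt ℂ (fun w => A m w i j) w :=
  (hd.analytic m i j).differentiableAt (hd.isOpen.mem_nhds (hd.subset n h))

theorem differentiableAt_jumpFactor (hd : ProblemData p A ε U) {n : ι} {w : ℂ}
    (h : w ∈ closedBall (p n) ε) (hne : w ≠ p n) (i j : Fin 2) :
    DifferentiableAt ℂ (fun w => jumpFactor p A n w i j) w := by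
  simp only [jumpFactor, Matrix.sub_apply, Matrix.smul_apply, smul_eq_mul]
  have h1 : DifferentiableAt ℂ (fun w => (w - p n)⁻¹) w :=
    DifferentiableAt.inv (by fun_prop) (sub_ne_zero.mpr hne)
  exact (differentiableAt_const _).sub (h1.mul (hd.differentiableAt_data h i j))

/-- `M (1 - A / (w - p))` with its singularity at `p` removed. -/
noncomputable def filled (p : ι → ℂ) (A : ι → ℂ → Mat2) (M : ℂ → Mat2) (n : ι) (w : ℂ) : Mat2 :=
  Matrix.of fun i j => Function.update (fun z => (M z * jumpFactor p A n z) i j) (p n)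
    (limUnder (𝓝[≠] (p n)) fun z => (M z * jumpFactor p A n z) i j) w

theorem filled_of_ne {M : ℂ → Mat2} {n : ι} {w : ℂ} (h : w ≠ p n) :
    filled p A M n w = M w * jumpFactor p A n w := by
  ext i j
  simp [filled, h]

variable [Finite ι]

theorem exists_radius (hd : ProblemData p A ε U) (n : ι) :
    ∃ R, ε < R ∧ ∀ m, m ≠ n → ε + R < dist (p m) (p n) := by
  have h : ∀ᶠ R in 𝓝[>] ε, ∀ m, m ≠ n → ε + R < dist (p m) (p n) := by
    rw [eventually_all]
    intro m
    by_cases hm : m = n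
    · exact Eventually.of_forall fun R h => absurd hm h
    · have h1 := hd.sep m n hm
      filter_upwards [Ioo_mem_nhdsGT (show ε < dist (p m) (p n) - ε by linarith)] with R hR _
      linarith [hR.2]
  obtain ⟨R, hR, hR'⟩ := (h.and self_mem_nhdsWithin).exists
  exact ⟨R, hR', hR⟩

theorem eventually_notMem (p : ι → ℂ) (ε : ℝ) {w : ℂ} (h : ∀ n, w ∉ closedBall (p n) ε) :
    ∀ᶠ z in 𝓝 w, ∀ n, z ∉ closedBall (p n) ε := by
  rw [eventually_all]
  exact fun n => isClosed_closedBall.isOpen_compl.mem_nhds (h n)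

/-- Near a circle, outside the corresponding disk, one is outside all disks. -/
theorem eventually_notMem_of_sphere (hd : ProblemData p A ε U) {n : ι} {w : ℂ}
    (hw : w ∈ closedBall (p n) ε) :
    ∀ᶠ z in 𝓝[(closedBall (p n) ε)ᶜ] w, ∀ m, z ∉ closedBall (p m) ε := by
  rw [eventually_all]
  intro m
  by_cases hm : m = n
  · subst hm
    exact self_mem_nhdsWithin
  · exact mem_nhdsWithin_of_mem_nhds
      (isClosed_closedBall.isOpen_compl.mem_nhds fun h => hm (hd.eq_of_mem h hw))

theorem eventually_cocompact_notMem (p : ι → ℂ) (ε : ℝ) :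
    ∀ᶠ w in cocompact ℂ, ∀ n, w ∉ closedBall (p n) ε := by
  rw [eventually_all]
  exact fun n => (isCompact_closedBall (p n) ε).compl_mem_cocompact

theorem tendsto_patch {α : Type*} [TopologicalSpace α] {F : ι → ℂ → α} {M : ℂ → α}
    {a : α} (h : Tendsto M (cocompact ℂ) (𝓝 a)) :
    Tendsto (patch p ε F M) (cocompact ℂ) (𝓝 a) := by
  refine h.congr' ?_
  filter_upwards [eventually_cocompact_notMem p ε] with w hw
  exact (patch_of_notMem hw).symm

theorem patch_eventuallyEq {α : Type*} {F : ι → ℂ → α} {M : ℂ → α} {w : ℂ}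
    (h : ∀ n, w ∉ closedBall (p n) ε) : patch p ε F M =ᶠ[𝓝 w] M := by
  filter_upwards [eventually_notMem p ε h] with z hz
  exact patch_of_notMem hz

theorem isOpen_compl_range (p : ι → ℂ) : IsOpen (Set.range p)ᶜ :=
  (Set.finite_range p).isClosed.isOpen_compl

theorem isOpen_compl_spheres (p : ι → ℂ) (ε : ℝ) : IsOpen (⋃ n, sphere (p n) ε)ᶜ :=
  (isClosed_iUnion_of_finite fun _ => isClosed_sphere).isOpen_compl

theorem differentiableAt_mul_jumpFactor (hd : ProblemData p A ε U) {M : ℂ → Mat2}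
    (hM : ResidueProblem p A M) {n : ι} {w : ℂ} (h : w ∈ closedBall (p n) ε) (hne : w ≠ p n)
    (i j : Fin 2) : DifferentiableAt ℂ (fun z => (M z * jumpFactor p A n z) i j) w :=
  differentiableAt_mul_apply
    (fun i j => (hM.analytic i j).differentiableAt
      ((isOpen_compl_range p).mem_nhds (hd.notMem_range_of_mem h hne)))
    (hd.differentiableAt_jumpFactor h hne) i j

/-- The two limits in the residue condition are the same R, so (w - p) M (1 - A/(w - p)) tends to 0
at p and the singularity is removable. -/
theorem differentiableAt_filled (hd : ProblemData p A ε U) {M : ℂ → Mat2}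
    (hM : ResidueProblem p A M) {n : ι} {w : ℂ} (h : w ∈ closedBall (p n) ε) (i j : Fin 2) :
    DifferentiableAt ℂ (fun z => filled p A M n z i j) w := by
  rcases eq_or_ne w (p n) with rfl | hne
  · have hball : ball (p n) ε ∈ 𝓝 (p n) := ball_mem_nhds _ hd.pos
    have hdiff : DifferentiableOn ℂ (fun z => (M z * jumpFactor p A n z) i j)
        (ball (p n) ε \ {p n}) := fun z hz =>
      (hd.differentiableAt_mul_jumpFactor hM (ball_subset_closedBall hz.1) hz.2
        i j).differentiableWithinAt
    refine (Complex.differentiableOn_update_limUnder_of_isLittleO hball hdiff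
      ?_).differentiableAt hball
    obtain ⟨R, hR₁, hR₂⟩ := hM.residue n
    have hlim : Tendsto (fun z => (z - p n) * (M z * jumpFactor p A n z) i j) (𝓝[≠] (p n))
        (𝓝 0) := by
      have h1 := (tendsto_mat_entry hR₁ i j).sub (tendsto_mat_entry hR₂ i j)
      rw [sub_self] at h1
      refine h1.congr' ?_
      filter_upwards [self_mem_nhdsWithin] with z hz
      have hz' : z - p n ≠ 0 := sub_ne_zero.mpr hz
      simp only [jumpFactor, Matrix.mul_sub, Matrix.mul_one, Matrix.mul_smul, Matrix.sub_apply,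
        Matrix.smul_apply, smul_eq_mul]
      rw [mul_sub, mul_inv_cancel_left₀ hz']
    set c := (M (p n) * jumpFactor p A n (p n)) i j
    have hlim2 : Tendsto (fun z => (z - p n) * c) (𝓝[≠] (p n)) (𝓝 0) := by
      have : Continuous fun z => (z - p n) * c := by fun_prop
      simpa using (this.tendsto (p n)).mono_left nhdsWithin_le_nhds
    rw [isLittleO_iff_tendsto']
    · simpa only [sub_zero, div_inv_eq_mul, mul_comm, mul_sub] using hlim.sub hlim2
    · filter_upwards [self_mem_nhdsWithin] with z hz h0
      exact absurd (inv_eq_zero.mp h0) (sub_ne_zero.mpr hz)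
  · refine (hd.differentiableAt_mul_jumpFactor hM h hne i j).congr_of_eventuallyEq ?_
    filter_upwards [isOpen_ne.mem_nhds hne] with z hz
    rw [filled_of_ne hz]

/-- A solution of the residue problem yields a solution of the jump problem. -/
theorem jumpProblem_patch (hd : ProblemData p A ε U) {M : ℂ → Mat2}
    (hM : ResidueProblem p A M) : JumpProblem p A ε (patch p ε (filled p A M) M) where
  analytic i j w hw := by
    refine DifferentiableAt.differentiableWithinAt ?_
    by_cases h : ∃ n, w ∈ closedBall (p n) ε
    · obtain ⟨n, hn⟩ := h
      have hball : w ∈ ball (p n) ε := by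
        refine (mem_closedBall.mp hn).lt_of_ne fun h => hw ?_
        exact Set.mem_iUnion.mpr ⟨n, h⟩
      refine (hd.differentiableAt_filled hM hn i j).congr_of_eventuallyEq ?_
      filter_upwards [hd.patch_eventuallyEq_of_mem_ball hball] with z hz
      rw [hz]
    · push Not at h
      refine ((hM.analytic i j).differentiableAt ((isOpen_compl_range p).mem_nhds
        (hd.notMem_range_of_notMem h))).congr_of_eventuallyEq ?_
      filter_upwards [patch_eventuallyEq h] with z hz
      rw [hz]
  tendsto_one := tendsto_patch hM.tendsto_one
  jump n := by
    have hMc : ∀ w ∈ sphere (p n) ε, ContinuousAt M w := fun w hw =>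
      continuousAt_of_entries fun i j => (hM.analytic i j).differentiableAt
        ((isOpen_compl_range p).mem_nhds (hd.notMem_range_of_mem (sphere_subset_closedBall hw)
          (ne_of_mem_sphere hw hd.pos.ne')))
    have hfc : ∀ w ∈ sphere (p n) ε, ContinuousAt (filled p A M n) w := fun w hw =>
      continuousAt_of_entries fun i j =>
        hd.differentiableAt_filled hM (sphere_subset_closedBall hw) i j
    refine ⟨filled p A M n, M, fun w hw => (hfc w hw).continuousWithinAt,
      fun w hw => (hMc w hw).continuousWithinAt, fun w hw => ⟨?_, ?_, ?_⟩⟩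
    · refine Tendsto.congr' ?_ (hfc w hw).continuousWithinAt
      filter_upwards [self_mem_nhdsWithin] with z hz
      exact (hd.patch_of_mem (ball_subset_closedBall hz)).symm
    · refine Tendsto.congr' ?_ (hMc w hw).continuousWithinAt
      filter_upwards [hd.eventually_notMem_of_sphere (sphere_subset_closedBall hw)] with z hz
      exact (patch_of_notMem hz).symm
    · exact filled_of_ne (ne_of_mem_sphere hw hd.pos.ne')

/-- A solution of the jump problem is the restriction of a solution of the residue problem. -/
theorem exists_residueProblem (hd : ProblemData p A ε U) {M : ℂ → Mat2}
    (hM : JumpProblem p A ε M) : ∃ M' : ℂ → Mat2, ResidueProblem p A M' ∧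
      (∀ w, (∀ n, w ∉ closedBall (p n) ε) → M' w = M w) ∧
      ∀ n, ∀ w ∈ ball (p n) ε, M' w = M w * jumpFactorInv p A n w := by
  classical
  choose Mp Mm hMp hMm hjump using hM.jump
  -- On the circle itself the outer boundary value is used, as continuity from outside forces.
  let F : ι → ℂ → Mat2 := fun n w =>
    if w ∈ ball (p n) ε then M w * jumpFactorInv p A n w else Mm n w
  have hin : ∀ n, ∀ w ∈ ball (p n) ε, patch p ε F M w = M w * jumpFactorInv p A n w :=
    fun n w hw => by rw [hd.patch_of_mem (ball_subset_closedBall hw)]; exact if_pos hw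
  have hMball : ∀ n, ∀ w ∈ ball (p n) ε, ∀ i j, DifferentiableAt ℂ (fun w => M w i j) w :=
    fun n w hw i j => (hM.analytic i j).differentiableAt
      ((isOpen_compl_spheres p ε).mem_nhds (hd.notMem_spheres_of_mem_ball hw))
  have hMout : ∀ w, (∀ n, w ∉ closedBall (p n) ε) →
      ∀ i j, DifferentiableAt ℂ (fun w => M w i j) w :=
    fun w hw i j => (hM.analytic i j).differentiableAt
      ((isOpen_compl_spheres p ε).mem_nhds (notMem_spheres_of_notMem hw))
  have hanalytic : ∀ n, ∃ R, ε < R ∧ ∀ w ∈ ball (p n) R, w ≠ p n →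
      ∀ i j, DifferentiableAt ℂ (fun w => patch p ε F M w i j) w := by
    intro n
    obtain ⟨R, hεR, hR⟩ := hd.exists_radius n
    refine ⟨R, hεR, fun w hw hne i j => ?_⟩
    have hout : ∀ z ∈ closedBall (p n) R, z ∉ closedBall (p n) ε →
        ∀ m, z ∉ closedBall (p m) ε := by
      intro z hz hzn m hzm
      by_cases hmn : m = n
      · exact hzn (hmn ▸ hzm)
      · have h1 := hR m hmn
        have h2 := dist_triangle_left (p m) (p n) z
        rw [mem_closedBall] at hz hzm
        linarith
    -- Multiplying by z - p clears the pole, so the gluing theorem can be applied to Φ on the whole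
    -- disk of radius R.
    let Φ : ℂ → Mat2 := fun z =>
      if z ∈ ball (p n) ε then (z - p n) • M z + M z * A n z else (z - p n) • patch p ε F M z
    have hΦin : ∀ z ∈ ball (p n) ε, ∀ i j, DifferentiableAt ℂ (fun z => Φ z i j) z := by
      intro z hz i j
      have h1 : DifferentiableAt ℂ (fun z => (z - p n) * M z i j + (M z * A n z) i j) z :=
        DifferentiableAt.add (DifferentiableAt.mul (by fun_prop) (hMball n z hz i j))
          (differentiableAt_mul_apply (hMball n z hz)
            (hd.differentiableAt_data (ball_subset_closedBall hz)) i j)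
      refine h1.congr_of_eventuallyEq ?_
      filter_upwards [isOpen_ball.mem_nhds hz] with y hy
      simp only [Φ, if_pos hy, Matrix.add_apply, Matrix.smul_apply, smul_eq_mul]
    have hΦout : ∀ z ∈ closedBall (p n) R, z ∉ closedBall (p n) ε →
        ∀ i j, DifferentiableAt ℂ (fun z => Φ z i j) z := by
      intro z hz hzn i j
      have h1 : DifferentiableAt ℂ (fun z => (z - p n) * M z i j) z :=
        DifferentiableAt.mul (by fun_prop) (hMout z (hout z hz hzn) i j)
      refine h1.congr_of_eventuallyEq ?_
      filter_upwards [eventually_notMem p ε (hout z hz hzn)] with y hy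
      simp only [Φ, if_neg fun h => hy n (ball_subset_closedBall h), patch_of_notMem hy,
        Matrix.smul_apply, smul_eq_mul]
    have hΦc : ContinuousOn Φ (closedBall (p n) R) := by
      intro z hz
      rcases lt_trichotomy (dist z (p n)) ε with h | h | h
      · exact (continuousAt_of_entries (hΦin z h)).continuousWithinAt
      · obtain ⟨hp, hm, hpm⟩ := hjump n z h
        have hzS : z ∈ sphere (p n) ε := h
        have hzne : z - p n ≠ 0 := sub_ne_zero.mpr (ne_of_mem_sphere hzS hd.pos.ne')
        have hΦS : ∀ y ∈ sphere (p n) ε, Φ y = (y - p n) • Mm n y := by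
          intro y hy
          have hy' : y ∉ ball (p n) ε := fun h => (mem_ball.mp h).ne hy
          simp only [Φ, if_neg hy', hd.patch_of_mem (F := F) (sphere_subset_closedBall hy), F]
        have hsub : Tendsto (fun y : ℂ => y - p n) (𝓝 z) (𝓝 (z - p n)) :=
          (continuous_id.sub continuous_const).tendsto z
        have hΦz := hΦS z hzS
        have hA : Tendsto (A n) (𝓝 z) (𝓝 (A n z)) := continuousAt_of_entries
          (hd.differentiableAt_data (sphere_subset_closedBall hzS))
        have t1 : Tendsto Φ (𝓝[ball (p n) ε] z) (𝓝 (Φ z)) := by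
          have h1 : Tendsto (fun y => (y - p n) • M y + M y * A n y) (𝓝[ball (p n) ε] z)
              (𝓝 ((z - p n) • Mp n z + Mp n z * A n z)) :=
            ((hsub.mono_left nhdsWithin_le_nhds).smul hp).add
              (hp.mul (hA.mono_left nhdsWithin_le_nhds))
          -- The jump condition becomes continuity: (1 - A/(z - p)) ((z - p) + A) = z - p, because
          -- A² = 0.
          have h2 : (z - p n) • Mp n z + Mp n z * A n z = Φ z := by
            rw [hΦz, hpm, jumpFactor, Matrix.mul_sub, Matrix.mul_one, Matrix.sub_mul,
              Matrix.mul_smul, Matrix.smul_mul, Matrix.mul_assoc, hd.nilpotent, smul_sub,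
              smul_smul, mul_inv_cancel₀ hzne]
            simp
          rw [← h2]
          refine h1.congr' ?_
          filter_upwards [self_mem_nhdsWithin] with y hy
          exact (if_pos hy).symm
        have t2 : Tendsto Φ (𝓝[sphere (p n) ε] z) (𝓝 (Φ z)) := by
          rw [hΦz]
          refine ((hsub.mono_left nhdsWithin_le_nhds).smul (hMm n z hzS)).congr' ?_
          filter_upwards [self_mem_nhdsWithin] with y hy
          exact (hΦS y hy).symm
        have t3 : Tendsto Φ (𝓝[(closedBall (p n) ε)ᶜ] z) (𝓝 (Φ z)) := by
          rw [hΦz]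
          refine ((hsub.mono_left nhdsWithin_le_nhds).smul hm).congr' ?_
          filter_upwards [hd.eventually_notMem_of_sphere (sphere_subset_closedBall hzS)] with y hy
          simp only [Φ, if_neg fun h => hy n (ball_subset_closedBall h), patch_of_notMem hy]
        have hcover : (Set.univ : Set ℂ) =
            ball (p n) ε ∪ sphere (p n) ε ∪ (closedBall (p n) ε)ᶜ := by
          rw [ball_union_sphere, Set.union_compl_self]
        refine ContinuousAt.continuousWithinAt ?_
        rw [ContinuousAt, ← nhdsWithin_univ, hcover, nhdsWithin_union, nhdsWithin_union]
        exact (t1.sup t2).sup t3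
      · exact (continuousAt_of_entries (hΦout z hz (by simpa using h))).continuousWithinAt
    have hΦ : DifferentiableOn ℂ (fun z => Φ z i j) (ball (p n) R) :=
      differentiableOn_of_off_circle hd.pos hεR
        (continuousOn_pi.mp (continuousOn_pi.mp hΦc i) j)
        (fun z hz => (hΦin z hz i j).differentiableWithinAt)
        (fun z hz => (hΦout z (ball_subset_closedBall hz.1) hz.2 i j).differentiableWithinAt)
    have h1 : DifferentiableAt ℂ (fun z => (z - p n)⁻¹) w :=
      DifferentiableAt.inv (by fun_prop) (sub_ne_zero.mpr hne)
    refine (h1.mul (hΦ.differentiableAt (isOpen_ball.mem_nhds hw))).congr_of_eventuallyEq ?_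
    filter_upwards [isOpen_ne.mem_nhds hne] with z hz
    have hz' : z - p n ≠ 0 := sub_ne_zero.mpr hz
    by_cases hzb : z ∈ ball (p n) ε
    · simp only [Φ, if_pos hzb, hin n z hzb, jumpFactorInv, Matrix.mul_add, Matrix.mul_one,
        Matrix.mul_smul, Matrix.add_apply, Matrix.smul_apply, smul_eq_mul, Pi.mul_apply]
      field_simp
    · simp only [Φ, if_neg hzb, Matrix.smul_apply, smul_eq_mul, Pi.mul_apply]
      rw [inv_mul_cancel_left₀ hz']
  refine ⟨patch p ε F M, ⟨fun i j w hw => ?_, tendsto_patch hM.tendsto_one, fun n => ?_⟩,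
    fun w hw => patch_of_notMem hw, hin⟩
  · refine DifferentiableAt.differentiableWithinAt ?_
    by_cases h : ∃ n, w ∈ closedBall (p n) ε
    · obtain ⟨n, hn⟩ := h
      obtain ⟨R, hεR, hR⟩ := hanalytic n
      exact hR w (closedBall_subset_ball hεR hn) (fun h => hw ⟨n, h.symm⟩) i j
    · push Not at h
      refine (hMout w h i j).congr_of_eventuallyEq ?_
      filter_upwards [patch_eventuallyEq h] with z hz
      rw [hz]
  · have hball : ball (p n) ε ∈ 𝓝[≠] (p n) :=
      mem_nhdsWithin_of_mem_nhds (ball_mem_nhds _ hd.pos)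
    have hself := mem_ball_self (x := p n) hd.pos
    have hMc : Tendsto M (𝓝[≠] (p n)) (𝓝 (M (p n))) :=
      (continuousAt_of_entries (hMball n _ hself)).tendsto.mono_left nhdsWithin_le_nhds
    have hAc : Tendsto (A n) (𝓝[≠] (p n)) (𝓝 (A n (p n))) :=
      (continuousAt_of_entries (hd.differentiableAt_data
        (ball_subset_closedBall hself))).tendsto.mono_left nhdsWithin_le_nhds
    have hMA := hMc.mul hAc
    -- Inside the disk the new matrix is M + M A/(w - p), with residue M(p) A(p); multiplied by A
    -- its pole disappears by nilpotency.
    refine ⟨M (p n) * A n (p n), ?_, ?_⟩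
    · have hsub : Tendsto (fun w : ℂ => w - p n) (𝓝[≠] (p n)) (𝓝 0) := by
        have : Continuous fun w : ℂ => w - p n := by fun_prop
        simpa using (this.tendsto (p n)).mono_left nhdsWithin_le_nhds
      have h1 := (hsub.smul hMc).add hMA
      rw [zero_smul, zero_add] at h1
      refine h1.congr' ?_
      filter_upwards [hball, self_mem_nhdsWithin] with w hw hne
      rw [hin n w hw, jumpFactorInv, Matrix.mul_add, Matrix.mul_one, Matrix.mul_smul, smul_add,
        smul_smul, mul_inv_cancel₀ (sub_ne_zero.mpr hne), one_smul]
    · refine hMA.congr' ?_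
      filter_upwards [hball] with w hw
      rw [hin n w hw, jumpFactorInv, Matrix.mul_add, Matrix.mul_one, Matrix.mul_smul,
        Matrix.add_mul, Matrix.smul_mul, Matrix.mul_assoc, hd.nilpotent]
      simp

/-- Uniqueness for the residue problem implies uniqueness for the jump problem. -/
theorem jumpProblem_unique (hd : ProblemData p A ε U)
    (huniq : ∀ M M', ResidueProblem p A M → ResidueProblem p A M' →
      Set.EqOn M M' (Set.range p)ᶜ) {M M' : ℂ → Mat2}
    (hM : JumpProblem p A ε M) (hM' : JumpProblem p A ε M') :
    Set.EqOn M M' (⋃ n, sphere (p n) ε)ᶜ := by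
  obtain ⟨L, hL, hLout, hLin⟩ := hd.exists_residueProblem hM
  obtain ⟨L', hL', hLout', hLin'⟩ := hd.exists_residueProblem hM'
  have heq := huniq L L' hL hL'
  intro w hw
  by_cases h : ∃ n, w ∈ closedBall (p n) ε
  · obtain ⟨n, hn⟩ := h
    have hball : w ∈ ball (p n) ε :=
      (mem_closedBall.mp hn).lt_of_ne fun h => hw (Set.mem_iUnion.mpr ⟨n, h⟩)
    have hoff : ∀ z ∈ ball (p n) ε, z ≠ p n → M z = M' z := by
      intro z hz hne
      have h1 := heq (hd.notMem_range_of_mem (ball_subset_closedBall hz) hne)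
      rw [hLin n z hz, hLin' n z hz] at h1
      have h2 := congrArg (· * jumpFactor p A n z) h1
      simpa only [Matrix.mul_assoc, jumpFactorInv_mul_jumpFactor hd.nilpotent,
        Matrix.mul_one] using h2
    -- The jump factors are singular at the center of the disk, where equality follows by
    -- continuity.
    rcases eq_or_ne w (p n) with rfl | hne
    · have hc : ∀ K, JumpProblem p A ε K → Tendsto K (𝓝[≠] (p n)) (𝓝 (K (p n))) := fun K hK =>
        (continuousAt_of_entries fun i j => (hK.analytic i j).differentiableAt
          ((isOpen_compl_spheres p ε).mem_nhds hw)).tendsto.mono_left nhdsWithin_le_nhds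
      refine tendsto_nhds_unique (hc M hM) ((hc M' hM').congr' ?_)
      filter_upwards [mem_nhdsWithin_of_mem_nhds (isOpen_ball.mem_nhds hball),
        self_mem_nhdsWithin] with z hz hzne
      exact (hoff z hz hzne).symm
    · exact hoff w hball hne
  · push Not at h
    rw [← hLout w h, ← hLout' w h, heq (hd.notMem_range_of_notMem h)]

end ProblemData

end AbstractProblem

/-! ### Partial fractions and Liouville's theorem. -/

section PartialFractions

variable {ι : Type*} [Fintype ι]

theorem tendsto_inv_sub_cocompact (a : ℂ) :
    Tendsto (fun w : ℂ => (w - a)⁻¹) (cocompact ℂ) (𝓝 0) := by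
  have h : Tendsto (fun w : ℂ => w - a) (cocompact ℂ) (cocompact ℂ) :=
    (Homeomorph.subRight a).isClosedEmbedding.tendsto_cocompact
  rw [← Metric.cobounded_eq_cocompact] at h ⊢
  exact tendsto_inv₀_cobounded.comp h

theorem tendsto_partialFraction_cocompact (a c : ι → ℂ) :
    Tendsto (fun w => ∑ l, c l / (w - a l)) (cocompact ℂ) (𝓝 0) := by
  have := tendsto_finsetSum Finset.univ fun l (_ : l ∈ Finset.univ) =>
    (tendsto_inv_sub_cocompact (a l)).const_mul (c l)
  simpa [div_eq_mul_inv] using this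

theorem tendsto_mul_partialFraction_cocompact (a c : ι → ℂ) :
    Tendsto (fun w => w * ∑ l, c l / (w - a l)) (cocompact ℂ) (𝓝 (∑ l, c l)) := by
  have h : ∀ l, Tendsto (fun w => w * (c l / (w - a l))) (cocompact ℂ) (𝓝 (c l)) := by
    intro l
    have h1 := ((tendsto_inv_sub_cocompact (a l)).const_mul (c l * a l)).const_add (c l)
    rw [mul_zero, add_zero] at h1
    refine h1.congr' ?_
    filter_upwards [(isCompact_singleton (x := a l)).compl_mem_cocompact] with w hw
    have : w - a l ≠ 0 := sub_ne_zero.mpr hw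
    field_simp
    ring
  simpa only [Finset.mul_sum] using tendsto_finsetSum Finset.univ fun l _ => h l

theorem tendsto_residue_partialFraction {a : ι → ℂ} (ha : Function.Injective a) (c : ι → ℂ)
    (k : ι) : Tendsto (fun w => (w - a k) * ∑ l, c l / (w - a l)) (𝓝[≠] (a k)) (𝓝 (c k)) := by
  classical
  have h : ∀ l, Tendsto (fun w => (w - a k) * (c l / (w - a l))) (𝓝[≠] (a k))
      (𝓝 (if l = k then c k else 0)) := by
    intro l
    by_cases hl : l = k
    · subst hl
      rw [if_pos rfl]
      refine tendsto_const_nhds.congr' ?_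
      filter_upwards [self_mem_nhdsWithin] with w hw
      exact (mul_div_cancel₀ _ (sub_ne_zero.mpr hw)).symm
    · rw [if_neg hl]
      have hc : ContinuousAt (fun w => (w - a k) * (c l / (w - a l))) (a k) := by
        refine ContinuousAt.mul (by fun_prop) (ContinuousAt.div (by fun_prop) (by fun_prop) ?_)
        exact sub_ne_zero.mpr (ha.ne (Ne.symm hl))
      simpa using hc.tendsto.mono_left nhdsWithin_le_nhds
  have := tendsto_finsetSum Finset.univ fun l (_ : l ∈ Finset.univ) => h l
  simpa [Finset.mul_sum] using this

theorem differentiableAt_partialFraction {a : ι → ℂ} (c : ι → ℂ) {w : ℂ} (hw : ∀ l, w ≠ a l) :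
    DifferentiableAt ℂ (fun w => ∑ l, c l / (w - a l)) w :=
  DifferentiableAt.fun_sum fun l _ => (differentiableAt_const _).div (by fun_prop)
    (sub_ne_zero.mpr (hw l))

/-- A function with simple poles that vanishes at infinity is the sum of its principal parts. -/
theorem eq_partialFraction {p : ι → ℂ} (hp : Function.Injective p) {f : ℂ → ℂ}
    (hf : DifferentiableOn ℂ f (Set.range p)ᶜ) (hlim : Tendsto f (cocompact ℂ) (𝓝 0)) (R : ι → ℂ)
    (hres : ∀ n, Tendsto (fun w => (w - p n) * f w) (𝓝[≠] (p n)) (𝓝 (R n))) {w : ℂ}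
    (hw : w ∉ Set.range p) : f w = ∑ n, R n / (w - p n) := by
  have hopen : IsOpen (Set.range p)ᶜ := (Set.finite_range p).isClosed.isOpen_compl
  let g : ℂ → ℂ := fun w => f w - ∑ n, R n / (w - p n)
  have hg : ∀ w ∉ Set.range p, DifferentiableAt ℂ g w := fun w hw =>
    (hf.differentiableAt (hopen.mem_nhds hw)).sub
      (differentiableAt_partialFraction R fun l h => hw ⟨l, h.symm⟩)
  -- Punctured limits extend the difference g across the poles, where its residues cancel. The
  -- extension is entire and vanishes at infinity, hence is 0.
  let h : ℂ → ℂ := fun w => limUnder (𝓝[≠] w) g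
  have hhg : ∀ w ∉ Set.range p, h w = g w := fun w hw =>
    ((hg w hw).continuousAt.tendsto.mono_left nhdsWithin_le_nhds).limUnder_eq
  have hh : Differentiable ℂ h := by
    intro w
    by_cases hw : w ∈ Set.range p
    · obtain ⟨n, rfl⟩ := hw
      have hV : insert (p n) (Set.range p)ᶜ ∈ 𝓝 (p n) := by
        have h1 : (p '' {n}ᶜ)ᶜ ∈ 𝓝 (p n) := by
          refine ((Set.toFinite (p '' {n}ᶜ)).isClosed.isOpen_compl).mem_nhds ?_
          rintro ⟨m, hm, hmn⟩
          exact hm (hp hmn)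
        refine mem_of_superset h1 fun z hz => ?_
        by_cases hzn : z = p n
        · exact Or.inl hzn
        · refine Or.inr ?_
          rintro ⟨m, rfl⟩
          exact hz ⟨m, fun hm => hzn (congrArg p hm), rfl⟩
      have hlittle : (fun z => g z - g (p n)) =o[𝓝[≠] (p n)] fun z => (z - p n)⁻¹ := by
        rw [isLittleO_iff_tendsto']
        · have h1 := (hres n).sub (tendsto_residue_partialFraction hp R n)
          have h2 : Tendsto (fun z => (z - p n) * g (p n)) (𝓝[≠] (p n)) (𝓝 0) := by
            have : Continuous fun z => (z - p n) * g (p n) := by fun_prop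
            simpa using (this.tendsto (p n)).mono_left nhdsWithin_le_nhds
          have h3 := h1.sub h2
          rw [sub_self, sub_zero] at h3
          refine h3.congr fun z => ?_
          simp only [g, div_inv_eq_mul]
          ring
        · filter_upwards [self_mem_nhdsWithin] with z hz h0
          exact absurd (inv_eq_zero.mp h0) (sub_ne_zero.mpr hz)
      have hupd := Complex.differentiableOn_update_limUnder_of_isLittleO hV
        (fun z hz => (hg z (hz.1.resolve_left hz.2)).differentiableWithinAt) hlittle
      refine (hupd.differentiableAt hV).congr_of_eventuallyEq ?_
      filter_upwards [hV] with z hz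
      by_cases hzn : z = p n
      · subst hzn
        rw [Function.update_self]
      · rw [Function.update_of_ne hzn]
        exact hhg z (hz.resolve_left hzn)
    · refine (hg w hw).congr_of_eventuallyEq ?_
      filter_upwards [hopen.mem_nhds hw] with z hz
      exact hhg z hz
  have hh0 : Tendsto h (cocompact ℂ) (𝓝 0) := by
    have h1 := hlim.sub (tendsto_partialFraction_cocompact p R)
    rw [sub_zero] at h1
    refine h1.congr' ?_
    filter_upwards [(Set.finite_range p).isCompact.compl_mem_cocompact] with z hz
    exact (hhg z hz).symm
  have := Differentiable.apply_eq_of_tendsto_cocompact hh w hh0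
  rw [hhg w hw] at this
  exact sub_eq_zero.mp this

end PartialFractions

/-! ### Existence and uniqueness for the soliton Riemann–Hilbert problem. -/

section ConcreteProblem

variable {N : ℕ} {lam : Fin N → ℂ}

/-- The eigenvalues followed by their conjugates. -/
noncomputable def poles (lam : Fin N → ℂ) : Fin N ⊕ Fin N → ℂ :=
  Sum.elim lam fun k => conj (lam k)

/-- The nilpotent residue matrices. -/
noncomputable def residueData (ω : Fin N → ℂ) (Dm t z : ℝ) : Fin N ⊕ Fin N → ℂ → Mat2 :=
  Sum.elim (fun k w => !![0, 0; ω k * Complex.exp (-2 * Complex.I * theta Dm w t z), 0])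
    fun k w => !![0, -conj (ω k) * Complex.exp (2 * Complex.I * theta Dm w t z); 0, 0]

theorem range_poles (lam : Fin N → ℂ) : Set.range (poles lam) = poleSet lam :=
  Set.Sum.elim_range _ _

theorem iUnion_poles (lam : Fin N → ℂ) (S : ℂ → Set ℂ) :
    ⋃ n, S (poles lam n) = ⋃ p ∈ poleSet lam, S p := by
  rw [← range_poles, Set.biUnion_range]

theorem contour_eq (lam : Fin N → ℂ) (ε : ℝ) :
    contour lam ε = ⋃ n, Metric.sphere (poles lam n) ε :=
  (iUnion_poles lam fun p => Metric.sphere p ε).symm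

theorem notMem_closedDisks_iff {lam : Fin N → ℂ} {ε : ℝ} {w : ℂ} :
    w ∉ closedDisks lam ε ↔ ∀ n, w ∉ Metric.closedBall (poles lam n) ε := by
  rw [closedDisks, ← iUnion_poles lam fun p => Metric.closedBall p ε]
  simp

theorem isResidueRHPSolution_iff {ω : Fin N → ℂ} {Dm t z : ℝ} {M : ℂ → Mat2} :
    IsResidueRHPSolution lam ω Dm t z M ↔
      ResidueProblem (poles lam) (residueData ω Dm t z) M := by
  constructor
  · rintro ⟨h1, h2, h3, h4⟩
    exact ⟨by rwa [range_poles], h2, fun n => by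
      rcases n with k | k
      · exact h3 k
      · exact h4 k⟩
  · rintro ⟨h1, h2, h3⟩
    exact ⟨by rwa [range_poles] at h1, h2, fun k => h3 (Sum.inl k), fun k => h3 (Sum.inr k)⟩

theorem jumpMatrix_inv (lam ω : Fin N → ℂ) (Dm t z : ℝ) (k : Fin N) (w : ℂ) :
    (jumpMatrix lam ω Dm t z k w)⁻¹ =
      jumpFactor (poles lam) (residueData ω Dm t z) (Sum.inl k) w := by
  refine inv_eq_right_inv ?_
  ext i j
  fin_cases i <;> fin_cases j <;>
    simp [jumpMatrix, jumpFactor, poles, residueData, mul_apply, div_eq_mul_inv, mul_comm]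

theorem conj_theta (Dm t z : ℝ) (w : ℂ) : conj (theta Dm w t z) = theta Dm (conj w) t z := by
  have h2 : conj (2 : ℂ) = 2 := map_ofNat _ 2
  simp [theta, h2]

theorem jumpMatrix_conjTranspose (lam ω : Fin N → ℂ) (Dm t z : ℝ) (k : Fin N) (w : ℂ) :
    (jumpMatrix lam ω Dm t z k (conj w)).conjTranspose =
      jumpFactor (poles lam) (residueData ω Dm t z) (Sum.inr k) w := by
  have h2 : conj (2 : ℂ) = 2 := map_ofNat _ 2
  ext i j
  fin_cases i <;> fin_cases j <;>
    simp [jumpMatrix, jumpFactor, poles, residueData, conjTranspose_apply, ← Complex.exp_conj,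
      conj_theta, div_eq_mul_inv, h2]
  ring

theorem isJumpRHPSolution_iff {ω : Fin N → ℂ} {Dm t z ε : ℝ} {M : ℂ → Mat2} :
    IsJumpRHPSolution lam ω Dm t z ε M ↔
      JumpProblem (poles lam) (residueData ω Dm t z) ε M := by
  constructor
  · rintro ⟨h1, h2, h3, h4⟩
    refine ⟨by rwa [contour_eq] at h1, h2, fun n => ?_⟩
    rcases n with k | k
    · have h := h3 k
      simp only [jumpMatrix_inv] at h
      exact h
    · have h := h4 k
      simp only [jumpMatrix_conjTranspose] at h
      exact h
  · rintro ⟨h1, h2, h3⟩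
    refine ⟨by rwa [contour_eq], h2, fun k => ?_, fun k => ?_⟩
    · simp only [jumpMatrix_inv]
      exact h3 (Sum.inl k)
    · simp only [jumpMatrix_conjTranspose]
      exact h3 (Sum.inr k)

theorem poles_injective (him : ∀ k, 0 < (lam k).im) (hinj : Function.Injective lam) :
    Function.Injective (poles lam) := by
  refine Function.Injective.sumElim hinj (fun k l h => hinj ((starRingEnd ℂ).injective h)) ?_
  intro k l h
  exact sub_conj_ne_zero him k l (sub_eq_zero.mpr h)

theorem differentiableAt_theta (Dm t z : ℝ) {w : ℂ} (hw : w ≠ 0) :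
    DifferentiableAt ℂ (fun w => theta Dm w t z) w := by
  unfold theta
  exact (differentiableAt_id.mul_const _).sub
    (((differentiableAt_const _).div (by fun_prop) (by simpa using hw)).mul_const _)

theorem differentiableAt_residueData (ω : Fin N → ℂ) (Dm t z : ℝ) (n : Fin N ⊕ Fin N) (i j : Fin 2)
    {w : ℂ} (hw : w ≠ 0) : DifferentiableAt ℂ (fun w => residueData ω Dm t z n w i j) w := by
  have h := differentiableAt_theta Dm t z hw
  rcases n with k | k <;> fin_cases i <;> fin_cases j <;> simp [residueData] <;> fun_prop

/-- The term 1/λ in θ makes the residue data singular at 0, which the disks avoid because they miss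
the real line. -/
theorem problemData (ω : Fin N → ℂ) (Dm t z : ℝ) {ε : ℝ} (hε : AdmissibleRadius lam ε) :
    ProblemData (poles lam) (residueData ω Dm t z) ε {0}ᶜ where
  pos := hε.1
  sep n m hnm := by
    obtain ⟨-, him, hsep⟩ := hε
    have hmix : ∀ k l, 2 * ε < dist (lam k) (conj (lam l)) := by
      intro k l
      rw [Complex.dist_eq]
      refine lt_of_lt_of_le ?_ (Complex.abs_im_le_norm _)
      refine lt_of_lt_of_le ?_ (le_abs_self _)
      rw [Complex.sub_im, Complex.conj_im]
      linarith [him k, him l]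
    rcases n with k | k <;> rcases m with l | l
    · exact hsep k l fun h => hnm (by rw [h])
    · exact hmix k l
    · exact (hmix l k).trans_eq (dist_comm _ _)
    · have h1 := hsep k l fun h => hnm (by rw [h])
      have h2 : dist (conj (lam k)) (conj (lam l)) = dist (lam k) (lam l) :=
        Complex.isometry_conj.dist_eq _ _
      exact h1.trans_eq h2.symm
  isOpen := isOpen_compl_singleton
  subset n w hw h := by
    have h0 : w = 0 := h
    subst h0
    rw [Metric.mem_closedBall, dist_zero_left] at hw
    obtain ⟨-, him, -⟩ := hε
    rcases n with k | k
    · have := (le_abs_self _).trans ((Complex.abs_im_le_norm (lam k)).trans hw)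
      linarith [him k]
    · have hw' : ‖lam k‖ ≤ ε := by rwa [← RCLike.norm_conj (lam k)]
      have := (le_abs_self _).trans ((Complex.abs_im_le_norm (lam k)).trans hw')
      linarith [him k]
  analytic n i j w hw := (differentiableAt_residueData ω Dm t z n i j hw).differentiableWithinAt
  nilpotent n w := by
    ext i j
    rcases n with k | k <;> fin_cases i <;> fin_cases j <;> simp [residueData, mul_apply]

/-- The solution of the Riemann-Hilbert problem with residues `x`, `u` of the first row. -/
noncomputable def solitonMatrix (lam x u : Fin N → ℂ) (w : ℂ) : Mat2 :=
  !![1 + ∑ l, x l / (w - lam l), ∑ l, u l / (w - conj (lam l));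
    ∑ l, -conj (u l) / (w - lam l), 1 + ∑ l, conj (x l) / (w - conj (lam l))]

theorem tendsto_mat2 {l : Filter ℂ} {a b c d : ℂ → ℂ} {a' b' c' d' : ℂ}
    (ha : Tendsto a l (𝓝 a')) (hb : Tendsto b l (𝓝 b')) (hc : Tendsto c l (𝓝 c'))
    (hd : Tendsto d l (𝓝 d')) :
    Tendsto (fun w => !![a w, b w; c w, d w]) l (𝓝 !![a', b'; c', d']) := by
  refine tendsto_pi_nhds.mpr fun i => tendsto_pi_nhds.mpr fun j => ?_
  fin_cases i <;> fin_cases j <;> simpa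

theorem conj_expCoeff (lam ω : Fin N → ℂ) (Dm t z : ℝ) (k : Fin N) :
    conj (expCoeff lam ω Dm t z k) =
      conj (ω k) * Complex.exp (2 * Complex.I * theta Dm (conj (lam k)) t z) := by
  have h2 : conj (2 : ℂ) = 2 := map_ofNat _ 2
  rw [expCoeff, map_mul, ← Complex.exp_conj, map_mul, conj_theta]
  simp [h2]

theorem tendsto_one_add_mul {a b : ℂ → ℂ} {a' : ℂ} {l : Filter ℂ} (hb : Tendsto b l (𝓝 0))
    (h : Tendsto (fun w => b w * a w) l (𝓝 a')) :
    Tendsto (fun w => b w * (1 + a w)) l (𝓝 a') := by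
  simpa [mul_add] using hb.add h

theorem tendsto_sub_self (a : ℂ) : Tendsto (fun w : ℂ => w - a) (𝓝[≠] a) (𝓝 0) := by
  have : Continuous fun w : ℂ => w - a := by fun_prop
  simpa using (this.tendsto a).mono_left nhdsWithin_le_nhds

theorem tendsto_sub_mul_of_differentiableAt {f : ℂ → ℂ} {a : ℂ} (hf : DifferentiableAt ℂ f a) :
    Tendsto (fun w => (w - a) * f w) (𝓝[≠] a) (𝓝 0) := by
  simpa using (tendsto_sub_self a).mul (hf.continuousAt.tendsto.mono_left nhdsWithin_le_nhds)

/-- The residue conditions for the first row are `IsSystemSolution`; its conjugated equations are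
those for the second row. -/
theorem residueProblem_solitonMatrix (him : ∀ k, 0 < (lam k).im) (hinj : Function.Injective lam)
    {ω : Fin N → ℂ} {Dm t z : ℝ} {x u : Fin N → ℂ}
    (h : IsSystemSolution lam (expCoeff lam ω Dm t z) x u) :
    ResidueProblem (poles lam) (residueData ω Dm t z) (solitonMatrix lam x u) where
  analytic i j w hw := by
    have h1 : ∀ l, w ≠ lam l := fun l hl => hw ⟨Sum.inl l, hl.symm⟩
    have h2 : ∀ l, w ≠ conj (lam l) := fun l hl => hw ⟨Sum.inr l, hl.symm⟩
    refine DifferentiableAt.differentiableWithinAt ?_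
    fin_cases i <;> fin_cases j
    · exact (differentiableAt_const _).add (differentiableAt_partialFraction x h1)
    · exact differentiableAt_partialFraction u h2
    · exact differentiableAt_partialFraction _ h1
    · exact (differentiableAt_const _).add (differentiableAt_partialFraction _ h2)
  tendsto_one := by
    have := tendsto_mat2 ((tendsto_partialFraction_cocompact lam x).const_add 1)
      (tendsto_partialFraction_cocompact (fun l => conj (lam l)) u)
      (tendsto_partialFraction_cocompact lam fun l => -conj (u l))
      ((tendsto_partialFraction_cocompact (fun l => conj (lam l)) fun l => conj (x l)).const_add 1)
    rwa [add_zero, ← one_fin_two] at this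
  residue n := by
    have hinj' : Function.Injective fun l => conj (lam l) :=
      fun k l h => hinj ((starRingEnd ℂ).injective h)
    rcases n with k | k
    · have hne : ∀ l, lam k ≠ conj (lam l) := fun l => sub_ne_zero.mp (sub_conj_ne_zero him k l)
      have d1 := differentiableAt_partialFraction (a := fun l => conj (lam l)) u hne
      have d2 := (differentiableAt_const (1 : ℂ)).add (differentiableAt_partialFraction
        (a := fun l => conj (lam l)) (fun l => conj (x l)) hne)
      have dA := (differentiableAt_residueData ω Dm t z (Sum.inl k) 1 0
        (ne_zero_of_im_pos him k)).continuousAt.tendsto.mono_left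
          (nhdsWithin_le_nhds (s := {lam k}ᶜ))
      refine ⟨!![x k, 0; -conj (u k), 0], ?_, ?_⟩
      · have := tendsto_mat2
          (tendsto_one_add_mul (tendsto_sub_self (lam k))
            (tendsto_residue_partialFraction hinj x k))
          (tendsto_sub_mul_of_differentiableAt d1)
          (tendsto_residue_partialFraction hinj (fun l => -conj (u l)) k)
          (tendsto_sub_mul_of_differentiableAt d2)
        refine this.congr fun w => ?_
        simp [solitonMatrix, poles]
      · have t1 := (d1.continuousAt.tendsto.mono_left (nhdsWithin_le_nhds (s := {lam k}ᶜ))).mul dA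
        have t2 := (d2.continuousAt.tendsto.mono_left (nhdsWithin_le_nhds (s := {lam k}ᶜ))).mul dA
        have this := tendsto_mat2 t1 (tendsto_const_nhds (x := (0 : ℂ))) t2
          (tendsto_const_nhds (x := (0 : ℂ)))
        have e1 : (∑ l, u l / (lam k - conj (lam l))) *
            residueData ω Dm t z (Sum.inl k) (lam k) 1 0 = x k := by
          rw [h.x_eq, mul_comm]
          rfl
        have e2 : (1 + ∑ l, conj (x l) / (lam k - conj (lam l))) *
            residueData ω Dm t z (Sum.inl k) (lam k) 1 0 = -conj (u k) := by
          rw [h.conj_u_eq, mul_comm, neg_mul, neg_neg]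
          rfl
        have e3 : !![x k, 0; -conj (u k), 0] = !![(∑ l, u l / (lam k - conj (lam l))) *
            residueData ω Dm t z (Sum.inl k) (lam k) 1 0, 0;
            (1 + ∑ l, conj (x l) / (lam k - conj (lam l))) *
            residueData ω Dm t z (Sum.inl k) (lam k) 1 0, 0] := by rw [e1, e2]
        rw [e3]
        refine this.congr fun w => ?_
        simp [solitonMatrix, residueData]
    · have hne : ∀ l, conj (lam k) ≠ lam l := fun l => sub_ne_zero.mp (conj_sub_ne_zero him k l)
      have d1 := (differentiableAt_const (1 : ℂ)).add (differentiableAt_partialFraction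
        (a := lam) x hne)
      have d2 := differentiableAt_partialFraction (a := lam) (fun l => -conj (u l)) hne
      have dA := (differentiableAt_residueData ω Dm t z (Sum.inr k) 0 1
        (conj_ne_zero_of_im_pos him k)).continuousAt.tendsto.mono_left
          (nhdsWithin_le_nhds (s := {conj (lam k)}ᶜ))
      refine ⟨!![0, u k; 0, conj (x k)], ?_, ?_⟩
      · have := tendsto_mat2
          (tendsto_sub_mul_of_differentiableAt d1)
          (tendsto_residue_partialFraction hinj' u k)
          (tendsto_sub_mul_of_differentiableAt d2)
          (tendsto_one_add_mul (tendsto_sub_self (conj (lam k)))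
            (tendsto_residue_partialFraction hinj' (fun l => conj (x l)) k))
        refine this.congr fun w => ?_
        simp [solitonMatrix, poles]
      · have t1 := (d1.continuousAt.tendsto.mono_left
          (nhdsWithin_le_nhds (s := {conj (lam k)}ᶜ))).mul dA
        have t2 := (d2.continuousAt.tendsto.mono_left
          (nhdsWithin_le_nhds (s := {conj (lam k)}ᶜ))).mul dA
        have this := tendsto_mat2 (tendsto_const_nhds (x := (0 : ℂ))) t1
          (tendsto_const_nhds (x := (0 : ℂ))) t2
        have eA : residueData ω Dm t z (Sum.inr k) (conj (lam k)) 0 1 =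
            -conj (expCoeff lam ω Dm t z k) := by
          rw [conj_expCoeff]
          simp [residueData]
        have e1 : (1 + ∑ l, x l / (conj (lam k) - lam l)) *
            residueData ω Dm t z (Sum.inr k) (conj (lam k)) 0 1 = u k := by
          rw [h.u_eq, eA, mul_comm]
          rfl
        have e2 : (∑ l, -conj (u l) / (conj (lam k) - lam l)) *
            residueData ω Dm t z (Sum.inr k) (conj (lam k)) 0 1 = conj (x k) := by
          rw [h.conj_x_eq, eA, upperSum]
          simp only [neg_div, Finset.sum_neg_distrib]
          ring
        have e3 : !![0, u k; 0, conj (x k)] = !![0, (1 + ∑ l, x l / (conj (lam k) - lam l)) *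
            residueData ω Dm t z (Sum.inr k) (conj (lam k)) 0 1;
            0, (∑ l, -conj (u l) / (conj (lam k) - lam l)) *
            residueData ω Dm t z (Sum.inr k) (conj (lam k)) 0 1] := by rw [e1, e2]
        rw [e3]
        refine this.congr fun w => ?_
        simp [solitonMatrix, residueData]

/-- The residue problem has at most one solution off the poles. -/
theorem residueProblem_unique (him : ∀ k, 0 < (lam k).im) (hinj : Function.Injective lam)
    {ω : Fin N → ℂ} {Dm t z : ℝ} {M M' : ℂ → Mat2}
    (hM : ResidueProblem (poles lam) (residueData ω Dm t z) M)
    (hM' : ResidueProblem (poles lam) (residueData ω Dm t z) M') :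
    Set.EqOn M M' (Set.range (poles lam))ᶜ := by
  choose R hR₁ hR₂ using hM.residue
  choose R' hR₁' hR₂' using hM'.residue
  have hp := poles_injective him hinj
  intro w hw
  ext i j
  have hfrac : ∀ j, ∀ w ∉ Set.range (poles lam),
      M w i j - M' w i j = ∑ n, (R n i j - R' n i j) / (w - poles lam n) := by
    intro j w hw
    refine eq_partialFraction (f := fun w => M w i j - M' w i j) hp
      ((hM.analytic i j).sub (hM'.analytic i j)) ?_ _ (fun n => ?_) hw
    · simpa using (tendsto_mat_entry hM.tendsto_one i j).sub
        (tendsto_mat_entry hM'.tendsto_one i j)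
    · refine ((tendsto_mat_entry (hR₁ n) i j).sub
        (tendsto_mat_entry (hR₁' n) i j)).congr fun w => ?_
      simp [mul_sub]
  have hprod : ∀ n j, Tendsto (fun w => ((M w - M' w) * residueData ω Dm t z n w) i j)
      (𝓝[≠] (poles lam n)) (𝓝 (R n i j - R' n i j)) := by
    intro n j
    refine ((tendsto_mat_entry (hR₂ n) i j).sub
        (tendsto_mat_entry (hR₂' n) i j)).congr fun w => ?_
    rw [Matrix.sub_mul, Matrix.sub_apply]
  -- The residue matrix at λ_k has zero second column, so the second column of M has no pole there;
  -- at the conjugates this holds for the first column.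
  have hz₁ : ∀ k, R (Sum.inl k) i 1 - R' (Sum.inl k) i 1 = 0 := by
    intro k
    refine tendsto_nhds_unique (hprod (Sum.inl k) 1) (tendsto_const_nhds.congr fun w => ?_)
    simp [residueData, mul_apply]
  have hz₂ : ∀ k, R (Sum.inr k) i 0 - R' (Sum.inr k) i 0 = 0 := by
    intro k
    refine tendsto_nhds_unique (hprod (Sum.inr k) 0) (tendsto_const_nhds.congr fun w => ?_)
    simp [residueData, mul_apply]
  have hcol₀ : ∀ w ∉ Set.range (poles lam), M w i 0 - M' w i 0 =
      ∑ l, (R (Sum.inl l) i 0 - R' (Sum.inl l) i 0) / (w - lam l) := by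
    intro w hw
    rw [hfrac 0 w hw, Fintype.sum_sum_type]
    simp [hz₂, poles]
  have hcol₁ : ∀ w ∉ Set.range (poles lam), M w i 1 - M' w i 1 =
      ∑ l, (R (Sum.inr l) i 1 - R' (Sum.inr l) i 1) / (w - conj (lam l)) := by
    intro w hw
    rw [hfrac 1 w hw, Fintype.sum_sum_type]
    simp [hz₁, poles]
  have hnear : ∀ n, ∀ᶠ w in 𝓝[≠] (poles lam n), w ∉ Set.range (poles lam) := by
    intro n
    have h1 : (poles lam '' {n}ᶜ)ᶜ ∈ 𝓝 (poles lam n) := by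
      refine ((Set.toFinite (poles lam '' {n}ᶜ)).isClosed.isOpen_compl).mem_nhds ?_
      rintro ⟨m, hm, hmn⟩
      exact hm (hp hmn)
    filter_upwards [mem_nhdsWithin_of_mem_nhds h1, self_mem_nhdsWithin] with z hz hzn
    rintro ⟨m, rfl⟩
    exact hz ⟨m, fun hm => hzn (congrArg (poles lam) hm), rfl⟩
  -- For either row, the remaining residue conditions on the difference of two solutions are the
  -- homogeneous system.
  have hsys := homogeneous_system him hinj (e := expCoeff lam ω Dm t z)
    (x := fun l => R (Sum.inl l) i 0 - R' (Sum.inl l) i 0)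
    (u := fun l => R (Sum.inr l) i 1 - R' (Sum.inr l) i 1)
    (fun k => by
      have hne : ∀ l, lam k ≠ conj (lam l) := fun l => sub_ne_zero.mp (sub_conj_ne_zero him k l)
      have d1 := differentiableAt_partialFraction (a := fun l => conj (lam l))
        (fun l => R (Sum.inr l) i 1 - R' (Sum.inr l) i 1) hne
      have dA := (differentiableAt_residueData ω Dm t z (Sum.inl k) 1 0
        (ne_zero_of_im_pos him k)).continuousAt.tendsto.mono_left
          (nhdsWithin_le_nhds (s := {lam k}ᶜ))
      have t1 := (d1.continuousAt.tendsto.mono_left (nhdsWithin_le_nhds (s := {lam k}ᶜ))).mul dA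
      have e1 : (∑ l, (R (Sum.inr l) i 1 - R' (Sum.inr l) i 1) / (lam k - conj (lam l))) *
          residueData ω Dm t z (Sum.inl k) (lam k) 1 0 = expCoeff lam ω Dm t z k *
          lowerSum lam (fun l => R (Sum.inr l) i 1 - R' (Sum.inr l) i 1) k := by
        rw [mul_comm]
        rfl
      rw [← e1]
      refine tendsto_nhds_unique (hprod (Sum.inl k) 0) (t1.congr' ?_)
      filter_upwards [hnear (Sum.inl k)] with w hw
      rw [← hcol₁ w hw]
      simp [residueData, mul_apply])
    (fun k => by
      have hne : ∀ l, conj (lam k) ≠ lam l := fun l => sub_ne_zero.mp (conj_sub_ne_zero him k l)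
      have d1 := differentiableAt_partialFraction (a := lam)
        (fun l => R (Sum.inl l) i 0 - R' (Sum.inl l) i 0) hne
      have dA := (differentiableAt_residueData ω Dm t z (Sum.inr k) 0 1
        (conj_ne_zero_of_im_pos him k)).continuousAt.tendsto.mono_left
          (nhdsWithin_le_nhds (s := {conj (lam k)}ᶜ))
      have t1 := (d1.continuousAt.tendsto.mono_left
        (nhdsWithin_le_nhds (s := {conj (lam k)}ᶜ))).mul dA
      have e1 : (∑ l, (R (Sum.inl l) i 0 - R' (Sum.inl l) i 0) / (conj (lam k) - lam l)) *
          residueData ω Dm t z (Sum.inr k) (conj (lam k)) 0 1 = -conj (expCoeff lam ω Dm t z k) *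
          upperSum lam (fun l => R (Sum.inl l) i 0 - R' (Sum.inl l) i 0) k := by
        rw [conj_expCoeff, mul_comm, upperSum]
        simp [residueData]
      rw [← e1]
      refine tendsto_nhds_unique (hprod (Sum.inr k) 1) (t1.congr' ?_)
      filter_upwards [hnear (Sum.inr k)] with w hw
      rw [← hcol₀ w hw]
      simp [residueData, mul_apply])
  rw [← sub_eq_zero]
  fin_cases j
  · refine (hcol₀ w hw).trans (Finset.sum_eq_zero fun l _ => ?_)
    have := congrFun hsys.1 l
    simp only [Pi.zero_apply] at this
    rw [this, zero_div]
  · refine (hcol₁ w hw).trans (Finset.sum_eq_zero fun l _ => ?_)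
    have := congrFun hsys.2 l
    simp only [Pi.zero_apply] at this
    rw [this, zero_div]

end ConcreteProblem

/-! ### Reading off q, D and P. -/

section Reconstruction

variable {N : ℕ} {lam : Fin N → ℂ}

theorem commutator_sigma3 (a b c d : ℂ) :
    !![a, b; c, d] * sigma3 - sigma3 * !![a, b; c, d] = !![0, -2 * b; 2 * c, 0] := by
  ext i j
  fin_cases i <;> fin_cases j <;> simp [sigma3] <;> ring

theorem solitonMatrix_zero (lam x u : Fin N → ℂ) :
    solitonMatrix lam x u 0 = !![diagValue lam x, offDiagValue lam u;
      -conj (offDiagValue lam u), conj (diagValue lam x)] := by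
  ext i j
  fin_cases i <;> fin_cases j <;>
    simp [solitonMatrix, diagValue, offDiagValue, map_sum, div_neg, neg_div, sub_eq_add_neg]

theorem tendsto_commutator_solitonMatrix (lam e : Fin N → ℂ) :
    Tendsto (fun w : ℂ => (Complex.I * w) •
      (solitonMatrix lam (xCoef lam e) (uCoef lam e) w * sigma3 -
        sigma3 * solitonMatrix lam (xCoef lam e) (uCoef lam e) w)) (cocompact ℂ)
      (𝓝 !![0, pulse lam e; -conj (pulse lam e), 0]) := by
  have h2 : conj (2 : ℂ) = 2 := map_ofNat _ 2
  have h := tendsto_mat2 (tendsto_const_nhds (x := (0 : ℂ)))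
    ((tendsto_mul_partialFraction_cocompact (fun l => conj (lam l)) (uCoef lam e)).const_mul
      (-2 * Complex.I))
    ((tendsto_mul_partialFraction_cocompact lam fun l => -conj (uCoef lam e l)).const_mul
      (2 * Complex.I)) (tendsto_const_nhds (x := (0 : ℂ)))
  have hlim : 2 * Complex.I * ∑ l, -conj (uCoef lam e l) = -conj (pulse lam e) := by
    simp [pulse, map_sum, h2]
  rw [hlim] at h
  refine h.congr fun w => ?_
  rw [solitonMatrix, commutator_sigma3]
  ext i j
  fin_cases i <;> fin_cases j <;> simp <;> ring

theorem reconstructs_of_eq {Dm D : ℝ} {M M' : ℂ → Mat2} {q P : ℂ}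
    (h : Reconstructs Dm M q D P) (hinf : M' =ᶠ[cocompact ℂ] M) (h0 : M' 0 = M 0) :
    Reconstructs Dm M' q D P := by
  obtain ⟨h1, h2, h3⟩ := h
  refine ⟨h1.congr' ?_, by rwa [h0], by rwa [h0]⟩
  filter_upwards [hinf] with w hw
  rw [hw]

/-- The normalization puts the matrix in SU(2), so its inverse is its adjoint and the conjugated σ₃
is explicit. -/
theorem smul_conj_sigma3 (Dm : ℝ) {a b : ℂ} (h : a * conj a + b * conj b = 1) :
    (Dm : ℂ) • (!![a, b; -conj b, conj a] * sigma3 * !![a, b; -conj b, conj a]⁻¹) =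
      !![Dm * (a * conj a - b * conj b), -2 * Dm * a * b;
        conj (-2 * Dm * a * b), -(Dm * (a * conj a - b * conj b))] := by
  have h2 : conj (2 : ℂ) = 2 := map_ofNat _ 2
  have hinv : !![a, b; -conj b, conj a]⁻¹ = !![conj a, -b; conj b, a] := by
    refine inv_eq_right_inv ?_
    rw [mul_fin_two, one_fin_two, ← h]
    congr! 3 <;> ring_nf
  rw [hinv, sigma3, mul_fin_two, mul_fin_two, smul_of, smul_cons]
  simp only [map_mul, map_neg, h2, Complex.conj_ofReal, smul_cons, smul_eq_mul, smul_empty]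
  congr! 3 <;> ring_nf

theorem reconstructs_solitonMatrix (him : ∀ k, 0 < (lam k).im) (hinj : Function.Injective lam)
    (Dm : ℝ) (e : Fin N → ℂ) :
    Reconstructs Dm (solitonMatrix lam (xCoef lam e) (uCoef lam e)) (pulse lam e)
      (inversion Dm lam e) (polarization Dm lam e) := by
  have hdet : diagEntry lam e * conj (diagEntry lam e) +
      offDiagEntry lam e * conj (offDiagEntry lam e) = 1 :=
    (isSystemSolution_coef him hinj e).det_eq_one him
  have h0 : solitonMatrix lam (xCoef lam e) (uCoef lam e) 0 =
      !![diagEntry lam e, offDiagEntry lam e;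
        -conj (offDiagEntry lam e), conj (diagEntry lam e)] := solitonMatrix_zero _ _ _
  have hD : (inversion Dm lam e : ℂ) = Dm * (diagEntry lam e * conj (diagEntry lam e) -
      offDiagEntry lam e * conj (offDiagEntry lam e)) := by
    rw [Complex.mul_conj, Complex.mul_conj, inversion]
    push_cast
    rfl
  refine ⟨tendsto_commutator_solitonMatrix lam e, ?_, ?_⟩
  · rw [h0, det_fin_two_of]
    refine isUnit_iff_ne_zero.mpr (ne_of_eq_of_ne ?_ one_ne_zero)
    linear_combination hdet
  · rw [h0, hD, polarization]
    exact smul_conj_sigma3 Dm hdet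

end Reconstruction

/-! ### Bounds away from the poles. -/

section Boundedness

variable {N : ℕ} {lam : Fin N → ℂ}

theorem norm_partialFraction_le {a c : Fin N → ℂ} {B η : ℝ} {w : ℂ} (hη : 0 < η)
    (hc : ‖c‖ ≤ B) (hw : ∀ l, η ≤ dist w (a l)) :
    ‖∑ l, c l / (w - a l)‖ ≤ N * (B / η) := by
  refine (norm_sum_le _ _).trans ((Finset.sum_le_card_nsmul _ _ (B / η) fun l _ => ?_).trans_eq
    (by simp))
  rw [norm_div, ← dist_eq_norm]
  have hB : 0 ≤ B := (norm_nonneg c).trans hc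
  have h1 := (norm_le_pi_norm c l).trans hc
  gcongr
  exact hw l

theorem norm_solitonMatrix_le {x u : Fin N → ℂ} {B η : ℝ} {w : ℂ} (hη : 0 < η)
    (hx : ‖x‖ ≤ B) (hu : ‖u‖ ≤ B) (hw : ∀ p ∈ poleSet lam, η ≤ dist w p) (i j : Fin 2) :
    ‖solitonMatrix lam x u w i j‖ ≤ 1 + N * (B / η) := by
  have h1 : ∀ l, η ≤ dist w (lam l) := fun l => hw _ (Or.inl ⟨l, rfl⟩)
  have h2 : ∀ l, η ≤ dist w (conj (lam l)) := fun l => hw _ (Or.inr ⟨l, rfl⟩)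
  have hB : 0 ≤ B := (norm_nonneg x).trans hx
  have hx' : ‖fun l => conj (x l)‖ ≤ B := (pi_norm_le_iff_of_nonneg hB).mpr fun l => by
    rw [RCLike.norm_conj]
    exact (norm_le_pi_norm x l).trans hx
  have hu' : ‖fun l => -conj (u l)‖ ≤ B := (pi_norm_le_iff_of_nonneg hB).mpr fun l => by
    rw [norm_neg, RCLike.norm_conj]
    exact (norm_le_pi_norm u l).trans hu
  have hadd : ∀ s : ℂ, ‖s‖ ≤ N * (B / η) → ‖1 + s‖ ≤ 1 + N * (B / η) := fun s hs =>
    (norm_add_le _ _).trans (by rw [norm_one]; gcongr)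
  fin_cases i <;> fin_cases j
  · exact hadd _ (norm_partialFraction_le hη hx h1)
  · exact (norm_partialFraction_le hη hu h2).trans (le_add_of_nonneg_left zero_le_one)
  · exact (norm_partialFraction_le hη hu' h1).trans (le_add_of_nonneg_left zero_le_one)
  · exact hadd _ (norm_partialFraction_le hη hx' h2)

/-- The x_k are bounded uniformly in e, and the localization estimate bounds the u_k because its
exponential is at most 1. Hence the constant does not depend on (t, z). -/
theorem exists_solitonMatrix_bound {r : ℝ} {α : Fin N → ℝ} (hr : 0 < r) (hα : StrictMono α)
    (hα_mem : ∀ k, 0 < α k ∧ α k < Real.pi) {ω : Fin N → ℂ} (hω : ∀ k, ω k ≠ 0)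
    {Dm : ℝ} (hDm : Dm = 1 ∨ Dm = -1) {η : ℝ} (hη : 0 < η) :
    ∃ C : ℝ, ∀ (t z : ℝ) (w : ℂ), (∀ p ∈ poleSet (eigenvalue r α), η ≤ dist w p) → ∀ i j,
      ‖solitonMatrix (eigenvalue r α)
        (xCoef (eigenvalue r α) (expCoeff (eigenvalue r α) ω Dm t z))
        (uCoef (eigenvalue r α) (expCoeff (eigenvalue r α) ω Dm t z)) w i j‖ ≤ C := by
  obtain ⟨B₁, hB₁, hx⟩ := exists_xCoef_bound (eigenvalue_im_pos hr hα_mem)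
    (eigenvalue_injective hr hα hα_mem)
  obtain ⟨B₂, κ, hB₂, hκ, hu⟩ := exists_uCoef_expCoeff_bound hr hα hα_mem hω hDm
  refine ⟨1 + N * ((B₁ + B₂) / η), fun t z w hw i j => norm_solitonMatrix_le hη
    ((hx _).trans (by linarith)) ((hu t z).trans ?_) hw i j⟩
  have : Real.exp (-κ * |z - velocity Dm r * t|) ≤ 1 :=
    Real.exp_le_one_iff.mpr (mul_nonpos_of_nonpos_of_nonneg (by linarith) (abs_nonneg _))
  linarith [mul_le_of_le_one_right hB₂ this]

end Boundedness

end MaxwellBloch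

theorem theorem2 {N : ℕ} (hN : 1 ≤ N) (r : ℝ) (hr : 0 < r)
    (α : Fin N → ℝ) (hα : StrictMono α) (hα_mem : ∀ k, 0 < α k ∧ α k < Real.pi)
    (ω : Fin N → ℂ) (hω : ∀ k, ω k ≠ 0)
    (Dm : ℝ) (hDm : Dm = 1 ∨ Dm = -1)
    (lam : Fin N → ℂ) (hlam : lam = MaxwellBloch.eigenvalue r α)
    (V : ℝ) (hV : V = MaxwellBloch.velocity Dm r) :
    ∃ (M : ℝ → ℝ → ℂ → Matrix (Fin 2) (Fin 2) ℂ)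
      (q : ℝ → ℝ → ℂ) (D : ℝ → ℝ → ℝ) (P : ℝ → ℝ → ℂ),
      -- the residue form is uniquely solvable and produces a solution of the equations
      (∀ t z, MaxwellBloch.IsResidueRHPSolution lam ω Dm t z (M t z)) ∧
      (∀ t z M', MaxwellBloch.IsResidueRHPSolution lam ω Dm t z M' →
        Set.EqOn M' (M t z) (MaxwellBloch.poleSet lam)ᶜ) ∧
      (∀ t z, MaxwellBloch.Reconstructs Dm (M t z) (q t z) (D t z) (P t z)) ∧
      MaxwellBloch.IsMBESolution Dm q D P ∧
      -- (1) every soliton of the group has the velocity `V`, and the group as a whole moves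
      -- coherently with this velocity: it never decays along `z = V t`, and at all times it is
      -- concentrated at bounded distance from that line
      (∀ k ξ, (∀ t : ℝ, (MaxwellBloch.theta Dm (lam k) t (ξ * t)).im = 0) ↔ ξ = V) ∧
      ¬ Tendsto (fun t : ℝ => q t (V * t)) atTop (𝓝 0) ∧
      ¬ Tendsto (fun t : ℝ => q t (V * t)) atBot (𝓝 0) ∧
      (∃ C κ : ℝ, 0 < κ ∧ ∀ t z : ℝ,
        ‖q t z‖ ≤ C * Real.exp (-κ * |z - V * t|) ∧
        |D t z - Dm| ≤ C * Real.exp (-κ * |z - V * t|) ∧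
        ‖P t z‖ ≤ C * Real.exp (-κ * |z - V * t|)) ∧
      -- (2) exponential decay along every other direction
      (∀ ξ : ℝ, ξ ≠ V → ∃ κ : ℝ, 0 < κ ∧ ∀ l ∈ ({atTop, atBot} : Set (Filter ℝ)),
        (fun t : ℝ => q t (ξ * t)) =O[l] (fun t : ℝ => Real.exp (-κ * |t|)) ∧
        (fun t : ℝ => D t (ξ * t) - Dm) =O[l] (fun t : ℝ => Real.exp (-κ * |t|)) ∧
        (fun t : ℝ => P t (ξ * t)) =O[l] (fun t : ℝ => Real.exp (-κ * |t|))) ∧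
      -- (3) the center, obtained by matching the leading-order terms of the denominator of `q`
      (∀ t z, MaxwellBloch.solitonDenominator lam ω Dm t z ≠ 0 ∧
        q t z = 2 * Complex.I - 2 * Complex.I *
          (MaxwellBloch.solitonNumerator lam ω Dm t z /
            MaxwellBloch.solitonDenominator lam ω Dm t z)) ∧
      (∀ t c : ℝ,
        MaxwellBloch.IsMatchingCenter (fun z => MaxwellBloch.solitonDenominator lam ω Dm t z) c ↔
          c = V * t + MaxwellBloch.displacement Dm r α ω) ∧
      -- (4) boundedness along `z = V t`, residue form
      (∀ η : ℝ, 0 < η → ∃ C : ℝ, ∀ (t : ℝ) (w : ℂ),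
        (∀ p ∈ MaxwellBloch.poleSet lam, η ≤ dist w p) → ∀ i j, ‖M t (V * t) w i j‖ ≤ C) ∧
      -- the jump form is uniquely solvable, reconstructs the same functions, and its solution is
      -- bounded along `z = V t` outside the disks
      (∀ ε : ℝ, MaxwellBloch.AdmissibleRadius lam ε →
        ∃ M₁ : ℝ → ℝ → ℂ → Matrix (Fin 2) (Fin 2) ℂ,
          (∀ t z, MaxwellBloch.IsJumpRHPSolution lam ω Dm t z ε (M₁ t z)) ∧
          (∀ t z M', MaxwellBloch.IsJumpRHPSolution lam ω Dm t z ε M' →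
            Set.EqOn M' (M₁ t z) (MaxwellBloch.contour lam ε)ᶜ) ∧
          (∀ t z, MaxwellBloch.Reconstructs Dm (M₁ t z) (q t z) (D t z) (P t z)) ∧
          (∀ t z, Set.EqOn (M₁ t z) (M t z) (MaxwellBloch.closedDisks lam ε)ᶜ) ∧
          ∃ C : ℝ, ∀ (t : ℝ), ∀ w ∉ MaxwellBloch.closedDisks lam ε, ∀ i j,
            ‖M₁ t (V * t) w i j‖ ≤ C) := by
  subst hlam hV
  have him := MaxwellBloch.eigenvalue_im_pos hr hα_mem
  have hinj := MaxwellBloch.eigenvalue_injective hr hα hα_mem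
  have hM := fun t z => MaxwellBloch.residueProblem_solitonMatrix him hinj
    (MaxwellBloch.isSystemSolution_coef him hinj
      (MaxwellBloch.expCoeff (MaxwellBloch.eigenvalue r α) ω Dm t z))
  have hrec := fun t z => MaxwellBloch.reconstructs_solitonMatrix him hinj Dm
    (MaxwellBloch.expCoeff (MaxwellBloch.eigenvalue r α) ω Dm t z)
  have hloc := MaxwellBloch.exists_localization hr hα hα_mem hω hDm
  -- The four witnesses, `solitonMatrix` and the three fields, are fixed by unification with the
  -- proofs supplied.
  refine ⟨_, _, _, _, fun t z => MaxwellBloch.isResidueRHPSolution_iff.mpr (hM t z),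
    fun t z M' hM' => ?_, hrec, MaxwellBloch.isMBESolution hr hα hα_mem hω hDm,
    MaxwellBloch.im_theta_eq_zero_iff hr hα_mem hDm,
    MaxwellBloch.not_tendsto_pulse_zero hN hr hα hα_mem hω hDm
      fun t => tendsto_atTop_add_const_right _ _ tendsto_id,
    MaxwellBloch.not_tendsto_pulse_zero hN hr hα hα_mem hω hDm
      fun t => tendsto_atBot_add_const_right _ _ tendsto_id, hloc, fun ξ hξ => ?_,
    fun t z => ⟨MaxwellBloch.systemMatrix_det_ne_zero him hinj _,
      MaxwellBloch.pulse_eq_det him hinj ω Dm t z⟩,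
    MaxwellBloch.isMatchingCenter_solitonDenominator_iff hN hr hα hα_mem hω hDm,
    fun η hη => ?_, fun ε hε => ?_⟩
  · have h := MaxwellBloch.residueProblem_unique him hinj
      (MaxwellBloch.isResidueRHPSolution_iff.mp hM') (hM t z)
    rwa [MaxwellBloch.range_poles] at h
  · obtain ⟨C, κ, hκ, h⟩ := hloc
    exact ⟨κ * |ξ - MaxwellBloch.velocity Dm r|, mul_pos hκ (abs_pos.mpr (sub_ne_zero.mpr hξ)),
      fun l _ => ⟨MaxwellBloch.decay_of_localization (fun t z => (h t z).1) ξ l,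
        MaxwellBloch.decay_of_localization (f := fun t z => _ - Dm) (fun t z => (h t z).2.1) ξ l,
        MaxwellBloch.decay_of_localization (fun t z => (h t z).2.2) ξ l⟩⟩
  · obtain ⟨C, hC⟩ := MaxwellBloch.exists_solitonMatrix_bound hr hα hα_mem hω hDm hη
    exact ⟨C, fun t w hw => hC t _ w hw⟩
  · have hd := fun t z => MaxwellBloch.problemData ω Dm t z hε
    refine ⟨_, fun t z => MaxwellBloch.isJumpRHPSolution_iff.mpr
      ((hd t z).jumpProblem_patch (hM t z)), fun t z M' hM' => ?_, fun t z => ?_,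
      fun t z w hw => MaxwellBloch.patch_of_notMem (MaxwellBloch.notMem_closedDisks_iff.mp hw), ?_⟩
    · have h := (hd t z).jumpProblem_unique
        (fun L L' hL hL' => MaxwellBloch.residueProblem_unique him hinj hL hL')
        (MaxwellBloch.isJumpRHPSolution_iff.mp hM') ((hd t z).jumpProblem_patch (hM t z))
      rwa [← MaxwellBloch.contour_eq] at h
    -- Reconstruction sees only a neighbourhood of infinity and the point 0, both outside the disks,
    -- where the two solutions agree.
    · refine MaxwellBloch.reconstructs_of_eq (hrec t z) ?_ (MaxwellBloch.patch_of_notMem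
        fun n hn => (hd t z).subset n hn rfl)
      filter_upwards [MaxwellBloch.ProblemData.eventually_cocompact_notMem
        (MaxwellBloch.poles (MaxwellBloch.eigenvalue r α)) ε] with w hw
      exact MaxwellBloch.patch_of_notMem hw
    -- Outside the closed disks every pole is at distance at least ε, so the bound for the residue
    -- form applies with η = ε.
    · obtain ⟨C, hC⟩ := MaxwellBloch.exists_solitonMatrix_bound hr hα hα_mem hω hDm hε.1
      refine ⟨C, fun t w hw i j => ?_⟩
      rw [MaxwellBloch.patch_of_notMem (MaxwellBloch.notMem_closedDisks_iff.mp hw)]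
      refine hC t _ w (fun p hp => le_of_not_ge fun h => hw ?_) i j
      exact Set.mem_biUnion hp (Metric.mem_closedBall.mpr h)
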